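/- Let $d\ge 2$, let $M$ be a smooth $d$-manifold (without boundary) with a conformal class $\boldsymbol c=[g]=[\Omega^2 g]$ of smooth Riemannian metrics, and let $\Sigma\subset M$ be a closed (compact, boundaryless) embedded smooth hypersurface. A (smooth) density of weight $w$ is an equivalence class $\boldsymbol f=[g\,;f]=[\Omega^2g\,;\Omega^w f]$, $\Omega>0$ smooth. Let $\boldsymbol\sigma=[g\,;\sigma]$ be a defining density for $\Sigma$: it has weight $1$, zero locus $\Sigma$, and $d\sigma\neq0$ along $\Sigma$. Write $J=\mathrm{Sc}/(2(d-1))$, $n=\nabla\sigma$, $\rho=-\frac1d(\Delta\sigma+J\sigma)$, and let $$\mathcal S=|\nabla\sigma|^2-\tfrac{2\sigma}{d}(\Delta\sigma+\sigma J)$$ be the $\mathcal S$-curvature, a density of weight $0$. The Laplace–Robin operator $D$ maps a density $[g\,;f]$ of weight $w$ to the density of weight $w-1$ $$D\boldsymbol f=\big[g\,;(d+2w-2)(\nabla_n+w\rho)f-\sigma(\Delta+wJ)f\big].$$ For a true scale $\boldsymbol\tau=[g\,;\tau]$ (weight $1$, $\tau>0$), put $$D\log\boldsymbol\tau=\big[g\,;(d-2)(\nabla_n\log\tau+\rho)-\sigma(\Delta\log\tau+J)\big],\qquad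 \nabla^{\sigma}_a\log\boldsymbol\tau=\big[g\,;\sigma\nabla_a\log\tau-n_a\big].$$ Assume that $\mathcal S$ vanishes nowhere. Let $D_0\subset M$ be a measurable region with compact closure which contains a one-sided collar of $\Sigma$, i.e. $U\cap\{\sigma>0\}\subset D_0$ for some open $U\supset\Sigma$. For a true scale $\boldsymbol\tau_{\rm reg}$ (the regulator) let $$\mathrm{Vol}_\varepsilon=\int_{D_0}\frac{\theta(\sigma/\tau_{\rm reg}-\varepsilon)}{\sigma^d}\,dV^g\qquad(\varepsilon>0),$$ where $\theta$ is the indicator function of $[0,\infty)$. Then, for every true scale $\boldsymbol\tau$ (for example $\boldsymbol\tau=\boldsymbol\tau_{\rm reg}$): 1. The function $$\boldsymbol Q^{\boldsymbol\sigma}:=-\frac1{\sqrt{\mathcal S}}\,\big(-D\circ\mathcal S^{-1}\big)^{d-2}\Big(\mathcal S^{-1}D\log\boldsymbol\tau-(\nabla_a\mathcal S^{-1})\,g^{ab}\,\nabla^{\sigma}_b\log\boldsymbol\tau\Big)\Big|_\Sigma$$ is a smooth density of weight $1-d$ along $\Sigma$. 2. The regulated volume is finite for every $\varepsilon>0$,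 and for small $\varepsilon>0$ it has an expansion $$\mathrm{Vol}_\varepsilon=\sum_{k=1}^{d-1}\frac{v_k}{\varepsilon^k}+\mathrm{Vol}_{\rm ren}+\mathcal A\log\varepsilon+\varepsilon\,\mathcal R(\varepsilon)$$ with $\mathcal R$ smooth, in which the anomaly $\mathcal A$ is uniquely determined and equals $$\mathcal A=\frac{1}{(d-1)!\,(d-2)!}\int_\Sigma\boldsymbol Q^{\boldsymbol\sigma} =\frac{1}{(d-1)!\,(d-2)!}\int_\Sigma Q^{\sigma}\,dA^{\bar g},$$ where the last integral is computed with any $g\in\boldsymbol c$, $\boldsymbol Q^{\boldsymbol\sigma}=[g\,;Q^\sigma]$, and the area measure of the metric $\bar g$ induced by $g$ on $\Sigma$. -/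

import Mathlib

open MeasureTheory Set Filter
open scoped Manifold ContDiff Topology

noncomputable section

namespace RenVol

/-! ### Riemannian geometry in the charts of a manifold -/

/-- The model space `ℝⁿ`. -/
abbrev E (n : ℕ) : Type := EuclideanSpace ℝ (Fin n)

/-- A smooth Riemannian metric on the `n`-manifold `M`. -/
abbrev Metric (n : ℕ) (M : Type*) [TopologicalSpace M] [ChartedSpace (E n) M]
    [IsManifold (𝓡 n) ∞ M] : Type _ :=
  Bundle.ContMDiffRiemannianMetric (𝓡 n) ∞ (E n) (fun x : M => TangentSpace (𝓡 n) x)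

/-- A field of real-valued functions of two tangent vectors, such as a metric or the pullback of a
metric under a smooth map. -/
abbrev FormField (n : ℕ) (M : Type*) [TopologicalSpace M] [ChartedSpace (E n) M] : Type _ :=
  ∀ x : M, TangentSpace (𝓡 n) x → TangentSpace (𝓡 n) x → ℝ

/-- The `i`-th standard basis vector of `ℝⁿ`. -/
def stdVec (n : ℕ) (i : Fin n) : E n := EuclideanSpace.single i (1 : ℝ)

/-- The partial derivative `∂ᵢF` of a function on `ℝⁿ`. -/
def pd {n : ℕ} (i : Fin n) (F : E n → ℝ) (u : E n) : ℝ := fderiv ℝ F u (stdVec n i)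

section Manifold

variable {n : ℕ} {M : Type*} [TopologicalSpace M] [ChartedSpace (E n) M]

/-- The inverse of the preferred chart at `p`, a parametrization of a neighbourhood of `p`. -/
def param (p : M) : E n → M := (chartAt (E n) p).symm

/-- The coordinate vector field `∂ᵢ` of the chart at `p`, at the point with coordinates `u`. -/
def coordVec (p : M) (u : E n) (i : Fin n) : TangentSpace (𝓡 n) (param (n := n) p u) :=
  mfderiv 𝓘(ℝ, E n) (𝓡 n) (param (n := n) p) u (stdVec n i)

/-- The Gram matrix `hᵢⱼ(u) = h(∂ᵢ, ∂ⱼ)` of `h` in the chart at `p`. -/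
def gram (h : FormField n M) (p : M) (u : E n) : Matrix (Fin n) (Fin n) ℝ :=
  Matrix.of fun i j => h (param p u) (coordVec p u i) (coordVec p u j)

/-- The volume element `√(det hᵢⱼ) du¹⋯duⁿ` of `h` on the domain of the chart at `p`. -/
def chartVolume [MeasurableSpace M] (h : FormField n M) (p : M) : Measure M :=
  Measure.map (param (n := n) p)
    (((volume : Measure (E n)).restrict (chartAt (E n) p).target).withDensity
      fun u => ENNReal.ofReal (Real.sqrt (gram h p u).det))

/-- A smooth partition of unity subordinate to the domains of the preferred charts. -/
def chartPartition (n : ℕ) (M : Type*) [TopologicalSpace M] [ChartedSpace (E n) M]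
    [IsManifold (𝓡 n) ∞ M] [T2Space M] [SigmaCompactSpace M] :
    SmoothPartitionOfUnity M (𝓡 n) M univ :=
  (SmoothPartitionOfUnity.exists_isSubordinate_chartAt_source (𝓡 n) M).choose

/-- The Riemannian volume measure of `h`: the local volume elements in the charts, patched by a
partition of unity. -/
def volumeMeasure [IsManifold (𝓡 n) ∞ M] [T2Space M] [SigmaCompactSpace M] [MeasurableSpace M]
    (h : FormField n M) : Measure M :=
  Measure.sum fun p : M =>
    (chartVolume h p).withDensity fun x => ENNReal.ofReal (chartPartition n M p x)

variable [IsManifold (𝓡 n) ∞ M]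

/-- A Riemannian metric as a field of bilinear forms. -/
def Metric.form (g : Metric n M) : FormField n M := fun x v w => g.inner x v w

/-- The volume measure `dV^g` of a Riemannian metric. -/
def Metric.vol [T2Space M] [SigmaCompactSpace M] [MeasurableSpace M] (g : Metric n M) :
    Measure M := volumeMeasure (Metric.form g)

/-- The pullback `ι^*g` (the induced metric, or first fundamental form, when `ι` is an
embedding). -/
def Metric.pullback {m : ℕ} {N : Type*} [TopologicalSpace N] [ChartedSpace (E m) N]
    (g : Metric n M) (ι : N → M) : FormField m N :=
  fun y v w => g.inner (ι y) (mfderiv (𝓡 m) (𝓡 n) ι y v) (mfderiv (𝓡 m) (𝓡 n) ι y w)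

/-- The differential `df` at `x`, a covector (its components are `∇ₐf`). -/
def diff (f : M → ℝ) (x : M) : TangentSpace (𝓡 n) x →L[ℝ] ℝ := mvfderiv (𝓡 n) f x

/-- The contraction `gᵃᵇ αₐ β_b` of two covectors at `x` with the inverse metric, computed in the
basis `e₁, …, eₙ` of the tangent space (the value does not depend on the basis). -/
def Metric.dual (g : Metric n M) (x : M) (α β : TangentSpace (𝓡 n) x →L[ℝ] ℝ) : ℝ :=
  let e : Fin n → TangentSpace (𝓡 n) x := fun i => stdVec n i
  let G : Matrix (Fin n) (Fin n) ℝ := Matrix.of fun i j => g.inner x (e i) (e j)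
  ∑ i, ∑ j, G⁻¹ i j * α (e i) * β (e j)

/-- The Laplace–Beltrami operator `Δf = ∇ᵃ∇ₐf`, in coordinates
`(det g)^{-1/2} ∂ᵢ ((det g)^{1/2} gⁱʲ ∂ⱼf)`. -/
def Metric.laplacian (g : Metric n M) (f : M → ℝ) (x : M) : ℝ :=
  let u₀ : E n := chartAt (E n) x x
  let G : E n → Matrix (Fin n) (Fin n) ℝ := gram (Metric.form g) x
  (Real.sqrt (G u₀).det)⁻¹ *
    ∑ i, pd i (fun u => Real.sqrt (G u).det *
      ∑ j, (G u)⁻¹ i j * pd j (fun u' => f (param x u')) u) u₀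

/-- The Christoffel symbols `Γᵏᵢⱼ = ½ gᵏˡ (∂ᵢgⱼₗ + ∂ⱼgᵢₗ - ∂ₗgᵢⱼ)` in the chart at `p`. -/
def Metric.christoffel (g : Metric n M) (p : M) (k i j : Fin n) (u : E n) : ℝ :=
  let G : E n → Matrix (Fin n) (Fin n) ℝ := gram (Metric.form g) p
  (1 / 2) * ∑ l, (G u)⁻¹ k l *
    (pd i (fun u' => G u' j l) u + pd j (fun u' => G u' i l) u - pd l (fun u' => G u' i j) u)

/-- The Ricci curvature `Ricᵢⱼ = ∂ₖΓᵏᵢⱼ - ∂ᵢΓᵏₖⱼ + ΓᵏₖₗΓˡᵢⱼ - ΓᵏᵢₗΓˡₖⱼ` in the chart at `p`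
(so that round spheres have positive Ricci curvature). -/
def Metric.ricci (g : Metric n M) (p : M) (i j : Fin n) (u : E n) : ℝ :=
  let Γ := Metric.christoffel g p
  ∑ k, (pd k (Γ k i j) u - pd i (Γ k k j) u
    + ∑ l, (Γ k k l u * Γ l i j u - Γ k i l u * Γ l k j u))

/-- The scalar curvature `Sc = gⁱʲ Ricᵢⱼ`. -/
def Metric.scalarCurvature (g : Metric n M) (x : M) : ℝ :=
  let u₀ : E n := chartAt (E n) x x
  ∑ i, ∑ j, (gram (Metric.form g) x u₀)⁻¹ i j * Metric.ricci g x i j u₀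

/-- The trace `J = Sc / (2(n-1))` of the Schouten tensor. -/
def Metric.J (g : Metric n M) (x : M) : ℝ := Metric.scalarCurvature g x / (2 * ((n : ℝ) - 1))

/-! ### Conformal densities

A density is a family of functions, one for each metric of the conformal class: the value of the
family at `g` is the function `f` in the representative `[g ; f]`. -/

/-- `g' = Ω²g` with `Ω` smooth and strictly positive. -/
def IsRescaling (g g' : Metric n M) (Ω : M → ℝ) : Prop :=
  ContMDiff (𝓡 n) 𝓘(ℝ) ∞ Ω ∧ (∀ x, 0 < Ω x) ∧
    ∀ (x : M) (v w : TangentSpace (𝓡 n) x), g'.inner x v w = Ω x ^ 2 * g.inner x v w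

/-- The conformal class `[g]`. -/
def conformalClass (g : Metric n M) : Set (Metric n M) := {g' | ∃ Ω, IsRescaling g g' Ω}

/-- A family of functions on `N`, indexed by the metrics on `M`. -/
abbrev Family (n : ℕ) (M : Type*) [TopologicalSpace M] [ChartedSpace (E n) M]
    [IsManifold (𝓡 n) ∞ M] (N : Type*) : Type _ := Metric n M → N → ℝ

/-- `f` is a smooth density of weight `w` along `ι : N → M` for the conformal class `c`:
`[g ; f] = [Ω²g ; Ω^w f]`. -/
def IsDensityAlong {m : ℕ} {N : Type*} [TopologicalSpace N] [ChartedSpace (E m) N]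
    (ι : N → M) (c : Set (Metric n M)) (w : ℝ) (f : Family n M N) : Prop :=
  (∀ g ∈ c, ContMDiff (𝓡 m) 𝓘(ℝ) ∞ (f g)) ∧
    ∀ g ∈ c, ∀ g' ∈ c, ∀ Ω : M → ℝ, IsRescaling g g' Ω →
      ∀ y, f g' y = Ω (ι y) ^ w * f g y

/-- A smooth density of weight `w` on `M`. -/
def IsDensity (c : Set (Metric n M)) (w : ℝ) (f : Family n M M) : Prop :=
  IsDensityAlong (m := n) (fun x : M => x) c w f

/-- A true scale: a strictly positive density of weight `1`. -/
def IsTrueScale (c : Set (Metric n M)) (τ : Family n M M) : Prop :=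
  IsDensity c 1 τ ∧ ∀ g ∈ c, ∀ x, 0 < τ g x

/-- A defining density for the hypersurface `Σ`: a density of weight `1` with zero locus `Σ` and
with nonvanishing differential along `Σ`. -/
def IsDefiningDensity (c : Set (Metric n M)) (Z : Set M) (σ : Family n M M) : Prop :=
  IsDensity c 1 σ ∧ (∀ g ∈ c, {x | σ g x = 0} = Z) ∧
    ∀ g ∈ c, ∀ x ∈ Z, diff (n := n) (σ g) x ≠ 0

/-- `ρ = -(1/n)(Δσ + Jσ)`. -/
def rho (σ : Family n M M) : Family n M M := fun g x =>
  -(1 / (n : ℝ)) * (g.laplacian (σ g) x + g.J x * σ g x)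

/-- The `S`-curvature `S = |∇σ|² - (2σ/n)(Δσ + Jσ)`. -/
def SCurv (σ : Family n M M) : Family n M M := fun g x =>
  g.dual x (diff (σ g) x) (diff (σ g) x)
    - 2 * σ g x / (n : ℝ) * (g.laplacian (σ g) x + σ g x * g.J x)

/-- The Laplace–Robin operator on densities `f` of weight `w`. -/
def laplaceRobin (σ : Family n M M) (w : ℝ) (f : Family n M M) : Family n M M := fun g x =>
  ((n : ℝ) + 2 * w - 2) * (g.dual x (diff (σ g) x) (diff (f g) x) + w * rho σ g x * f g x)
    - σ g x * (g.laplacian (f g) x + w * g.J x * f g x)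

/-- The Laplace–Robin operator on log-densities `l` of weight `w`. -/
def laplaceRobinLog (σ : Family n M M) (w : ℝ) (l : Family n M M) : Family n M M := fun g x =>
  ((n : ℝ) - 2) * (g.dual x (diff (σ g) x) (diff (l g) x) + w * rho σ g x)
    - σ g x * (g.laplacian (l g) x + w * g.J x)

/-- The covector `∇^σₐ l = σ∇ₐl - w∇ₐσ` of a log-density `l` of weight `w`. -/
def nablaSigmaLog (σ : Family n M M) (w : ℝ) (l : Family n M M) (g : Metric n M) (x : M) :
    TangentSpace (𝓡 n) x →L[ℝ] ℝ :=
  σ g x • diff (l g) x - w • diff (σ g) x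

/-- The log-density `log τ` (of weight `1`, for a true scale `τ`). -/
def logFam (τ : Family n M M) : Family n M M := fun g x => Real.log (τ g x)

/-- The weight `-1` density `(S⁻¹ D - (∇ₐS⁻¹) gᵃᵇ ∇^σ_b) log τ`. -/
def innerTerm (σ τ : Family n M M) : Family n M M := fun g x =>
  (SCurv σ g x)⁻¹ * laplaceRobinLog σ 1 (logFam τ) g x
    - g.dual x (diff (fun z => (SCurv σ g z)⁻¹) x) (nablaSigmaLog σ 1 (logFam τ) g x)

/-- The power `(-D S⁻¹)ᵏ f` for a density `f` of weight `w`; each factor lowers the weight by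
one. -/
def negDSinvPow (σ : Family n M M) : ℕ → ℝ → Family n M M → Family n M M
  | 0, _, f => f
  | k + 1, w, f => negDSinvPow σ k (w - 1) fun g x =>
      -laplaceRobin σ w (fun g' z => (SCurv σ g' z)⁻¹ * f g' z) g x

/-- `-S^{-1/2} (-D S⁻¹)^{n-2} (S⁻¹ D - (∇ₐS⁻¹) gᵃᵇ ∇^σ_b) log τ`, before restriction to the
hypersurface. -/
def QCurvBulk (σ τ : Family n M M) : Family n M M := fun g x =>
  -(1 / Real.sqrt (SCurv σ g x)) * negDSinvPow σ (n - 2) (-1) (innerTerm σ τ) g x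

/-- The extrinsically coupled `Q`-curvature `Q^σ`, along the hypersurface `ι : N → M`. -/
def QCurv {N : Type*} (σ τ : Family n M M) (ι : N → M) : Family n M N := fun g y =>
  QCurvBulk σ τ g (ι y)

/-! ### The regulated volume and its anomaly -/

/-- The Heaviside step function, with support `[0, ∞)`. -/
def heaviside (t : ℝ) : ℝ := if 0 ≤ t then 1 else 0

/-- The function `θ(σ/τ - ε) / σⁿ` in the scale `g`. -/
def regIntegrand (σ τ : Family n M M) (ε : ℝ) : Family n M M := fun g x =>
  heaviside (σ g x / τ g x - ε) / σ g x ^ n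

/-- The regulated volume `∫_D θ(σ/τ - ε) / σⁿ dV^g`. -/
def regVolume [T2Space M] [SigmaCompactSpace M] [MeasurableSpace M]
    (σ τ : Family n M M) (D : Set M) (g : Metric n M) (ε : ℝ) : ℝ :=
  ∫ x in D, regIntegrand σ τ ε g x ∂g.vol

end Manifold

/-- `A` is the anomaly of the regulated volume `V` in dimension `d`, i.e. the coefficient of
`log ε` in an expansion
`V(ε) = ∑_{k=1}^{d-1} vₖ ε^{-k} + V_ren + A log ε + ε R(ε)` for small `ε > 0`, with `R` smooth. -/
def HasAnomaly (d : ℕ) (V : ℝ → ℝ) (A : ℝ) : Prop :=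
  ∃ (v : ℕ → ℝ) (Vren : ℝ) (R : ℝ → ℝ), ContDiff ℝ ∞ R ∧
    ∀ᶠ ε in 𝓝[>] (0 : ℝ),
      V ε = ∑ k ∈ Finset.Icc 1 (d - 1), v k / ε ^ k + Vren + A * Real.log ε + ε * R ε

end RenVol

end

noncomputable section
set_option maxSynthPendingDepth 3
set_option linter.unusedSectionVars false

namespace RenVol

/-! ### Linear algebra of contractions -/

section Contraction

open Matrix
open scoped MatrixOrder Matrix.Norms.L2Operator

variable {n : ℕ}

/-! Write `s` for σ in a metric of the class. The regulated volume and the integral of the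
Q-curvature are both conformally invariant, so the metric may be rescaled until the regulator is 1
(`anomaly_eq`); the volume is then the integral of s^{-d} over {s ≥ ε}. Up to an additive constant
only a cutoff χ near Σ matters, and with L(t) = ∫_{s ≥ t} χ the derivative of the volume is
L'(ε)/ε^d. Integrating the Taylor expansion of L' term by term, the logarithm comes from order d-1,
so the anomaly is L^{(d)}(0)/(d-1)! (`IsCutoff.hasAnomaly`).

It remains to express L^{(d)}(0) by an integral over Σ. Let `jet m h` be the m-th derivative at t =
0 of ∫_{s ≥ t} χh, formally (-1)^m ∫ δ^{(m-1)}(s) h. Two rules suffice: multiplication by s lowers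
the order, jet (m+1) (s f) = m · jet m f (`jet_mul_self`), and integration by parts raises it, jet
(m+1) (div(f∇h)) = jet (m+2) (f⟨∇s,∇h⟩) (`jet_gdiv`). Apply the second rule to f∇s and to s∇f with f
= S⁻¹h, and use |∇s|² = S - 2sρ and Δs = -dρ - Js. The combination that isolates the jet of h is the
Laplace–Robin operator in weight w = m+2-d: jet (m+1) (-D(S⁻¹h)) = -w · jet (m+2) h (`jet_robin`).
The factor vanishes in weight 0, which is exactly the step from order d to order d-1 starting at h =
1. The log-density fills this gap: the correction with ∇S⁻¹ makes all terms in log τ cancel, which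
leaves jet d 1 (`jet_inner₀`). This is also why the choice of τ is irrelevant. The remaining factors
multiply to (d-2)!, and the divergence theorem gives jet 1 F = -∫_Σ F/|∇s| with |∇s| = √S on Σ
(`jet_one`).

Smoothness of L is obtained without the coarea formula. The function (s-t)₊²/2 is C¹, so Green's
identity applies to it and exchanges one derivative in t for a divergence (`lev₁_mul_pair`); where
∇s ≠ 0 this can be iterated (`Adm.contDiff_lev`).

The geometric groundwork is needed because the Laplacian and the scalar curvature at a point are
defined in the preferred chart of that point. They are shown to be chart independent by means of the
Levi-Civita connection and orthonormal frames; this yields smoothness of the operators and the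
conformal laws behind the weights. -/

/-- The contraction `Gⁱʲ Rᵢⱼ`. -/
def contr (G R : Matrix (Fin n) (Fin n) ℝ) : ℝ := ∑ i, ∑ j, G⁻¹ i j * R i j

lemma contr_eq_trace (G R : Matrix (Fin n) (Fin n) ℝ) : contr G R = (G⁻¹ * Rᵀ).trace := by
  simp [contr, Matrix.trace, Matrix.mul_apply]

/-- The inverse of AᵀGA is A⁻¹G⁻¹A⁻ᵀ, and the outer factors cancel cyclically under the trace. -/
lemma contr_congr_basis (G R A : Matrix (Fin n) (Fin n) ℝ) (hA : IsUnit A.det) :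
    contr (Aᵀ * G * A) (Aᵀ * R * A) = contr G R := by
  have hA' : IsUnit (Aᵀ).det := by rwa [Matrix.det_transpose]
  rw [contr_eq_trace, contr_eq_trace, Matrix.mul_inv_rev, Matrix.mul_inv_rev,
    Matrix.transpose_mul, Matrix.transpose_mul, Matrix.transpose_transpose]
  have : A⁻¹ * (G⁻¹ * Aᵀ⁻¹) * (Aᵀ * (Rᵀ * A)) = A⁻¹ * (G⁻¹ * Rᵀ * A) := by
    calc A⁻¹ * (G⁻¹ * Aᵀ⁻¹) * (Aᵀ * (Rᵀ * A))
        = A⁻¹ * (G⁻¹ * ((Aᵀ⁻¹ * Aᵀ) * (Rᵀ * A))) := by simp only [Matrix.mul_assoc]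
      _ = _ := by rw [Matrix.nonsing_inv_mul _ hA', Matrix.one_mul, ← Matrix.mul_assoc G⁻¹]
  rw [this, Matrix.trace_mul_comm, Matrix.mul_assoc, Matrix.mul_nonsing_inv _ hA, Matrix.mul_one]

lemma contr_one (R : Matrix (Fin n) (Fin n) ℝ) : contr 1 R = R.trace := by
  rw [contr_eq_trace, inv_one, one_mul, Matrix.trace_transpose]

/-- Positivity in the C*-algebra of matrices gives G = BᵀB; the columns of B⁻¹ form the orthonormal
basis. -/
lemma _root_.Matrix.PosDef.exists_orthonormal {G : Matrix (Fin n) (Fin n) ℝ} (hG : G.PosDef) :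
    ∃ A : Matrix (Fin n) (Fin n) ℝ, IsUnit A.det ∧ Aᵀ * G * A = 1 := by
  obtain ⟨B, rfl⟩ := CStarAlgebra.nonneg_iff_eq_star_mul_self.1 hG.posSemidef.nonneg
  have hB' : IsUnit B.det := by
    have := hG.det_pos.ne'
    rw [Matrix.det_mul] at this
    exact isUnit_iff_ne_zero.2 (right_ne_zero_of_mul this)
  refine ⟨B⁻¹, by simpa using hB', ?_⟩
  rw [Matrix.star_eq_conjTranspose, Matrix.conjTranspose_eq_transpose_of_trivial]
  calc (B⁻¹)ᵀ * (Bᵀ * B) * B⁻¹ = ((B * B⁻¹)ᵀ) * (B * B⁻¹) := by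
        rw [Matrix.transpose_mul]; simp only [Matrix.mul_assoc]
    _ = 1 := by rw [Matrix.mul_nonsing_inv _ hB']; simp

/-- Jacobi's formula. -/
lemma hasFDerivAt_det (G : Fin n → Fin n → ℝ) (hG : IsUnit (Matrix.of G).det) :
    ∃ L : (Fin n → Fin n → ℝ) →L[ℝ] ℝ,
      HasFDerivAt (fun H : Fin n → Fin n → ℝ => (Matrix.of H).det) L G ∧
      ∀ H, L H = (Matrix.of G).det * ((Matrix.of G)⁻¹ * Matrix.of H).trace := by
  have hd : DifferentiableAt ℝ (fun H : Fin n → Fin n → ℝ => (Matrix.of H).det) G := by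
    simp only [Matrix.det_apply, Matrix.of_apply]
    fun_prop
  refine ⟨_, hd.hasFDerivAt, fun H => ?_⟩
  have h1 : HasDerivAt (fun t : ℝ => G + t • H) H 0 := by
    simpa using ((hasDerivAt_id (0 : ℝ)).smul_const H).const_add G
  have h2 : HasDerivAt (fun t : ℝ => (Matrix.of (G + t • H)).det)
      (fderiv ℝ (fun H : Fin n → Fin n → ℝ => (Matrix.of H).det) G H) 0 := by
    have h3 := hd.hasFDerivAt
    have h4 : G = G + (0 : ℝ) • H := by simp
    rw [h4] at h3
    have := h3.comp_hasDerivAt (0 : ℝ) h1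
    simpa using! this
  -- Factoring out G reduces the derivative to that of det(1 + tM) at t = 0, which is read off from
  -- its polynomial expansion.
  set M := (Matrix.of G)⁻¹ * Matrix.of H with hM
  have h3 : ∀ t : ℝ, (Matrix.of (G + t • H)).det = (Matrix.of G).det * (1 + t • M).det := by
    intro t
    rw [← Matrix.det_mul, mul_add, mul_one, Matrix.mul_smul, hM, ← Matrix.mul_assoc,
      Matrix.mul_nonsing_inv _ hG, Matrix.one_mul]
    rfl
  have h4 : HasDerivAt (fun t : ℝ => (Matrix.of G).det * (1 + t • M).det)
      ((Matrix.of G).det * M.trace) 0 := by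
    have h7 := funext fun r : ℝ => Matrix.det_one_add_smul r M
    have h5 : HasDerivAt (fun r : ℝ => 1 + M.trace * r +
        Polynomial.eval r (1 + (Polynomial.X : Polynomial ℝ) • M.map Polynomial.C).det.divX.divX
          * r ^ 2) M.trace 0 := by
      have h6 := ((((hasDerivAt_id (0 : ℝ)).const_mul M.trace).const_add 1).add
        ((Polynomial.hasDerivAt
          (1 + (Polynomial.X : Polynomial ℝ) • M.map Polynomial.C).det.divX.divX 0).mul
          (hasDerivAt_pow 2 (0 : ℝ))))
      simpa using! h6
    rw [← h7] at h5
    exact h5.const_mul _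
  rw [funext h3] at h2
  exact h2.unique h4

end Contraction

/-! ### The Levi-Civita connection and its curvature in an open subset of a vector space -/

lemma two_le_infty : (2 : ℕ∞ω) ≤ ∞ := WithTop.coe_le_coe.2 (le_top : (2 : ℕ∞) ≤ ⊤)

lemma one_add_one_le_infty : ((1 + 1 : ℕ) : ℕ∞ω) ≤ ∞ :=
  WithTop.coe_le_coe.2 (le_top : ((2 : ℕ) : ℕ∞) ≤ ⊤)

section LeviCivita

variable {V : Type*} [NormedAddCommGroup V] [NormedSpace ℝ V] [FiniteDimensional ℝ V]

/-- Bilinear forms on `V`. -/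
abbrev Bil (V : Type*) [NormedAddCommGroup V] [NormedSpace ℝ V] : Type _ := V →L[ℝ] V →L[ℝ] ℝ

/-- Connection coefficients on `V`. -/
abbrev Conn (V : Type*) [NormedAddCommGroup V] [NormedSpace ℝ V] : Type _ := V →L[ℝ] V →L[ℝ] V

/-- `b` is symmetric and positive definite. -/
def IsInner (b : Bil V) : Prop := (∀ X Y, b X Y = b Y X) ∧ ∀ X, X ≠ 0 → 0 < b X X

omit [FiniteDimensional ℝ V] in
lemma IsInner.ext {b : Bil V} (hb : IsInner b) {v w : V} (h : ∀ Z, b v Z = b w Z) : v = w := by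
  by_contra hne
  have := hb.2 (v - w) (sub_ne_zero.2 hne)
  have h' : b v = b w := ContinuousLinearMap.ext h
  rw [map_sub b, h', sub_self] at this
  exact lt_irrefl _ this

/-- The isomorphism with the dual space given by an inner product. -/
def IsInner.equiv {b : Bil V} (hb : IsInner b) : V ≃L[ℝ] (V →L[ℝ] ℝ) :=
  ((LinearEquiv.ofInjectiveOfFinrankEq (b : V →ₗ[ℝ] (V →L[ℝ] ℝ))
    (by
      intro v w h
      exact hb.ext fun Z => by
        have h' : b v = b w := h
        rw [h'])
    (by
      rw [(LinearMap.toContinuousLinearMap (𝕜 := ℝ) (E := V) (F' := ℝ)).symm.finrank_eq]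
      exact (Subspace.dual_finrank_eq).symm))).toContinuousLinearEquiv

lemma IsInner.coe_equiv {b : Bil V} (hb : IsInner b) : (hb.equiv : V →L[ℝ] (V →L[ℝ] ℝ)) = b := by
  ext v w; rfl

/-- `ContinuousLinearMap.inverse` is a total function, zero on non-invertible maps. Nondegeneracy
excludes that case, so the inverse really raises indices. -/
lemma IsInner.apply_inverse {b : Bil V} (hb : IsInner b) (α : V →L[ℝ] ℝ) :
    b (b.inverse α) = α := by
  have h1 : b.inverse = (hb.equiv.symm : (V →L[ℝ] ℝ) →L[ℝ] V) := by
    conv_lhs => rw [← hb.coe_equiv]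
    exact ContinuousLinearMap.inverse_equiv _
  rw [h1]
  exact hb.equiv.apply_symm_apply α

lemma IsInner.contDiffAt_inverse {b : Bil V} (hb : IsInner b) :
    ContDiffAt ℝ ∞ (ContinuousLinearMap.inverse : (V →L[ℝ] (V →L[ℝ] ℝ)) → _) b := by
  conv => rw [← hb.coe_equiv]
  exact contDiffAt_map_inverse hb.equiv

/-- `Γ` is the Levi-Civita connection of the metric `B` at the point `u`. -/
def IsLC (B : V → Bil V) (Γ : V → Conn V) (u : V) : Prop :=
  (∀ X Y, Γ u X Y = Γ u Y X) ∧
    ∀ W X Y, fderiv ℝ B u W X Y = B u (Γ u W X) Y + B u X (Γ u W Y)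

omit [FiniteDimensional ℝ V] in
-- Koszul's argument: the three cyclic permutations of metric compatibility, together with symmetry,
-- determine ⟨Γ(X,Y),Z⟩.
lemma IsLC.unique {B : V → Bil V} {Γ Γ' : V → Conn V} {u : V} (hB : IsInner (B u))
    (h : IsLC B Γ u) (h' : IsLC B Γ' u) : Γ u = Γ' u := by
  ext X Y
  refine hB.ext fun Z => ?_
  have s := hB.1
  have a1 := h.2 X Y Z; have a2 := h.2 Y Z X; have a3 := h.2 Z X Y
  have b1 := h'.2 X Y Z; have b2 := h'.2 Y Z X; have b3 := h'.2 Z X Y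
  rw [h.1 Z X] at a3
  rw [h.1 Y X, h.1 Y Z] at a2
  rw [h'.1 Z X] at b3
  rw [h'.1 Y X, h'.1 Y Z] at b2
  rw [s Y (Γ u X Z)] at a1
  rw [s Z (Γ u X Y)] at a2
  rw [s X (Γ u Z Y)] at a3
  rw [s Y (Γ' u X Z)] at b1
  rw [s Z (Γ' u X Y)] at b2
  rw [s X (Γ' u Z Y)] at b3
  linarith

/-- The Koszul form `(X, Y, Z) ↦ ½ (∂_X B(Y, Z) + ∂_Y B(X, Z) - ∂_Z B(X, Y))`. -/
def koszul (B : V → Bil V) (u : V) : V →L[ℝ] V →L[ℝ] V →L[ℝ] ℝ :=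
  (1 / 2 : ℝ) • (fderiv ℝ B u + (fderiv ℝ B u).flip -
    ((ContinuousLinearMap.flipₗᵢ ℝ V V ℝ).toContinuousLinearEquiv.toContinuousLinearMap) ∘L
      (fderiv ℝ B u).flip)

omit [FiniteDimensional ℝ V] in
lemma koszul_apply (B : V → Bil V) (u X Y Z : V) :
    koszul B u X Y Z = 1 / 2 * (fderiv ℝ B u X Y Z + fderiv ℝ B u Y X Z - fderiv ℝ B u Z X Y) := by
  simp [koszul]

/-- The Levi-Civita connection of `B`. -/
def lc (B : V → Bil V) (u : V) : Conn V :=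
  (ContinuousLinearMap.compL ℝ V (V →L[ℝ] ℝ) V ((B u).inverse)) ∘L koszul B u

omit [FiniteDimensional ℝ V] in
lemma lc_apply (B : V → Bil V) (u X Y : V) : lc B u X Y = (B u).inverse (koszul B u X Y) := rfl

lemma inner_lc {B : V → Bil V} {u : V} (hB : IsInner (B u)) (X Y Z : V) :
    B u (lc B u X Y) Z = koszul B u X Y Z := by
  rw [lc_apply, hB.apply_inverse]

omit [FiniteDimensional ℝ V] in
lemma fderiv_symm {B : V → Bil V} {u : V} (hd : DifferentiableAt ℝ B u)
    (hB : ∀ᶠ v in 𝓝 u, IsInner (B v)) (W X Y : V) :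
    fderiv ℝ B u W X Y = fderiv ℝ B u W Y X := by
  have h1 : HasFDerivAt (fun v => B v X Y) (((fderiv ℝ B u).flip X).flip Y) u := by
    have := (hd.hasFDerivAt.clm_apply (hasFDerivAt_const X u)).clm_apply (hasFDerivAt_const Y u)
    convert! this using 1
    ext; simp
  have h2 : HasFDerivAt (fun v => B v Y X) (((fderiv ℝ B u).flip Y).flip X) u := by
    have := (hd.hasFDerivAt.clm_apply (hasFDerivAt_const Y u)).clm_apply (hasFDerivAt_const X u)
    convert! this using 1
    ext; simp
  have h3 := h2.congr_of_eventuallyEq (f₁ := fun v => B v X Y)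
    (by filter_upwards [hB] with v hv using hv.1 X Y)
  have := congrArg (fun L => L W) (h1.unique h3)
  simpa using this

lemma isLC_lc {B : V → Bil V} {u : V} (hd : DifferentiableAt ℝ B u)
    (hB : ∀ᶠ v in 𝓝 u, IsInner (B v)) : IsLC B (lc B) u := by
  have hu := hB.self_of_nhds
  have s := fderiv_symm hd hB
  refine ⟨fun X Y => hu.ext fun Z => ?_, fun W X Y => ?_⟩
  · rw [inner_lc hu, inner_lc hu, koszul_apply, koszul_apply, s Z X Y]; ring
  · rw [hu.1 X, inner_lc hu, inner_lc hu, koszul_apply, koszul_apply, s W Y X]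
    ring

lemma contDiffAt_lc {B : V → Bil V} {u : V} (hd : ContDiffAt ℝ ∞ B u) (hB : IsInner (B u)) :
    ContDiffAt ℝ ∞ (lc B) u := by
  have h1 : ContDiffAt ℝ ∞ (fderiv ℝ B) u := hd.fderiv_right (by simp)
  have h2 : ContDiffAt ℝ ∞ (koszul B) u := by
    have hf : ContDiffAt ℝ ∞ (fun v => (fderiv ℝ B v).flip) u :=
      (ContinuousLinearMap.flipₗᵢ ℝ V V (V →L[ℝ] ℝ)).contDiff.contDiffAt.comp u h1
    unfold koszul
    exact (contDiff_const_smul (1 / 2 : ℝ)).contDiffAt.comp u ((h1.add hf).sub (contDiffAt_const.clm_comp hf))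
  have h3 : ContDiffAt ℝ ∞ (fun v => (B v).inverse) u := hB.contDiffAt_inverse.comp u hd
  exact ((ContinuousLinearMap.compL ℝ V (V →L[ℝ] ℝ) V).contDiff.contDiffAt.comp u h3).clm_comp h2

/-- The curvature operator `R(X, Y)Z` of the connection `Γ`. -/
def riem (Γ : V → Conn V) (u X Y Z : V) : V :=
  fderiv ℝ Γ u X Y Z - fderiv ℝ Γ u Y X Z + Γ u X (Γ u Y Z) - Γ u Y (Γ u X Z)

/-- The Hessian of `F` with respect to the connection `Γ`. -/
def hess (Γ : V → Conn V) (F : V → ℝ) (u X Y : V) : ℝ :=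
  fderiv ℝ (fderiv ℝ F) u X Y - fderiv ℝ F u (Γ u X Y)

omit [FiniteDimensional ℝ V] in
lemma snd_symm {F' : Type*} [NormedAddCommGroup F'] [NormedSpace ℝ F'] {φ : V → F'} {u : V}
    (hφ : ContDiffAt ℝ ∞ φ u) (X Y : V) :
    fderiv ℝ (fderiv ℝ φ) u X Y = fderiv ℝ (fderiv ℝ φ) u Y X :=
  (hφ.isSymmSndFDerivAt (by simpa using two_le_infty)) X Y

omit [FiniteDimensional ℝ V] in
lemma fderiv_clm_apply₂ {F₁ F₂ F₃ : Type*} [NormedAddCommGroup F₁] [NormedSpace ℝ F₁]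
    [NormedAddCommGroup F₂] [NormedSpace ℝ F₂] [NormedAddCommGroup F₃] [NormedSpace ℝ F₃]
    {C : V → F₁ →L[ℝ] F₂ →L[ℝ] F₃} {p : V → F₁} {q : V → F₂} {u : V}
    (hC : DifferentiableAt ℝ C u) (hp : DifferentiableAt ℝ p u) (hq : DifferentiableAt ℝ q u)
    (X : V) : fderiv ℝ (fun v => C v (p v) (q v)) u X =
      fderiv ℝ C u X (p u) (q u) + C u (fderiv ℝ p u X) (q u) + C u (p u) (fderiv ℝ q u X) := by
  have := ((hC.hasFDerivAt.clm_apply hp.hasFDerivAt).clm_apply hq.hasFDerivAt).fderiv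
  rw [this]
  simp; abel

omit [FiniteDimensional ℝ V] in
lemma fderiv_clm_apply₁ {F₁ F₂ : Type*} [NormedAddCommGroup F₁] [NormedSpace ℝ F₁]
    [NormedAddCommGroup F₂] [NormedSpace ℝ F₂]
    {C : V → F₁ →L[ℝ] F₂} {p : V → F₁} {u : V}
    (hC : DifferentiableAt ℝ C u) (hp : DifferentiableAt ℝ p u)
    (X : V) : fderiv ℝ (fun v => C v (p v)) u X =
      fderiv ℝ C u X (p u) + C u (fderiv ℝ p u X) := by
  have := (hC.hasFDerivAt.clm_apply hp.hasFDerivAt).fderiv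
  rw [this]
  simp; abel

/-- The connection `Γ'` is the pullback of `Γ` by `φ`, at the point `u`. -/
def IsPullbackConn (φ : V → V) (Γ Γ' : V → Conn V) (u : V) : Prop :=
  ∀ X Y, fderiv ℝ φ u (Γ' u X Y) =
    fderiv ℝ (fderiv ℝ φ) u X Y + Γ (φ u) (fderiv ℝ φ u X) (fderiv ℝ φ u Y)

omit [FiniteDimensional ℝ V] in
/-- Tensoriality of the Hessian. -/
lemma hess_comp {Γ Γ' : V → Conn V} {φ : V → V} {F : V → ℝ} {u : V} (hφ : ContDiffAt ℝ ∞ φ u)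
    (hF : ContDiffAt ℝ ∞ F (φ u)) (h : IsPullbackConn φ Γ Γ' u) (X Y : V) :
    hess Γ' (F ∘ φ) u X Y = hess Γ F (φ u) (fderiv ℝ φ u X) (fderiv ℝ φ u Y) := by
  have h1 : fderiv ℝ (F ∘ φ) =ᶠ[𝓝 u] fun v => (fderiv ℝ F (φ v)) ∘L fderiv ℝ φ v := by
    have e1 : ∀ᶠ v in 𝓝 u, ContDiffAt ℝ 1 φ v := (hφ.of_le (by simp)).eventually (by simp)
    have e2 : ∀ᶠ v in 𝓝 u, ContDiffAt ℝ 1 F (φ v) :=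
      hφ.continuousAt.eventually ((hF.of_le (by simp)).eventually (by simp))
    filter_upwards [e1, e2] with v h1 h2
    exact fderiv_comp v (h2.differentiableAt (by simp)) (h1.differentiableAt (by simp))
  have dφ : DifferentiableAt ℝ φ u := hφ.differentiableAt (by simp)
  have dφ' : DifferentiableAt ℝ (fderiv ℝ φ) u :=
    (hφ.fderiv_right (m := 1) one_add_one_le_infty).differentiableAt (by simp)
  have dF' : DifferentiableAt ℝ (fderiv ℝ F) (φ u) :=
    (hF.fderiv_right (m := 1) one_add_one_le_infty).differentiableAt (by simp)
  have dF : DifferentiableAt ℝ F (φ u) := hF.differentiableAt (by simp)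
  have h4 : fderiv ℝ (fderiv ℝ (F ∘ φ)) u X Y = fderiv ℝ F (φ u) (fderiv ℝ (fderiv ℝ φ) u X Y) +
      fderiv ℝ (fderiv ℝ F) (φ u) (fderiv ℝ φ u X) (fderiv ℝ φ u Y) := by
    have dFφ : DifferentiableAt ℝ (fun v => fderiv ℝ F (φ v)) u :=
      DifferentiableAt.comp (g := fderiv ℝ F) u dF' dφ
    have h3 : HasFDerivAt (fun v => fderiv ℝ F (φ v)) ((fderiv ℝ (fderiv ℝ F) (φ u)) ∘L
        fderiv ℝ φ u) u := HasFDerivAt.comp (g := fderiv ℝ F) u dF'.hasFDerivAt dφ.hasFDerivAt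
    have h5 := (h3.clm_comp dφ'.hasFDerivAt).fderiv
    rw [h1.fderiv_eq, h5]
    simp
  -- The term dF(D²φ(X,Y)) is cancelled by the inhomogeneous term in the transformation law of the
  -- connection.
  rw [hess, hess, h4, fderiv_comp u dF dφ, ContinuousLinearMap.comp_apply, h X Y, map_add]
  ring

omit [FiniteDimensional ℝ V] in
/-- Tensoriality of the curvature. -/
lemma riem_comp {Γ Γ' : V → Conn V} {φ : V → V} {u : V} (hφ : ContDiffAt ℝ ∞ φ u)
    (hΓ : DifferentiableAt ℝ Γ (φ u)) (hΓ' : DifferentiableAt ℝ Γ' u)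
    (h : ∀ᶠ v in 𝓝 u, IsPullbackConn φ Γ Γ' v) (X Y Z : V) :
    fderiv ℝ φ u (riem Γ' u X Y Z) =
      riem Γ (φ u) (fderiv ℝ φ u X) (fderiv ℝ φ u Y) (fderiv ℝ φ u Z) := by
  have h0 := h.self_of_nhds
  have dφ : DifferentiableAt ℝ φ u := hφ.differentiableAt (by simp)
  have dφ' : DifferentiableAt ℝ (fderiv ℝ φ) u :=
    (hφ.fderiv_right (m := 1) one_add_one_le_infty).differentiableAt (by simp)
  have hφ1 : ContDiffAt ℝ ∞ (fderiv ℝ φ) u := hφ.fderiv_right (by simp)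
  have dφ'' : DifferentiableAt ℝ (fderiv ℝ (fderiv ℝ φ)) u :=
    (hφ1.fderiv_right (m := 1) one_add_one_le_infty).differentiableAt (by simp)
  have dΓφ : DifferentiableAt ℝ (fun v => Γ (φ v)) u := hΓ.comp u dφ
  -- The derivative of the transformation law in direction W; antisymmetrized in the first two
  -- arguments it becomes the law for the curvature.
  have key : ∀ W A B : V, fderiv ℝ (fderiv ℝ φ) u W (Γ' u A B) +
      fderiv ℝ φ u (fderiv ℝ Γ' u W A B) =
      fderiv ℝ (fderiv ℝ (fderiv ℝ φ)) u W A B +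
      (fderiv ℝ Γ (φ u) (fderiv ℝ φ u W) (fderiv ℝ φ u A) (fderiv ℝ φ u B) +
        Γ (φ u) (fderiv ℝ (fderiv ℝ φ) u W A) (fderiv ℝ φ u B) +
        Γ (φ u) (fderiv ℝ φ u A) (fderiv ℝ (fderiv ℝ φ) u W B)) := by
    intro W A B
    have dc : ∀ C : V, DifferentiableAt ℝ (fun _ : V => C) u := fun C => differentiableAt_const C
    have e1 : (fun v => fderiv ℝ φ v (Γ' v A B)) =ᶠ[𝓝 u] fun v =>
        fderiv ℝ (fderiv ℝ φ) v A B + Γ (φ v) (fderiv ℝ φ v A) (fderiv ℝ φ v B) := by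
      filter_upwards [h] with v hv using hv A B
    have e2 := DFunLike.congr_fun (e1.fderiv_eq (𝕜 := ℝ)) W
    have dA : DifferentiableAt ℝ (fun v => fderiv ℝ φ v A) u := dφ'.clm_apply (dc A)
    have dB : DifferentiableAt ℝ (fun v => fderiv ℝ φ v B) u := dφ'.clm_apply (dc B)
    have dG : DifferentiableAt ℝ (fun v => Γ' v A B) u := (hΓ'.clm_apply (dc A)).clm_apply (dc B)
    have dφAB : DifferentiableAt ℝ (fun v => fderiv ℝ (fderiv ℝ φ) v A B) u :=
      (dφ''.clm_apply (dc A)).clm_apply (dc B)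
    have dΓAB : DifferentiableAt ℝ (fun v => Γ (φ v) (fderiv ℝ φ v A) (fderiv ℝ φ v B)) u :=
      (dΓφ.clm_apply dA).clm_apply dB
    have f1 : fderiv ℝ (fun v => Γ' v A B) u W = fderiv ℝ Γ' u W A B := by
      rw [fderiv_clm_apply₂ hΓ' (dc A) (dc B)]; simp
    have f2 : fderiv ℝ (fun v => fderiv ℝ (fderiv ℝ φ) v A B) u W =
        fderiv ℝ (fderiv ℝ (fderiv ℝ φ)) u W A B := by
      rw [fderiv_clm_apply₂ dφ'' (dc A) (dc B)]; simp
    have f3 : ∀ C : V, fderiv ℝ (fun v => fderiv ℝ φ v C) u W = fderiv ℝ (fderiv ℝ φ) u W C := by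
      intro C
      rw [fderiv_clm_apply₁ dφ' (dc C)]; simp
    have f4 : fderiv ℝ (fun v => Γ (φ v)) u W = fderiv ℝ Γ (φ u) (fderiv ℝ φ u W) := by
      have := fderiv_comp u hΓ dφ
      rw [show (fun v => Γ (φ v)) = Γ ∘ φ from rfl, this]; rfl
    rw [fderiv_clm_apply₁ dφ' dG, f1, fderiv_fun_add dφAB dΓAB, add_apply, f2,
      fderiv_clm_apply₂ dΓφ dA dB, f3, f3, f4] at e2
    exact e2
  -- Third derivatives of φ are symmetric, hence drop out of the antisymmetrization.
  have s3 : fderiv ℝ (fderiv ℝ (fderiv ℝ φ)) u X Y Z = fderiv ℝ (fderiv ℝ (fderiv ℝ φ)) u Y X Z := by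
    rw [snd_symm hφ1 X Y]
  have k1 := key X Y Z
  have k2 := key Y X Z
  have q1 := h0 X (Γ' u Y Z)
  have q2 := h0 Y (Γ' u X Z)
  have q3 := h0 Y Z
  have q4 := h0 X Z
  have s2 : fderiv ℝ (fderiv ℝ φ) u X Y = fderiv ℝ (fderiv ℝ φ) u Y X := snd_symm hφ X Y
  rw [q3, map_add] at q1
  rw [q4, map_add] at q2
  rw [s3, s2] at k1
  rw [riem, riem, map_sub, map_add, map_sub, q1, q2, eq_sub_of_add_eq' k1, eq_sub_of_add_eq' k2]
  abel

omit [FiniteDimensional ℝ V] in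
/-- The pullback of the Levi-Civita connection is the Levi-Civita connection of the pullback. -/
lemma isLC_pullback {B B' : V → Bil V} {Γ Γ' : V → Conn V} {φ : V → V} {u : V}
    (hφ : ContDiffAt ℝ ∞ φ u) (hinj : Function.Injective (fderiv ℝ φ u))
    (hB : DifferentiableAt ℝ B (φ u))
    (h : ∀ᶠ v in 𝓝 u, ∀ X Y, B' v X Y = B (φ v) (fderiv ℝ φ v X) (fderiv ℝ φ v Y))
    (hdB' : DifferentiableAt ℝ B' u)
    (hΓ : IsLC B Γ (φ u))
    (hΓ' : IsPullbackConn φ Γ Γ' u) : IsLC B' Γ' u := by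
  have dφ : DifferentiableAt ℝ φ u := hφ.differentiableAt (by simp)
  have dφ' : DifferentiableAt ℝ (fderiv ℝ φ) u :=
    (hφ.fderiv_right (m := 1) one_add_one_le_infty).differentiableAt (by simp)
  have dc : ∀ C : V, DifferentiableAt ℝ (fun _ : V => C) u := fun C => differentiableAt_const C
  refine ⟨fun X Y => hinj ?_, fun W X Y => ?_⟩
  · rw [hΓ' X Y, hΓ' Y X, snd_symm hφ, hΓ.1]
  · have e1 : (fun v => B' v X Y) =ᶠ[𝓝 u] fun v => B (φ v) (fderiv ℝ φ v X) (fderiv ℝ φ v Y) := by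
      filter_upwards [h] with v hv using hv X Y
    have dBφ : DifferentiableAt ℝ (fun v => B (φ v)) u := DifferentiableAt.comp (g := B) u hB dφ
    have e2 := DFunLike.congr_fun (e1.fderiv_eq (𝕜 := ℝ)) W
    have f3 : ∀ C : V, fderiv ℝ (fun v => fderiv ℝ φ v C) u W = fderiv ℝ (fderiv ℝ φ) u W C := by
      intro C
      rw [fderiv_clm_apply₁ dφ' (dc C)]; simp
    have f4 : fderiv ℝ (fun v => B (φ v)) u W = fderiv ℝ B (φ u) (fderiv ℝ φ u W) := by
      have := fderiv_comp u hB dφ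
      rw [show (fun v => B (φ v)) = B ∘ φ from rfl, this]; rfl
    rw [fderiv_clm_apply₂ hdB' (dc X) (dc Y), fderiv_clm_apply₂ dBφ
      (dφ'.clm_apply (dc X)) (dφ'.clm_apply (dc Y)), f3, f3, f4, hΓ.2] at e2
    simp only [fderiv_fun_const, Pi.zero_apply, zero_apply, map_zero,
      add_zero] at e2
    rw [e2, h.self_of_nhds, h.self_of_nhds, hΓ' W X, hΓ' W Y]
    simp only [map_add, add_apply]
    ring

end LeviCivita

/-! ### Conformal change of the Levi-Civita connection and of the curvature. -/

section ConformalLaw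

variable {V : Type*} [NormedAddCommGroup V] [NormedSpace ℝ V] [FiniteDimensional ℝ V]

/-- The gradient of `F` with respect to the metric `B`. -/
def gradV (B : V → Bil V) (F : V → ℝ) (u : V) : V := (B u).inverse (fderiv ℝ F u)

lemma inner_gradV {B : V → Bil V} {F : V → ℝ} {u : V} (hB : IsInner (B u)) (Y : V) :
    B u (gradV B F u) Y = fderiv ℝ F u Y := by
  rw [gradV, hB.apply_inverse]

lemma contDiffAt_gradV {B : V → Bil V} {F : V → ℝ} {u : V} (hd : ContDiffAt ℝ ∞ B u)
    (hF : ContDiffAt ℝ ∞ F u) (hB : IsInner (B u)) : ContDiffAt ℝ ∞ (gradV B F) u := by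
  have h3 : ContDiffAt ℝ ∞ (fun v => (B v).inverse) u := hB.contDiffAt_inverse.comp u hd
  exact h3.clm_apply (hF.fderiv_right (by simp))

/-- The covariant derivative of the gradient is the Hessian. -/
lemma inner_fderiv_gradV {B : V → Bil V} {F : V → ℝ} {u : V} (hd : ContDiffAt ℝ ∞ B u)
    (hF : ContDiffAt ℝ ∞ F u) (hB : ∀ᶠ v in 𝓝 u, IsInner (B v)) (X Y : V) :
    B u (fderiv ℝ (gradV B F) u X + lc B u X (gradV B F u)) Y = hess (lc B) F u X Y := by
  have hu := hB.self_of_nhds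
  have dB : DifferentiableAt ℝ B u := hd.differentiableAt (by simp)
  have dW : DifferentiableAt ℝ (gradV B F) u :=
    (contDiffAt_gradV hd hF hu).differentiableAt (by simp)
  have dF' : DifferentiableAt ℝ (fderiv ℝ F) u :=
    (hF.fderiv_right (m := 1) one_add_one_le_infty).differentiableAt (by simp)
  have dc : ∀ C : V, DifferentiableAt ℝ (fun _ : V => C) u := fun C => differentiableAt_const C
  have e1 : (fun v => B v (gradV B F v) Y) =ᶠ[𝓝 u] fun v => fderiv ℝ F v Y := by
    filter_upwards [hB] with v hv using inner_gradV hv Y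
  have e2 := DFunLike.congr_fun (e1.fderiv_eq (𝕜 := ℝ)) X
  rw [fderiv_clm_apply₂ dB dW (dc Y), fderiv_clm_apply₁ dF' (dc Y), (isLC_lc dB hB).2] at e2
  simp only [fderiv_fun_const, Pi.zero_apply, zero_apply, map_zero, add_zero] at e2
  have h1 := inner_gradV (F := F) hu (lc B u X Y)
  rw [hess, ← e2, ← h1, map_add]
  simp only [add_apply]
  ring

variable {B : V → Bil V} {η : V → ℝ} {u : V}

omit [FiniteDimensional ℝ V] in
lemma IsInner.smul {b : Bil V} (hb : IsInner b) {c : ℝ} (hc : 0 < c) : IsInner (c • b) := by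
  refine ⟨fun X Y => by simp [hb.1 X Y], fun X hX => ?_⟩
  have := hb.2 X hX
  simp only [smul_apply, smul_eq_mul]
  positivity

/-- The conformal change of the Levi-Civita connection. -/
lemma lc_conformal (hB : DifferentiableAt ℝ B u) (hη : DifferentiableAt ℝ η u)
    (hu : IsInner (B u)) (X Y : V) :
    lc (fun v => Real.exp (2 * η v) • B v) u X Y =
      lc B u X Y + fderiv ℝ η u X • Y + fderiv ℝ η u Y • X - B u X Y • gradV B η u := by
  have hpos : 0 < Real.exp (2 * η u) := Real.exp_pos _
  have hu' := hu.smul hpos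
  refine hu'.ext fun Z => ?_
  have h1 : HasFDerivAt (fun v => Real.exp (2 * η v) • B v)
      (Real.exp (2 * η u) • fderiv ℝ B u +
        (Real.exp (2 * η u) • ((2 : ℝ) • fderiv ℝ η u)).smulRight (B u)) u :=
    ((hη.hasFDerivAt.const_mul 2).exp).smul hB.hasFDerivAt
  have h2 : ∀ X Y Z, fderiv ℝ (fun v => Real.exp (2 * η v) • B v) u X Y Z =
      Real.exp (2 * η u) * (fderiv ℝ B u X Y Z + 2 * fderiv ℝ η u X * B u Y Z) := by
    intro X Y Z
    rw [h1.fderiv]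
    simp
    ring
  rw [inner_lc (B := fun v => Real.exp (2 * η v) • B v) hu', koszul_apply, h2, h2, h2]
  have h3 := inner_lc hu X Y Z
  rw [koszul_apply] at h3
  have h4 := inner_gradV (F := η) hu Z
  simp only [smul_apply, map_add, map_sub, map_smul, add_apply, sub_apply,
    smul_eq_mul, h3, h4]
  ring

/-- The conformal change of sectional curvatures. -/
lemma riem_conformal (hd : ContDiffAt ℝ ∞ B u) (hη : ContDiffAt ℝ ∞ η u)
    (hB : ∀ᶠ v in 𝓝 u, IsInner (B v)) (X Y : V) :
    B u (riem (lc fun v => Real.exp (2 * η v) • B v) u X Y Y) X =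
      B u (riem (lc B) u X Y Y) X + 2 * hess (lc B) η u X Y * B u X Y
        - hess (lc B) η u Y Y * B u X X - B u Y Y * hess (lc B) η u X X
        + fderiv ℝ η u Y ^ 2 * B u X X - B u X X * B u Y Y * B u (gradV B η u) (gradV B η u)
        - 2 * fderiv ℝ η u X * fderiv ℝ η u Y * B u X Y
        + B u X Y ^ 2 * B u (gradV B η u) (gradV B η u) + fderiv ℝ η u X ^ 2 * B u Y Y := by
  have hu := hB.self_of_nhds
  have dB : DifferentiableAt ℝ B u := hd.differentiableAt (by simp)
  have dη : DifferentiableAt ℝ η u := hη.differentiableAt (by simp)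
  have dη' : DifferentiableAt ℝ (fderiv ℝ η) u :=
    (hη.fderiv_right (m := 1) one_add_one_le_infty).differentiableAt (by simp)
  have dW : DifferentiableAt ℝ (gradV B η) u :=
    (contDiffAt_gradV hd hη hu).differentiableAt (by simp)
  have dΓ : DifferentiableAt ℝ (lc B) u := (contDiffAt_lc hd hu).differentiableAt (by simp)
  have hd' : ContDiffAt ℝ ∞ (fun v => Real.exp (2 * η v) • B v) u :=
    ((contDiffAt_const.mul hη).exp).smul hd
  have hu' := hu.smul (Real.exp_pos (2 * η u))
  have dΓ' : DifferentiableAt ℝ (lc fun v => Real.exp (2 * η v) • B v) u :=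
    (contDiffAt_lc (B := fun v => Real.exp (2 * η v) • B v) hd' hu').differentiableAt (by simp)
  have dc : ∀ C : V, DifferentiableAt ℝ (fun _ : V => C) u := fun C => differentiableAt_const C
  have eB : ∀ᶠ v in 𝓝 u, DifferentiableAt ℝ B v := by
    filter_upwards [(hd.of_le (m := 1) (by simp)).eventually (by simp)] with v hv
      using hv.differentiableAt (by simp)
  have eη : ∀ᶠ v in 𝓝 u, DifferentiableAt ℝ η v := by
    filter_upwards [(hη.of_le (m := 1) (by simp)).eventually (by simp)] with v hv
      using hv.differentiableAt (by simp)
  -- The conformal law of the connection holds in a neighbourhood, so it can be differentiated; Q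
  -- and R are held fixed.
  have key : ∀ P Q R : V, fderiv ℝ (lc fun v => Real.exp (2 * η v) • B v) u P Q R =
      fderiv ℝ (lc B) u P Q R + fderiv ℝ (fderiv ℝ η) u P Q • R + fderiv ℝ (fderiv ℝ η) u P R • Q
        - (fderiv ℝ B u P Q R • gradV B η u + B u Q R • fderiv ℝ (gradV B η) u P) := by
    intro P Q R
    have e1 : (fun v => lc (fun v => Real.exp (2 * η v) • B v) v Q R) =ᶠ[𝓝 u] fun v =>
        lc B v Q R + fderiv ℝ η v Q • R + fderiv ℝ η v R • Q - B v Q R • gradV B η v := by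
      filter_upwards [eB, eη, hB] with v h1 h2 h3 using lc_conformal h1 h2 h3 Q R
    have e2 := DFunLike.congr_fun (e1.fderiv_eq (𝕜 := ℝ)) P
    have d1 : HasFDerivAt (fun v => lc B v Q R) (((fderiv ℝ (lc B) u).flip Q).flip R) u := by
      convert! (dΓ.hasFDerivAt.clm_apply (hasFDerivAt_const Q u)).clm_apply
        (hasFDerivAt_const R u) using 1
      ext; simp
    have d2 : ∀ A : V, HasFDerivAt (fun v => fderiv ℝ η v A) ((fderiv ℝ (fderiv ℝ η) u).flip A) u := by
      intro A
      convert! dη'.hasFDerivAt.clm_apply (hasFDerivAt_const A u) using 1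
      ext; simp
    have d3 : HasFDerivAt (fun v => B v Q R) (((fderiv ℝ B u).flip Q).flip R) u := by
      convert! (dB.hasFDerivAt.clm_apply (hasFDerivAt_const Q u)).clm_apply
        (hasFDerivAt_const R u) using 1
      ext; simp
    have d4 := (((d1.add ((d2 Q).smul_const R)).add ((d2 R).smul_const Q)).sub
      (d3.smul dW.hasFDerivAt)).fderiv
    have d5 : fderiv ℝ (fun v => lc B v Q R + fderiv ℝ η v Q • R + fderiv ℝ η v R • Q -
      B v Q R • gradV B η v) u P = _ := DFunLike.congr_fun d4 P
    rw [fderiv_clm_apply₂ dΓ' (dc Q) (dc R), d5] at e2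
    simp only [fderiv_fun_const, Pi.zero_apply, zero_apply, map_zero, add_zero] at e2
    rw [e2]
    simp [add_comm]
  have conf := lc_conformal dB dη hu
  have s := hu.1
  have LC := isLC_lc dB hB
  have gX := fun Z => inner_gradV (F := η) hu Z
  have gX' : ∀ Z, B u Z (gradV B η u) = fderiv ℝ η u Z := fun Z => by rw [s, gX]
  have H := fun P Q => inner_fderiv_gradV hd hη hB P Q
  have h1 := H X X
  have h2 := H Y X
  have h3 := snd_symm hη X Y
  simp only [map_add, add_apply] at h1 h2
  have g1 := inner_gradV (F := η) hu (lc B u X X)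
  have l1 := LC.2 X Y Y
  have l2 := LC.2 Y X Y
  have l3 : lc B u Y X = lc B u X Y := LC.1 Y X
  have hXY : hess (lc B) η u Y X = hess (lc B) η u X Y := by
    rw [hess, hess, h3, l3]
  rw [hXY] at h2
  rw [riem, riem, key, key, conf X, conf Y Y, conf Y, conf X Y]
  simp only [map_add, add_apply, map_sub, sub_apply, map_smul, smul_eq_mul,
    smul_apply, smul_add, smul_sub, l1, l2, l3, gX, gX', h3, s Y X]
  simp only [hess, h3] at h1 h2 ⊢
  -- What remains after expansion is the covariant derivative of the gradient of η, paired with X.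
  -- It enters with coefficients B(Y,Y) and B(X,Y), and `h1`, `h2` turn it into Hessians.
  linear_combination (-(B u Y Y)) * h1 + B u X Y * h2

end ConformalLaw

/-! ### Index formulas for the Laplacian and the curvature, and orthonormal frames. -/

section Coordinates

variable {n : ℕ}

lemma stdVec_apply (i j : Fin n) : stdVec n i j = if j = i then 1 else 0 := by
  simp [stdVec]

lemma sum_smul_stdVec (X : E n) : ∑ i, X i • stdVec n i = X := by
  ext j
  simp [stdVec_apply]

/-- The bilinear form with Gram matrix `G` in the standard basis. -/
def bil (G : Matrix (Fin n) (Fin n) ℝ) : Bil (E n) :=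
  ∑ i, ∑ j, G i j • (EuclideanSpace.proj i : E n →L[ℝ] ℝ).smulRight
    (EuclideanSpace.proj j : E n →L[ℝ] ℝ)

lemma bil_apply (G : Matrix (Fin n) (Fin n) ℝ) (X Y : E n) :
    bil G X Y = ∑ i, ∑ j, G i j * X i * Y j := by
  simp [bil, mul_assoc]

@[simp] lemma bil_stdVec (G : Matrix (Fin n) (Fin n) ℝ) (i j : Fin n) :
    bil G (stdVec n i) (stdVec n j) = G i j := by
  simp [bil_apply, stdVec_apply]

lemma bil_eq_of_basis {b : Bil (E n)} {G : Matrix (Fin n) (Fin n) ℝ}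
    (h : ∀ i j, b (stdVec n i) (stdVec n j) = G i j) : b = bil G := by
  ext X Y
  conv_lhs => rw [← sum_smul_stdVec X, ← sum_smul_stdVec Y]
  rw [bil_apply]
  simp only [map_sum, map_smul, sum_apply, smul_apply, h, smul_eq_mul, Finset.mul_sum]
  rw [Finset.sum_comm]
  exact Finset.sum_congr rfl fun i _ => Finset.sum_congr rfl fun j _ => by ring

lemma sum_mul_mul_eq_dotProduct (G : Matrix (Fin n) (Fin n) ℝ) (x : Fin n → ℝ) :
    ∑ i, ∑ j, G i j * x i * x j = star x ⬝ᵥ G.mulVec x := by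
  simp only [dotProduct, Matrix.mulVec, Pi.star_apply, star_trivial, Finset.mul_sum]
  exact Finset.sum_congr rfl fun i _ => Finset.sum_congr rfl fun j _ => by ring

lemma isInner_bil {G : Matrix (Fin n) (Fin n) ℝ} (hG : G.PosDef) : IsInner (bil G) := by
  have hs : ∀ i j, G i j = G j i := fun i j => by simpa using hG.1.apply j i
  refine ⟨fun X Y => ?_, fun X hX => ?_⟩
  · rw [bil_apply, bil_apply, Finset.sum_comm]
    refine Finset.sum_congr rfl fun i _ => Finset.sum_congr rfl fun j _ => ?_
    rw [hs j i]; ring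
  · have hX' : (fun i => X i) ≠ 0 := fun h => hX (by ext i; exact congrFun h i)
    have := hG.dotProduct_mulVec_pos hX'
    rw [bil_apply, sum_mul_mul_eq_dotProduct]
    exact this

lemma posDef_of_isInner {b : Bil (E n)} {G : Matrix (Fin n) (Fin n) ℝ} (hb : IsInner b)
    (h : ∀ i j, b (stdVec n i) (stdVec n j) = G i j) : G.PosDef := by
  have hbG := bil_eq_of_basis h
  refine Matrix.PosDef.of_dotProduct_mulVec_pos ?_ fun x hx => ?_
  · ext i j
    simp [← h, hb.1 (stdVec n j)]
  · have := hb.2 (WithLp.toLp 2 x) (fun h0 => hx (by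
      ext i
      simpa using congrArg (fun v : E n => v i) h0))
    rw [hbG, bil_apply, sum_mul_mul_eq_dotProduct] at this
    exact this

lemma inverse_bil {G : Matrix (Fin n) (Fin n) ℝ} (hG : G.PosDef) (α : E n →L[ℝ] ℝ) (k : Fin n) :
    (bil G).inverse α k = ∑ l, G⁻¹ k l * α (stdVec n l) := by
  have hs : ∀ i j, G i j = G j i := fun i j => by simpa using hG.1.apply j i
  have key : (bil G).inverse α = WithLp.toLp 2 (fun k => ∑ l, G⁻¹ k l * α (stdVec n l)) := by
    refine (isInner_bil hG).ext fun Z => ?_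
    rw [(isInner_bil hG).apply_inverse, bil_apply]
    conv_lhs => rw [← sum_smul_stdVec Z]
    simp only [map_sum, map_smul, smul_eq_mul]
    rw [Finset.sum_comm]
    refine Finset.sum_congr rfl fun j _ => ?_
    rw [← Finset.sum_mul, mul_comm]
    congr 1
    have h1 : G * G⁻¹ = 1 := Matrix.mul_nonsing_inv _ (isUnit_iff_ne_zero.2 hG.det_pos.ne')
    have h2 : ∀ l, ∑ i, G i j * G⁻¹ i l = if j = l then 1 else 0 := by
      intro l
      have := congrFun (congrFun h1 j) l
      rw [Matrix.mul_apply, Matrix.one_apply] at this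
      rw [← this]
      exact Finset.sum_congr rfl fun i _ => by rw [hs i j]
    simp only [Finset.mul_sum]
    rw [Finset.sum_comm]
    simp only [← mul_assoc, ← Finset.sum_mul, h2]
    simp
  rw [key]

/-- `G` is a smooth field of positive definite matrices near `u`. -/
def MetricGerm (G : E n → Matrix (Fin n) (Fin n) ℝ) (u : E n) : Prop :=
  ∀ᶠ v in 𝓝 u, (∀ i j, ContDiffAt ℝ ∞ (fun v => G v i j) v) ∧ (G v).PosDef

/-- The Laplacian of the metric `G`. -/
def lapLoc (G : E n → Matrix (Fin n) (Fin n) ℝ) (F : E n → ℝ) (u : E n) : ℝ :=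
  (Real.sqrt (G u).det)⁻¹ *
    ∑ i, pd i (fun u => Real.sqrt (G u).det * ∑ j, (G u)⁻¹ i j * pd j F u) u

/-- The Christoffel symbols of the metric `G`. -/
def chrLoc (G : E n → Matrix (Fin n) (Fin n) ℝ) (k i j : Fin n) (u : E n) : ℝ :=
  (1 / 2) * ∑ l, (G u)⁻¹ k l *
    (pd i (fun u' => G u' j l) u + pd j (fun u' => G u' i l) u - pd l (fun u' => G u' i j) u)

/-- The Ricci curvature of the metric `G`. -/
def ricLoc (G : E n → Matrix (Fin n) (Fin n) ℝ) (i j : Fin n) (u : E n) : ℝ :=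
  ∑ k, (pd k (chrLoc G k i j) u - pd i (chrLoc G k k j) u
    + ∑ l, (chrLoc G k k l u * chrLoc G l i j u - chrLoc G k i l u * chrLoc G l k j u))

/-- The scalar curvature of the metric `G`. -/
def scalLoc (G : E n → Matrix (Fin n) (Fin n) ℝ) (u : E n) : ℝ :=
  ∑ i, ∑ j, (G u)⁻¹ i j * ricLoc G i j u

variable {G : E n → Matrix (Fin n) (Fin n) ℝ} {u : E n}

lemma MetricGerm.eventually (h : MetricGerm G u) : ∀ᶠ v in 𝓝 u, MetricGerm G v :=
  h.eventually_nhds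

lemma MetricGerm.posDef (h : MetricGerm G u) : (G u).PosDef := h.self_of_nhds.2

lemma MetricGerm.contDiffAt_bil (h : MetricGerm G u) : ContDiffAt ℝ ∞ (fun v => bil (G v)) u := by
  unfold bil
  exact ContDiffAt.sum fun i _ => ContDiffAt.sum fun j _ => (h.self_of_nhds.1 i j).smul contDiffAt_const

lemma MetricGerm.isInner (h : MetricGerm G u) : ∀ᶠ v in 𝓝 u, IsInner (bil (G v)) := by
  filter_upwards [h] with v hv using isInner_bil hv.2

lemma fderiv_bil (h : MetricGerm G u) (X : E n) (i j : Fin n) :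
    fderiv ℝ (fun v => bil (G v)) u X (stdVec n i) (stdVec n j) =
      fderiv ℝ (fun v => G v i j) u X := by
  have dB := h.contDiffAt_bil.differentiableAt (by simp)
  have := fderiv_clm_apply₂ dB (differentiableAt_const (stdVec n i))
    (differentiableAt_const (stdVec n j)) X
  simpa using this.symm

/-- The bridge between the Christoffel symbols and the invariant connection, for which tensoriality
is proved without indices. -/
lemma lc_bil_apply (h : MetricGerm G u) (k i j : Fin n) :
    lc (fun v => bil (G v)) u (stdVec n i) (stdVec n j) k = chrLoc G k i j u := by
  rw [lc_apply, inverse_bil h.posDef, chrLoc, Finset.mul_sum]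
  refine Finset.sum_congr rfl fun l _ => ?_
  rw [koszul_apply, fderiv_bil h, fderiv_bil h, fderiv_bil h]
  simp only [pd]
  ring

lemma pd_chrLoc (h : MetricGerm G u) (m k i j : Fin n) :
    pd m (chrLoc G k i j) u =
      fderiv ℝ (lc fun v => bil (G v)) u (stdVec n m) (stdVec n i) (stdVec n j) k := by
  have e1 : chrLoc G k i j =ᶠ[𝓝 u] fun v =>
      (EuclideanSpace.proj k : E n →L[ℝ] ℝ) (lc (fun v => bil (G v)) v (stdVec n i) (stdVec n j)) := by
    filter_upwards [h.eventually] with v hv using (lc_bil_apply hv k i j).symm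
  have dΓ : DifferentiableAt ℝ (lc fun v => bil (G v)) u :=
    (contDiffAt_lc h.contDiffAt_bil h.isInner.self_of_nhds).differentiableAt (by simp)
  have dc : ∀ C : E n, DifferentiableAt ℝ (fun _ : E n => C) u := fun C => differentiableAt_const C
  have d1 := (dΓ.clm_apply (dc (stdVec n i))).clm_apply (dc (stdVec n j))
  have d2 := ((EuclideanSpace.proj k : E n →L[ℝ] ℝ).hasFDerivAt.comp u d1.hasFDerivAt).fderiv
  have d3 : fderiv ℝ (fun v => (EuclideanSpace.proj k : E n →L[ℝ] ℝ)
    (lc (fun v => bil (G v)) v (stdVec n i) (stdVec n j))) u (stdVec n m) = _ :=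
      DFunLike.congr_fun d2 (stdVec n m)
  rw [pd, e1.fderiv_eq, d3, ContinuousLinearMap.comp_apply,
    fderiv_clm_apply₂ dΓ (dc _) (dc _)]
  simp

lemma riem_sum_right (Γ : E n → Conn (E n)) (u X Y Z : E n) :
    riem Γ u X Y Z = ∑ i, ∑ j, (Y i * Z j) • riem Γ u X (stdVec n i) (stdVec n j) := by
  have h1 : ∀ Z, riem Γ u X Y Z = ∑ i, Y i • riem Γ u X (stdVec n i) Z := by
    intro Z
    conv_lhs => rw [← sum_smul_stdVec Y]
    simp only [riem, map_sum, map_smul, sum_apply, smul_apply, smul_sub, smul_add,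
      Finset.sum_sub_distrib, Finset.sum_add_distrib]
  have h2 : ∀ Y, riem Γ u X Y Z = ∑ j, Z j • riem Γ u X Y (stdVec n j) := by
    intro Y
    conv_lhs => rw [← sum_smul_stdVec Z]
    simp only [riem, map_sum, map_smul, smul_sub, smul_add,
      Finset.sum_sub_distrib, Finset.sum_add_distrib]
  rw [h1]
  refine Finset.sum_congr rfl fun i _ => ?_
  rw [h2, Finset.smul_sum]
  simp only [smul_smul]

/-- The Ricci curvature as a trace. -/
lemma ricLoc_eq (h : MetricGerm G u) (i j : Fin n) :
    ricLoc G i j u = ∑ k, riem (lc fun v => bil (G v)) u (stdVec n k) (stdVec n i) (stdVec n j) k := by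
  have e : ∀ a b c : Fin n, lc (fun v => bil (G v)) u (stdVec n a)
      (lc (fun v => bil (G v)) u (stdVec n b) (stdVec n c)) =
      ∑ l, chrLoc G l b c u • lc (fun v => bil (G v)) u (stdVec n a) (stdVec n l) := by
    intro a b c
    conv_lhs => rw [← sum_smul_stdVec (lc (fun v => bil (G v)) u (stdVec n b) (stdVec n c))]
    simp only [map_sum, map_smul, lc_bil_apply h]
  unfold ricLoc
  refine Finset.sum_congr rfl fun k _ => ?_
  rw [riem, e, e, pd_chrLoc h, pd_chrLoc h]
  simp only [PiLp.add_apply, PiLp.sub_apply, WithLp.ofLp_sum, Finset.sum_apply, PiLp.smul_apply,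
    smul_eq_mul, lc_bil_apply h, Finset.sum_sub_distrib]
  rw [← add_sub_assoc]
  simp only [mul_comm]

/-- `f` is an orthonormal frame for the bilinear form `b`. -/
def IsFrame (b : Bil (E n)) (f : Fin n → E n) : Prop :=
  ∀ a c, b (f a) (f c) = if a = c then 1 else 0

lemma exists_isFrame {H : Matrix (Fin n) (Fin n) ℝ} (hH : H.PosDef) :
    ∃ f : Fin n → E n, IsFrame (bil H) f := by
  obtain ⟨A, -, hA⟩ := hH.exists_orthonormal
  refine ⟨fun a => WithLp.toLp 2 fun i => A i a, fun a c => ?_⟩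
  have := congrFun (congrFun hA a) c
  rw [Matrix.one_apply] at this
  rw [bil_apply, ← this]
  simp only [Matrix.mul_apply, Matrix.transpose_apply, Finset.sum_mul]
  rw [Finset.sum_comm]
  exact Finset.sum_congr rfl fun i _ => Finset.sum_congr rfl fun j _ => by ring

lemma IsFrame.matrix {H : Matrix (Fin n) (Fin n) ℝ} {f : Fin n → E n} (hf : IsFrame (bil H) f) :
    (Matrix.of fun i a => f a i).transpose * H * (Matrix.of fun i a => f a i) = 1 := by
  ext a c
  rw [Matrix.one_apply, ← hf a c, bil_apply]
  simp only [Matrix.mul_apply, Matrix.transpose_apply, Finset.sum_mul, Matrix.of_apply]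
  rw [Finset.sum_comm]
  exact Finset.sum_congr rfl fun i _ => Finset.sum_congr rfl fun j _ => by ring

lemma IsFrame.isUnit {H : Matrix (Fin n) (Fin n) ℝ} {f : Fin n → E n} (hf : IsFrame (bil H) f) :
    IsUnit (Matrix.of fun i a => f a i).det := by
  have := congrArg Matrix.det hf.matrix
  rw [Matrix.det_mul, Matrix.det_one] at this
  exact IsUnit.of_mul_eq_one_right _ this

/-- Contractions in an orthonormal frame. -/
lemma IsFrame.contr_eq {H : Matrix (Fin n) (Fin n) ℝ} {f : Fin n → E n} (hf : IsFrame (bil H) f)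
    (R : Matrix (Fin n) (Fin n) ℝ) : contr H R = ∑ a, ∑ i, ∑ j, R i j * f a i * f a j := by
  rw [← contr_congr_basis H R _ hf.isUnit, hf.matrix, contr_one, Matrix.trace]
  refine Finset.sum_congr rfl fun a _ => ?_
  simp only [Matrix.diag_apply, Matrix.mul_apply, Matrix.transpose_apply, Finset.sum_mul,
    Matrix.of_apply]
  rw [Finset.sum_comm]
  exact Finset.sum_congr rfl fun i _ => Finset.sum_congr rfl fun j _ => by ring

/-- Traces in an orthonormal frame. -/
lemma IsFrame.trace_eq {H : Matrix (Fin n) (Fin n) ℝ} {f : Fin n → E n} (hf : IsFrame (bil H) f)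
    (T : E n →ₗ[ℝ] E n) : ∑ k, T (stdVec n k) k = ∑ a, bil H (T (f a)) (f a) := by
  set A : Matrix (Fin n) (Fin n) ℝ := Matrix.of fun i a => f a i with hA
  set M : Matrix (Fin n) (Fin n) ℝ := Matrix.of fun k i => T (stdVec n i) k with hM
  have hT : ∀ X k, T X k = ∑ i, M k i * X i := by
    intro X k
    conv_lhs => rw [← sum_smul_stdVec X]
    simp [hM, mul_comm]
  have h1 : ∑ a, bil H (T (f a)) (f a) = (M.transpose * H * A * A.transpose).trace := by
    rw [Matrix.trace_mul_comm, Matrix.trace]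
    refine Finset.sum_congr rfl fun a _ => ?_
    rw [Matrix.diag_apply, ← Matrix.mul_assoc, ← Matrix.mul_assoc, Matrix.mul_apply, bil_apply,
      Finset.sum_comm]
    refine Finset.sum_congr rfl fun j _ => ?_
    rw [Matrix.mul_apply, Finset.sum_mul]
    refine Finset.sum_congr rfl fun i _ => ?_
    rw [hT, Matrix.mul_apply, mul_comm (H i j)]
    simp only [Matrix.transpose_apply, hA, Matrix.of_apply, mul_comm]
  have h2 : H * A * A.transpose = 1 := by
    have h3 : A.transpose * (H * A) = 1 := by rw [← Matrix.mul_assoc]; exact hf.matrix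
    exact mul_eq_one_comm.1 h3
  rw [h1, Matrix.mul_assoc, Matrix.mul_assoc, ← Matrix.mul_assoc H, h2, Matrix.mul_one,
    Matrix.trace_transpose]
  rfl

end Coordinates

/-! ### Frame formulas, coordinate invariance and conformal change of the scalar curvature. -/

section Invariance

variable {n : ℕ} {G : E n → Matrix (Fin n) (Fin n) ℝ} {u : E n}

lemma proj_apply_coord (i : Fin n) (X : E n) : (EuclideanSpace.proj i : E n →L[ℝ] ℝ) X = X i := rfl

lemma sum_stdVec_bilin (R : E n →L[ℝ] E n →L[ℝ] ℝ) (X Y : E n) :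
    ∑ i, ∑ j, R (stdVec n i) (stdVec n j) * X i * Y j = R X Y := by
  have h := bil_eq_of_basis (b := R) (G := Matrix.of fun i j => R (stdVec n i) (stdVec n j))
    (fun i j => rfl)
  conv_rhs => rw [h, bil_apply]
  rfl

/-- Contraction of two covectors in an orthonormal frame. -/
lemma IsFrame.contr_covectors {H : Matrix (Fin n) (Fin n) ℝ} {f : Fin n → E n}
    (hf : IsFrame (bil H) f) (α β : E n →L[ℝ] ℝ) :
    ∑ i, ∑ j, H⁻¹ i j * α (stdVec n i) * β (stdVec n j) = ∑ a, α (f a) * β (f a) := by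
  have h1 := hf.contr_eq (Matrix.of fun i j => α (stdVec n i) * β (stdVec n j))
  have h2 := fun a => sum_stdVec_bilin (α.smulRight β) (f a) (f a)
  simp only [ContinuousLinearMap.smulRight_apply, smul_apply, smul_eq_mul] at h2
  simp only [Matrix.of_apply, h2] at h1
  rw [← h1, contr]
  simp only [Matrix.of_apply, mul_assoc]

/-- The scalar curvature in an orthonormal frame. -/
lemma IsFrame.scalLoc_eq (h : MetricGerm G u) {f : Fin n → E n} (hf : IsFrame (bil (G u)) f) :
    scalLoc G u = ∑ a, ∑ c, bil (G u) (riem (lc fun v => bil (G v)) u (f c) (f a) (f a)) (f c) := by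
  have h1 := hf.contr_eq (Matrix.of fun i j => ricLoc G i j u)
  rw [contr] at h1
  rw [scalLoc]
  refine h1.trans (Finset.sum_congr rfl fun a _ => ?_)
  set Γ := lc fun v => bil (G v)
  have h2 := hf.trace_eq ({ toFun := fun X => riem Γ u X (f a) (f a)
                            map_add' := fun X Y => by simp only [riem, map_add, add_apply]; abel
                            map_smul' := fun c X => by
                              simp only [riem, map_smul, smul_apply, RingHom.id_apply, smul_sub,
                                smul_add] } : E n →ₗ[ℝ] E n)
  simp only [LinearMap.coe_mk, AddHom.coe_mk] at h2
  rw [← h2]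
  simp only [Matrix.of_apply, ricLoc_eq h]
  have h3 : ∀ k, riem Γ u (stdVec n k) (f a) (f a) k = ∑ i, ∑ j, (f a i * f a j) *
      riem Γ u (stdVec n k) (stdVec n i) (stdVec n j) k := by
    intro k
    rw [riem_sum_right Γ u (stdVec n k) (f a) (f a)]
    simp
  simp only [h3]
  conv_rhs => rw [Finset.sum_comm]
  refine Finset.sum_congr rfl fun i _ => ?_
  conv_rhs => rw [Finset.sum_comm]
  refine Finset.sum_congr rfl fun j _ => ?_
  rw [Finset.sum_mul, Finset.sum_mul]
  exact Finset.sum_congr rfl fun k _ => by ring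

lemma inv_symm {H : Matrix (Fin n) (Fin n) ℝ} (hH : H.PosDef) (i j : Fin n) :
    H⁻¹ i j = H⁻¹ j i := by
  simpa using hH.inv.1.apply j i

lemma coord_eq_sum_inv {H : Matrix (Fin n) (Fin n) ℝ} (hH : H.PosDef) (X : E n) (k : Fin n) :
    X k = ∑ l, H⁻¹ k l * bil H X (stdVec n l) := by
  have h : (bil H).inverse (bil H X) = X :=
    (isInner_bil hH).ext fun Z => by rw [(isInner_bil hH).apply_inverse]
  rw [← inverse_bil hH (bil H X) k, h]

/-- Jacobi's formula gives half the trace of G⁻¹∂G. By metric compatibility ∂G is a sum of two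
terms, each with trace equal to the trace of the connection. -/
lemma fderiv_sqrt_det (h : MetricGerm G u) (X : E n) :
    fderiv ℝ (fun v => Real.sqrt (G v).det) u X =
      Real.sqrt (G u).det * ∑ k, lc (fun v => bil (G v)) u X (stdVec n k) k := by
  have hpos := h.posDef.det_pos
  have hu := h.isInner.self_of_nhds
  obtain ⟨L, hL, hL'⟩ := hasFDerivAt_det (fun i j => G u i j) (isUnit_iff_ne_zero.2 hpos.ne')
  have hG : HasFDerivAt (fun v : E n => fun i j => G v i j)
      (ContinuousLinearMap.pi fun i => ContinuousLinearMap.pi fun j =>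
        fderiv ℝ (fun v => G v i j) u) u := by
    refine hasFDerivAt_pi.2 fun i => hasFDerivAt_pi.2 fun j => ?_
    exact ((h.self_of_nhds.1 i j).differentiableAt (by simp)).hasFDerivAt
  have h1 := ((hL.comp u hG).sqrt (by exact hpos.ne')).fderiv
  have h2 : fderiv ℝ (fun v => Real.sqrt (G v).det) u X = _ := DFunLike.congr_fun h1 X
  rw [h2]
  simp only [smul_apply, ContinuousLinearMap.comp_apply, hL', smul_eq_mul, Function.comp]
  have LC := isLC_lc (h.contDiffAt_bil.differentiableAt (by simp)) h.isInner
  have h3 : ((Matrix.of fun i j => G u i j)⁻¹ *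
      Matrix.of fun i j => fderiv ℝ (fun v => G v i j) u X).trace =
      2 * ∑ k, lc (fun v => bil (G v)) u X (stdVec n k) k := by
    rw [two_mul]
    simp only [Matrix.trace, Matrix.diag_apply, Matrix.mul_apply, Matrix.of_apply,
      ← fderiv_bil h, LC.2, mul_add, Finset.sum_add_distrib]
    congr 1
    · rw [Finset.sum_comm]
      refine Finset.sum_congr rfl fun k _ => ?_
      rw [coord_eq_sum_inv h.posDef _ k]
      exact Finset.sum_congr rfl fun l _ => by rw [inv_symm h.posDef k l]; rfl
    · refine Finset.sum_congr rfl fun k _ => ?_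
      rw [coord_eq_sum_inv h.posDef _ k]
      exact Finset.sum_congr rfl fun l _ => by rw [hu.1]; rfl
  erw [h3]
  have h4 : Real.sqrt (G u).det ^ 2 = (G u).det := Real.sq_sqrt hpos.le
  have h5 : Real.sqrt (G u).det ≠ 0 := (Real.sqrt_pos.2 hpos).ne'
  have h6 : (Matrix.of fun i j => G u i j) = G u := rfl
  rw [h6]
  field_simp
  rw [h4]

/-- The Laplacian as the trace of the Hessian, in an orthonormal frame. -/
lemma IsFrame.lapLoc_eq (h : MetricGerm G u) {F : E n → ℝ} (hF : ContDiffAt ℝ ∞ F u)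
    {f : Fin n → E n} (hf : IsFrame (bil (G u)) f) :
    lapLoc G F u = ∑ a, hess (lc fun v => bil (G v)) F u (f a) (f a) := by
  set W := gradV (fun v => bil (G v)) F
  set Γ := lc fun v => bil (G v)
  have hu := h.isInner.self_of_nhds
  have hW : ContDiffAt ℝ ∞ W u := contDiffAt_gradV h.contDiffAt_bil hF hu
  have dW : DifferentiableAt ℝ W u := hW.differentiableAt (by simp)
  have hpos : 0 < Real.sqrt (G u).det := Real.sqrt_pos.2 h.posDef.det_pos
  -- The flux is √det G times the gradient W. The product rule and `fderiv_sqrt_det` turn its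
  -- divergence into the covariant divergence of W, that is, the trace of ∇W.
  have e1 : ∀ i, pd i (fun v => Real.sqrt (G v).det * ∑ j, (G v)⁻¹ i j * pd j F v) u =
      Real.sqrt (G u).det * (fderiv ℝ W u (stdVec n i) i +
        (∑ k, Γ u (stdVec n i) (stdVec n k) k) * W u i) := by
    intro i
    have e2 : (fun v => Real.sqrt (G v).det * ∑ j, (G v)⁻¹ i j * pd j F v) =ᶠ[𝓝 u]
        fun v => Real.sqrt (G v).det * (EuclideanSpace.proj i : E n →L[ℝ] ℝ) (W v) := by
      filter_upwards [h.eventually] with v hv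
      have := inverse_bil hv.posDef (fderiv ℝ F v) i
      simp only [proj_apply_coord, W, gradV, this, pd]
    have d1 : DifferentiableAt ℝ (fun v => Real.sqrt (G v).det) u := by
      have hd : DifferentiableAt ℝ (fun v => (G v).det) u := by
        simp only [Matrix.det_apply]
        have := fun i j => (h.self_of_nhds.1 i j).differentiableAt (by simp)
        fun_prop
      exact hd.sqrt h.posDef.det_pos.ne'
    have d2 : HasFDerivAt (fun v => (EuclideanSpace.proj i : E n →L[ℝ] ℝ) (W v))
        ((EuclideanSpace.proj i : E n →L[ℝ] ℝ) ∘L fderiv ℝ W u) u :=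
      (EuclideanSpace.proj i : E n →L[ℝ] ℝ).hasFDerivAt.comp u dW.hasFDerivAt
    rw [pd, e2.fderiv_eq, fderiv_fun_mul d1 d2.differentiableAt, d2.fderiv]
    simp only [add_apply, smul_apply, fderiv_sqrt_det h, smul_eq_mul,
      ContinuousLinearMap.comp_apply, proj_apply_coord]
    ring
  have e3 : ∑ i, (∑ k, Γ u (stdVec n i) (stdVec n k) k) * W u i =
      ∑ k, Γ u (stdVec n k) (W u) k := by
    have LC := isLC_lc (h.contDiffAt_bil.differentiableAt (by simp)) h.isInner
    simp only [Finset.sum_mul]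
    rw [Finset.sum_comm]
    refine Finset.sum_congr rfl fun k _ => ?_
    conv_rhs => rw [← sum_smul_stdVec (W u)]
    simp only [map_sum, map_smul, WithLp.ofLp_sum, Finset.sum_apply, PiLp.smul_apply,
      smul_eq_mul]
    refine Finset.sum_congr rfl fun i _ => ?_
    rw [mul_comm, LC.1]
  have h2 := hf.trace_eq ((fderiv ℝ W u + (Γ u).flip (W u) : E n →L[ℝ] E n) : E n →ₗ[ℝ] E n)
  simp only [ContinuousLinearMap.coe_coe, add_apply, ContinuousLinearMap.flip_apply] at h2
  have h3 := fun X Y => inner_fderiv_gradV h.contDiffAt_bil hF h.isInner X Y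
  rw [lapLoc, Finset.sum_congr rfl fun i _ => e1 i, ← Finset.mul_sum, Finset.sum_add_distrib, e3,
    inv_mul_cancel_left₀ hpos.ne', ← Finset.sum_add_distrib]
  simp only [PiLp.add_apply] at h2
  rw [h2]
  exact Finset.sum_congr rfl fun a _ => h3 _ _

/-- Near `u`, the metric `G'` is the pullback of the metric `G` by `φ`. -/
def IsPullback (φ : E n → E n) (G G' : E n → Matrix (Fin n) (Fin n) ℝ) (u : E n) : Prop :=
  ∀ᶠ v in 𝓝 u, ContDiffAt ℝ ∞ φ v ∧ Function.Injective (fderiv ℝ φ v) ∧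
    ∀ i j, G' v i j = bil (G (φ v)) (fderiv ℝ φ v (stdVec n i)) (fderiv ℝ φ v (stdVec n j))

variable {G' : E n → Matrix (Fin n) (Fin n) ℝ} {φ : E n → E n}

lemma IsPullback.bil_eq (hφ : IsPullback φ G G' u) : ∀ᶠ v in 𝓝 u, ∀ X Y,
    bil (G' v) X Y = bil (G (φ v)) (fderiv ℝ φ v X) (fderiv ℝ φ v Y) := by
  filter_upwards [hφ] with v hv X Y
  have := bil_eq_of_basis (b := (bil (G (φ v))).bilinearComp (fderiv ℝ φ v) (fderiv ℝ φ v))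
    (G := G' v) (fun i j => by simp [hv.2.2])
  rw [← this]; simp

lemma IsPullback.isFrame (hφ : IsPullback φ G G' u) {f : Fin n → E n}
    (hf : IsFrame (bil (G' u)) f) : IsFrame (bil (G (φ u))) fun a => fderiv ℝ φ u (f a) :=
  fun a c => by rw [← hφ.bil_eq.self_of_nhds, hf]

/-- An injective endomorphism of ℝⁿ is invertible, so the transformation law can be solved for a
connection `Γ₀`. That connection is Levi-Civita for `G'`, hence equal to `lc` by uniqueness. -/
lemma IsPullback.conn (hφ : IsPullback φ G G' u) (hG : MetricGerm G (φ u)) (hG' : MetricGerm G' u) :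
    ∀ᶠ v in 𝓝 u, IsPullbackConn φ (lc fun v => bil (G v)) (lc fun v => bil (G' v)) v := by
  have hc : ContinuousAt φ u := hφ.self_of_nhds.1.continuousAt
  filter_upwards [hφ.eventually_nhds, hc.eventually hG.eventually, hG'.eventually] with v h1 h2 h3
  have hv := h1.self_of_nhds
  have hinj := hv.2.1
  let e : E n ≃L[ℝ] E n := (LinearEquiv.ofInjectiveEndo (fderiv ℝ φ v : E n →ₗ[ℝ] E n)
    hinj).toContinuousLinearEquiv
  have he : ∀ X, e X = fderiv ℝ φ v X := fun X => rfl
  let Γ₀ : Conn (E n) := LinearMap.toContinuousLinearMap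
    { toFun := fun X => LinearMap.toContinuousLinearMap
        { toFun := fun Y => e.symm (fderiv ℝ (fderiv ℝ φ) v X Y +
            lc (fun v => bil (G v)) (φ v) (fderiv ℝ φ v X) (fderiv ℝ φ v Y))
          map_add' := fun Y Z => by simp only [map_add]; abel
          map_smul' := fun c Y => by simp only [map_smul, map_add, RingHom.id_apply, smul_add] }
      map_add' := fun Y Z => by ext W : 1; simp [map_add]; abel
      map_smul' := fun c Y => by ext W : 1; simp [map_smul] }
  have hΓ₀ : ∀ X Y, fderiv ℝ φ v (Γ₀ X Y) = fderiv ℝ (fderiv ℝ φ) v X Y +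
            lc (fun v => bil (G v)) (φ v) (fderiv ℝ φ v X) (fderiv ℝ φ v Y) := by
    intro X Y
    rw [← he]
    exact e.apply_symm_apply _
  have l1 : IsLC (fun v => bil (G' v)) (fun _ => Γ₀) v :=
    isLC_pullback (Γ := lc fun v => bil (G v)) hv.1 hinj
      (h2.contDiffAt_bil.differentiableAt (by simp))
      (IsPullback.bil_eq h1) (h3.contDiffAt_bil.differentiableAt (by simp))
      (isLC_lc (h2.contDiffAt_bil.differentiableAt (by simp)) h2.isInner) hΓ₀
  have l2 := isLC_lc (h3.contDiffAt_bil.differentiableAt (by simp)) h3.isInner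
  have l3 := l1.unique h3.isInner.self_of_nhds l2
  intro X Y
  rw [← l3]
  exact hΓ₀ X Y

/-- The differential of φ carries an orthonormal frame for `G'` to one for `G`, and the Hessian is
tensorial, so the frame sums agree term by term. -/
lemma IsPullback.lapLoc_eq (hφ : IsPullback φ G G' u) (hG : MetricGerm G (φ u))
    (hG' : MetricGerm G' u) {F : E n → ℝ} (hF : ContDiffAt ℝ ∞ F (φ u)) :
    lapLoc G' (F ∘ φ) u = lapLoc G F (φ u) := by
  obtain ⟨f, hf⟩ := exists_isFrame hG'.posDef
  have h0 := hφ.self_of_nhds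
  rw [hf.lapLoc_eq hG' (hF.comp u h0.1), (hφ.isFrame hf).lapLoc_eq hG hF]
  exact Finset.sum_congr rfl fun a _ =>
    hess_comp h0.1 hF (hφ.conn hG hG').self_of_nhds _ _

lemma IsPullback.scalLoc_eq (hφ : IsPullback φ G G' u) (hG : MetricGerm G (φ u))
    (hG' : MetricGerm G' u) : scalLoc G' u = scalLoc G (φ u) := by
  obtain ⟨f, hf⟩ := exists_isFrame hG'.posDef
  have h0 := hφ.self_of_nhds
  rw [hf.scalLoc_eq hG', (hφ.isFrame hf).scalLoc_eq hG]
  refine Finset.sum_congr rfl fun a _ => Finset.sum_congr rfl fun c _ => ?_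
  rw [hφ.bil_eq.self_of_nhds, riem_comp h0.1
    ((contDiffAt_lc hG.contDiffAt_bil hG.isInner.self_of_nhds).differentiableAt (by simp))
    ((contDiffAt_lc hG'.contDiffAt_bil hG'.isInner.self_of_nhds).differentiableAt (by simp))
    (hφ.conn hG hG')]

lemma lc_congr {V : Type*} [NormedAddCommGroup V] [NormedSpace ℝ V] {B B' : V → Bil V} {u : V}
    (h : B =ᶠ[𝓝 u] B') : lc B =ᶠ[𝓝 u] lc B' := by
  filter_upwards [h.eventuallyEq_nhds] with v hv
  simp only [lc, koszul, hv.fderiv_eq, hv.self_of_nhds]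

lemma riem_congr {V : Type*} [NormedAddCommGroup V] [NormedSpace ℝ V] {Γ Γ' : V → Conn V} {u : V}
    (h : Γ =ᶠ[𝓝 u] Γ') (X Y Z : V) : riem Γ u X Y Z = riem Γ' u X Y Z := by
  simp only [riem, h.fderiv_eq, h.self_of_nhds]

lemma bil_smul (c : ℝ) (H : Matrix (Fin n) (Fin n) ℝ) : bil (c • H) = c • bil H := by
  simp [bil, Finset.smul_sum, smul_smul]

/-- The conformal change of the scalar curvature. -/
lemma scalLoc_conformal (h : MetricGerm G u) (h' : MetricGerm G' u) {η : E n → ℝ}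
    (hη : ContDiffAt ℝ ∞ η u) (hG' : ∀ᶠ v in 𝓝 u, G' v = Real.exp (2 * η v) • G v) :
    scalLoc G' u = (Real.exp (2 * η u))⁻¹ * (scalLoc G u - 2 * ((n : ℝ) - 1) * lapLoc G η u
      - ((n : ℝ) - 1) * ((n : ℝ) - 2) *
        ∑ i, ∑ j, (G u)⁻¹ i j * fderiv ℝ η u (stdVec n i) * fderiv ℝ η u (stdVec n j)) := by
  obtain ⟨f, hf⟩ := exists_isFrame h.posDef
  have hu := h.isInner.self_of_nhds
  -- Frames scale by e^{-η}.
  have hf' : IsFrame (bil (G' u)) fun a => Real.exp (-η u) • f a := by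
    intro a c
    rw [hG'.self_of_nhds, bil_smul]
    simp only [smul_apply, map_smul, smul_eq_mul, hf a c]
    rw [← mul_assoc, ← mul_assoc, ← Real.exp_add, ← Real.exp_add]
    simp [two_mul]
  have hlc : lc (fun v => bil (G' v)) =ᶠ[𝓝 u] lc fun v => Real.exp (2 * η v) • bil (G v) := by
    refine lc_congr ?_
    filter_upwards [hG'] with v hv
    rw [hv, bil_smul]
  have hW : bil (G u) (gradV (fun v => bil (G v)) η u) (gradV (fun v => bil (G v)) η u) =
      ∑ a, fderiv ℝ η u (f a) ^ 2 := by
    have h1 := hf.contr_covectors (fderiv ℝ η u) (fderiv ℝ η u)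
    simp only [sq]
    rw [← h1, inner_gradV (B := fun v => bil (G v)) hu]
    conv_lhs => rw [← sum_smul_stdVec (gradV (fun v => bil (G v)) η u)]
    simp only [map_sum, map_smul, smul_eq_mul]
    refine Finset.sum_congr rfl fun i _ => ?_
    rw [gradV, inverse_bil h.posDef, Finset.sum_mul]
    exact Finset.sum_congr rfl fun j _ => by ring
  -- Four frame vectors contribute e^{-4η} and the outer inner product e^{2η}, which leaves e^{-2η}.
  have e1 : ∀ a c : Fin n, bil (G' u) (riem (lc fun v => bil (G' v)) u (Real.exp (-η u) • f c)
      (Real.exp (-η u) • f a) (Real.exp (-η u) • f a)) (Real.exp (-η u) • f c) =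
      (Real.exp (2 * η u))⁻¹ *
        bil (G u) (riem (lc fun v => Real.exp (2 * η v) • bil (G v)) u (f c) (f a) (f a)) (f c) := by
    intro a c
    rw [riem_congr hlc, hG'.self_of_nhds, bil_smul]
    have h1 : ∀ (Γ : E n → Conn (E n)) (t : ℝ) (X Y : E n),
        riem Γ u (t • X) (t • Y) (t • Y) = t ^ 3 • riem Γ u X Y Y := by
      intro Γ t X Y
      simp only [riem, map_smul, smul_apply, smul_smul, smul_sub, smul_add]
      ring_nf
    rw [h1]
    simp only [smul_apply, map_smul, smul_eq_mul, ← Real.exp_neg]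
    rw [← Real.exp_nat_mul, ← mul_assoc, ← mul_assoc, ← Real.exp_add, ← Real.exp_add]
    congr 2
    push_cast; ring
  rw [hf'.scalLoc_eq h', hf.scalLoc_eq h, hf.lapLoc_eq h hη, hf.contr_covectors]
  simp only [e1, ← Finset.mul_sum]
  congr 1
  have e2 := fun a c : Fin n => riem_conformal h.contDiffAt_bil hη h.isInner (f c) (f a)
  simp only [e2, hf _ _, hW, if_true]
  simp only [Finset.sum_add_distrib, Finset.sum_sub_distrib, mul_ite, ite_mul, mul_zero, mul_one,
    zero_mul, one_mul, Finset.sum_ite_eq', Finset.mem_univ, if_true,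
    Finset.sum_const, Finset.card_univ, Fintype.card_fin, nsmul_eq_mul, ite_pow, one_pow,
    ← Finset.mul_sum, ne_eq, OfNat.ofNat_ne_zero, not_false_eq_true, zero_pow, ← sq,
    mul_assoc]
  ring

end Invariance

/-! ### Metrics in arbitrary charts of the manifold -/

section Charts

variable {n : ℕ} {M : Type*} [TopologicalSpace M] [ChartedSpace (E n) M]

/-- The coordinate vector fields of the chart `e`. -/
def coordE (e : OpenPartialHomeomorph M (E n)) (u : E n) :
    E n →L[ℝ] TangentSpace (𝓡 n) (e.symm u) :=
  mfderiv 𝓘(ℝ, E n) (𝓡 n) e.symm u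

/-- The Gram matrix of `h` in the chart `e`. -/
def gramE (h : FormField n M) (e : OpenPartialHomeomorph M (E n)) (u : E n) :
    Matrix (Fin n) (Fin n) ℝ :=
  Matrix.of fun i j => h (e.symm u) (coordE e u (stdVec n i)) (coordE e u (stdVec n j))

variable [IsManifold (𝓡 n) ∞ M] {e e' : OpenPartialHomeomorph M (E n)}

/-- The charts of the maximal atlas. -/
abbrev IsChart (e : OpenPartialHomeomorph M (E n)) : Prop :=
  e ∈ IsManifold.maximalAtlas (𝓡 n) ∞ M

lemma isChart_chartAt (p : M) : IsChart (n := n) (chartAt (E n) p) :=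
  IsManifold.chart_mem_maximalAtlas p

omit [IsManifold (𝓡 n) ∞ M] in
lemma IsChart.contMDiffAt_symm (he : IsChart e) {u : E n} (hu : u ∈ e.target) :
    ContMDiffAt 𝓘(ℝ, E n) (𝓡 n) ∞ e.symm u :=
  contMDiffAt_symm_of_mem_maximalAtlas he hu

omit [IsManifold (𝓡 n) ∞ M] in
lemma IsChart.contMDiffAt (he : IsChart e) {x : M} (hx : x ∈ e.source) :
    ContMDiffAt (𝓡 n) 𝓘(ℝ, E n) ∞ e x :=
  contMDiffAt_of_mem_maximalAtlas he hx

lemma IsChart.contDiffAt_comp_symm (he : IsChart e) {F : Type*} [NormedAddCommGroup F]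
    [NormedSpace ℝ F] {f : M → F} {u : E n} {k : ℕ∞ω} (hk : k ≤ ∞) (hu : u ∈ e.target)
    (hf : ContMDiffAt (𝓡 n) 𝓘(ℝ, F) k f (e.symm u)) : ContDiffAt ℝ k (f ∘ e.symm) u :=
  (hf.comp u ((he.contMDiffAt_symm hu).of_le hk)).contDiffAt

lemma IsChart.contDiffAt_transition (he : IsChart e) (he' : IsChart e') {u : E n}
    (hu : u ∈ e.target) (hu' : e.symm u ∈ e'.source) : ContDiffAt ℝ ∞ (e' ∘ e.symm) u :=
  he.contDiffAt_comp_symm le_rfl hu (he'.contMDiffAt hu')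

lemma IsChart.fderiv_comp_symm (he : IsChart e) {f : M → ℝ} {u : E n} (hu : u ∈ e.target)
    (hf : MDifferentiableAt (𝓡 n) 𝓘(ℝ) f (e.symm u)) (X : E n) :
    fderiv ℝ (f ∘ e.symm) u X = diff f (e.symm u) (coordE e u X) := by
  have h1 : MDifferentiableAt 𝓘(ℝ, E n) (𝓡 n) e.symm u :=
    (he.contMDiffAt_symm hu).mdifferentiableAt (by simp)
  have h2 := mfderiv_comp u hf h1
  rw [mfderiv_eq_fderiv] at h2
  rw [h2]
  rfl

/-- The change of coordinate vector fields. -/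
lemma IsChart.coordE_transition (he : IsChart e) (he' : IsChart e') {u : E n}
    (hu : u ∈ e.target) (hu' : e.symm u ∈ e'.source) (X : E n) :
    HEq (coordE e u X) (coordE e' (e' (e.symm u)) (fderiv ℝ (e' ∘ e.symm) u X)) := by
  have h1 : MDifferentiableAt 𝓘(ℝ, E n) 𝓘(ℝ, E n) (e' ∘ e.symm) u :=
    ((he.contDiffAt_transition he' hu hu').differentiableAt (by simp)).mdifferentiableAt
  have h2 : MDifferentiableAt 𝓘(ℝ, E n) (𝓡 n) e'.symm ((e' ∘ e.symm) u) :=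
    (he'.contMDiffAt_symm (e'.map_source hu')).mdifferentiableAt (by simp)
  have h3 := mfderiv_comp u h2 h1
  have h4 : e'.symm ∘ (e' ∘ e.symm) =ᶠ[𝓝 u] e.symm := by
    have : ∀ᶠ v in 𝓝 u, e.symm v ∈ e'.source :=
      (e.continuousAt_symm hu).eventually (e'.open_source.mem_nhds hu')
    filter_upwards [this] with v hv using e'.left_inv hv
  have h5 := h4.mfderiv_eq (I := 𝓘(ℝ, E n)) (I' := 𝓡 n)
  rw [mfderiv_eq_fderiv] at h3
  -- The two tangent spaces sit at points that are only propositionally equal, but both unfold to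
  -- ℝⁿ, so an ordinary equality of vectors can be stated here.
  have h6 : mfderiv 𝓘(ℝ, E n) (𝓡 n) e.symm u X =
      mfderiv 𝓘(ℝ, E n) (𝓡 n) e'.symm ((e' ∘ e.symm) u) (fderiv ℝ (e' ∘ e.symm) u X) := by
    rw [← h5, h3]; rfl
  exact heq_of_eq h6

/-- All tangent spaces are the same type ℝⁿ by definition. With `T` as a single type, base point and
vectors can be replaced together without transport. -/
lemma apply_heq {M : Type*} {T : Type*} (h : M → T → T → ℝ) {x y : M} (hxy : x = y) {v w v' w' : T}
    (hv : v = v') (hw : w = w') : h x v w = h y v' w' := by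
  subst hxy hv hw; rfl

lemma IsChart.form_transition (he : IsChart e) (he' : IsChart e') (h : FormField n M) {u : E n}
    (hu : u ∈ e.target) (hu' : e.symm u ∈ e'.source) (X Y : E n) :
    h (e.symm u) (coordE e u X) (coordE e u Y) =
      h (e'.symm (e' (e.symm u))) (coordE e' (e' (e.symm u)) (fderiv ℝ (e' ∘ e.symm) u X))
        (coordE e' (e' (e.symm u)) (fderiv ℝ (e' ∘ e.symm) u Y)) :=
  apply_heq (T := E n) h (e'.left_inv hu').symm
    (eq_of_heq (he.coordE_transition he' hu hu' X)) (eq_of_heq (he.coordE_transition he' hu hu' Y))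

lemma IsChart.injective_coordE (he : IsChart e) {u : E n} (hu : u ∈ e.target) :
    Function.Injective (coordE e u) := by
  have h1 : MDifferentiableAt 𝓘(ℝ, E n) (𝓡 n) e.symm u :=
    (he.contMDiffAt_symm hu).mdifferentiableAt (by simp)
  have h2 : MDifferentiableAt (𝓡 n) 𝓘(ℝ, E n) e (e.symm u) :=
    (he.contMDiffAt (e.map_target hu)).mdifferentiableAt (by simp)
  have h3 := mfderiv_comp u h2 h1
  have h4 : e ∘ e.symm =ᶠ[𝓝 u] id := by
    filter_upwards [e.open_target.mem_nhds hu] with v hv using e.right_inv hv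
  rw [h4.mfderiv_eq, mfderiv_id] at h3
  intro X Y hXY
  have h5 := fun Z => DFunLike.congr_fun h3 Z
  have h6 : mfderiv (𝓡 n) 𝓘(ℝ, E n) e (e.symm u) (mfderiv 𝓘(ℝ, E n) (𝓡 n) e.symm u X) =
      mfderiv (𝓡 n) 𝓘(ℝ, E n) e (e.symm u) (mfderiv 𝓘(ℝ, E n) (𝓡 n) e.symm u Y) :=
    congrArg _ hXY
  exact (h5 X).trans (h6.trans (h5 Y).symm)

lemma IsChart.injective_fderiv_transition (he : IsChart e) (he' : IsChart e') {u : E n}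
    (hu : u ∈ e.target) (hu' : e.symm u ∈ e'.source) :
    Function.Injective (fderiv ℝ (e' ∘ e.symm) u) := by
  intro X Y hXY
  refine he.injective_coordE hu ?_
  have h1 := eq_of_heq (he.coordE_transition he' hu hu' X)
  have h2 := eq_of_heq (he.coordE_transition he' hu hu' Y)
  rw [hXY] at h1
  exact h1.trans h2.symm

/-- The inner product of two tangent vectors of a smooth map depends smoothly on the point. -/
lemma Metric.contDiffAt_inner (g : Metric n M) {V : Type*} [NormedAddCommGroup V] [NormedSpace ℝ V]
    {f : V → M} {u : V} (hf : ∀ᶠ v in 𝓝 u, ContMDiffAt 𝓘(ℝ, V) (𝓡 n) ∞ f v) (X Y : V) :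
    ContDiffAt ℝ ∞ (fun v => g.inner (f v) (mfderiv 𝓘(ℝ, V) (𝓡 n) f v X)
      (mfderiv 𝓘(ℝ, V) (𝓡 n) f v Y)) u := by
  obtain ⟨s, hs, hso, hus⟩ := eventually_nhds_iff.1 hf
  have hfs : ContMDiffOn 𝓘(ℝ, V) (𝓡 n) ∞ f s := fun v hv => (hs v hv).contMDiffWithinAt
  have hT := hfs.contMDiffOn_tangentMapWithin (m := ∞) (by simp) hso.uniqueMDiffOn
  -- The vector field v ↦ df(v)X is the tangent map of `f` composed with a constant section, hence
  -- smooth as a map into the tangent bundle.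
  have hv : ∀ X : V, ContMDiffAt 𝓘(ℝ, V) (𝓡 n).tangent ∞
      (fun v => (⟨f v, mfderiv 𝓘(ℝ, V) (𝓡 n) f v X⟩ : TangentBundle (𝓡 n) M)) u := by
    intro X
    have h1 : ContMDiffAt 𝓘(ℝ, V) 𝓘(ℝ, V).tangent ∞
        (fun v => (⟨v, X⟩ : TangentBundle 𝓘(ℝ, V) V)) u := by
      refine Bundle.contMDiffAt_totalSpace.2 ⟨contMDiffAt_id, ?_⟩
      refine (contMDiffAt_const (c := X)).congr_of_eventuallyEq (Eventually.of_forall fun v => ?_)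
      simp
    have h2 := (hT.contMDiffAt ((hso.preimage (FiberBundle.continuous_proj V
      (TangentSpace 𝓘(ℝ, V)))).mem_nhds (x := ⟨u, X⟩) hus)).comp u h1
    refine h2.congr_of_eventuallyEq ?_
    filter_upwards [hso.mem_nhds hus] with v hv
    simp only [Function.comp, tangentMapWithin, mfderivWithin_of_isOpen hso hv]
  have hg := (g.contMDiff (f u)).comp u hf.self_of_nhds
  have : ContMDiffAt 𝓘(ℝ, V) ((𝓡 n).prod 𝓘(ℝ)) ∞
      (fun m => Bundle.TotalSpace.mk' ℝ (E := Bundle.Trivial M ℝ) (f m)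
        (g.inner (f m) (mfderiv 𝓘(ℝ, V) (𝓡 n) f m X) (mfderiv 𝓘(ℝ, V) (𝓡 n) f m Y))) u := by
    apply ContMDiffAt.clm_bundle_apply₂ (F₁ := E n) (F₂ := E n)
    · exact hg
    · exact hv X
    · exact hv Y
  exact (Bundle.contMDiffAt_totalSpace.1 this).2.contDiffAt

end Charts

/-! ### Metric, Laplacian and scalar curvature in an arbitrary chart, and their smoothness. -/

section LocalFormulas

variable {n : ℕ} {M : Type*} [TopologicalSpace M] [ChartedSpace (E n) M] [IsManifold (𝓡 n) ∞ M]
  {e e' : OpenPartialHomeomorph M (E n)} (g : Metric n M)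

/-- The metric at the point `x` as a bilinear form on `ℝⁿ`. -/
def Metric.bilAt (x : M) : Bil (E n) := g.inner x

lemma Metric.isInner_bilAt (x : M) : IsInner (g.bilAt x) :=
  ⟨fun v w => g.symm x v w, fun v hv => g.pos x v hv⟩

lemma bil_gramE (e : OpenPartialHomeomorph M (E n)) (u X Y : E n) :
    bil (gramE g.form e u) X Y = g.inner (e.symm u) (coordE e u X) (coordE e u Y) := by
  have := bil_eq_of_basis (b := (g.bilAt (e.symm u)).bilinearComp (coordE e u) (coordE e u))
    (G := gramE g.form e u) (fun i j => rfl)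
  rw [← this]; rfl

lemma metricGerm_gramE (he : IsChart e) {u : E n} (hu : u ∈ e.target) :
    MetricGerm (gramE g.form e) u := by
  filter_upwards [e.open_target.mem_nhds hu] with v hv
  refine ⟨fun i j => ?_, ?_⟩
  · refine g.contDiffAt_inner ?_ (stdVec n i) (stdVec n j)
    filter_upwards [e.open_target.mem_nhds hv] with w hw using he.contMDiffAt_symm hw
  · refine posDef_of_isInner
      (b := (g.bilAt (e.symm v)).bilinearComp (coordE e v) (coordE e v)) ⟨fun X Y => ?_, fun X hX => ?_⟩
      (fun i j => rfl)
    · exact g.symm (e.symm v) (coordE e v X) (coordE e v Y)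
    · exact g.pos (e.symm v) (coordE e v X)
        fun h => hX (he.injective_coordE hv (h.trans (map_zero (coordE e v)).symm))

lemma isPullback_transition (he : IsChart e) (he' : IsChart e') {u : E n}
    (hu : u ∈ e.target) (hu' : e.symm u ∈ e'.source) :
    IsPullback (e' ∘ e.symm) (gramE g.form e') (gramE g.form e) u := by
  have h1 : ∀ᶠ v in 𝓝 u, e.symm v ∈ e'.source :=
    (e.continuousAt_symm hu).eventually (e'.open_source.mem_nhds hu')
  filter_upwards [h1, e.open_target.mem_nhds hu] with v hv1 hv2
  refine ⟨he.contDiffAt_transition he' hv2 hv1, he.injective_fderiv_transition he' hv2 hv1,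
    fun i j => ?_⟩
  rw [bil_gramE]
  exact he.form_transition he' g.form hv2 hv1 _ _

/-- The inner product of covectors, in any chart. -/
lemma dual_symm_eq (he : IsChart e) {u : E n} (hu : u ∈ e.target)
    (α β : TangentSpace (𝓡 n) (e.symm u) →L[ℝ] ℝ) :
    g.dual (e.symm u) α β = ∑ i, ∑ j, (gramE g.form e u)⁻¹ i j * α (coordE e u (stdVec n i)) *
      β (coordE e u (stdVec n j)) := by
  -- A frame orthonormal in the chart is mapped by `coordE` to one orthonormal for the metric on the
  -- tangent space; both contractions equal the same sum over the frame.
  obtain ⟨f, hf⟩ := exists_isFrame (metricGerm_gramE g he hu).posDef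
  have h1 := hf.contr_covectors ((α : E n →L[ℝ] ℝ) ∘L coordE e u) ((β : E n →L[ℝ] ℝ) ∘L coordE e u)
  set H : Matrix (Fin n) (Fin n) ℝ :=
    Matrix.of fun i j => g.inner (e.symm u) (stdVec n i) (stdVec n j) with hH
  have hb : g.bilAt (e.symm u) = bil H := bil_eq_of_basis fun i j => rfl
  have hf' : IsFrame (bil H) fun a => coordE e u (f a) := by
    intro a c
    rw [← hb, ← hf a c, bil_gramE]
    rfl
  have h2 := hf'.contr_covectors α β
  exact h2.trans h1.symm

lemma dual_diff_eq (he : IsChart e) {f k : M → ℝ} {u : E n} (hu : u ∈ e.target)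
    (hf : MDifferentiableAt (𝓡 n) 𝓘(ℝ) f (e.symm u))
    (hk : MDifferentiableAt (𝓡 n) 𝓘(ℝ) k (e.symm u)) :
    g.dual (e.symm u) (diff f (e.symm u)) (diff k (e.symm u)) =
      ∑ i, ∑ j, (gramE g.form e u)⁻¹ i j * pd i (f ∘ e.symm) u * pd j (k ∘ e.symm) u := by
  rw [dual_symm_eq g he hu]
  simp only [pd, he.fderiv_comp_symm hu hf, he.fderiv_comp_symm hu hk]

/-- The flux density `√(det G) Gⁱʲ ∂ⱼF`. -/
def flux (G : E n → Matrix (Fin n) (Fin n) ℝ) (F : E n → ℝ) (i : Fin n) (u : E n) : ℝ :=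
  Real.sqrt (G u).det * ∑ j, (G u)⁻¹ i j * pd j F u

lemma lapLoc_eq_flux (G : E n → Matrix (Fin n) (Fin n) ℝ) (F : E n → ℝ) (u : E n) :
    lapLoc G F u = (Real.sqrt (G u).det)⁻¹ * ∑ i, pd i (flux G F i) u := rfl

lemma lapLoc_congr (G : E n → Matrix (Fin n) (Fin n) ℝ) {F F' : E n → ℝ} {u : E n}
    (h : F =ᶠ[𝓝 u] F') : lapLoc G F u = lapLoc G F' u := by
  have h1 : ∀ i, flux G F i =ᶠ[𝓝 u] flux G F' i := by
    intro i
    filter_upwards [h.eventuallyEq_nhds] with v hv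
    simp only [flux, pd, hv.fderiv_eq]
  simp only [lapLoc_eq_flux, pd, (h1 _).fderiv_eq]

/-- The Laplacian, in any chart. -/
lemma laplacian_eq (he : IsChart e) {f : M → ℝ} {x : M} (hx : x ∈ e.source)
    (hf : ContMDiffAt (𝓡 n) 𝓘(ℝ) ∞ f x) :
    g.laplacian f x = lapLoc (gramE g.form e) (f ∘ e.symm) (e x) := by
  -- The definition uses the preferred chart at x, which changes with x. Only after passing to a
  -- fixed chart `e` can the result be differentiated in x.
  set c := chartAt (E n) x
  have hxc : x ∈ c.source := mem_chart_source _ x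
  have h0 : g.laplacian f x = lapLoc (gramE g.form c) (f ∘ c.symm) (c x) := rfl
  have hc := isChart_chartAt (n := n) x
  have hu : e x ∈ e.target := e.map_source hx
  have hu' : e.symm (e x) ∈ c.source := by rwa [e.left_inv hx]
  have hφ : (c ∘ e.symm) (e x) = c x := by simp [e.left_inv hx]
  have h1 := (isPullback_transition g he hc hu hu').lapLoc_eq (F := f ∘ c.symm)
    (by rw [hφ]; exact metricGerm_gramE g hc (c.map_source hxc)) (metricGerm_gramE g he hu)
    (by
      rw [hφ]
      exact hc.contDiffAt_comp_symm le_rfl (c.map_source hxc) (by rwa [c.left_inv hxc]))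
  rw [hφ] at h1
  rw [h0, ← h1]
  have h2 : f ∘ e.symm =ᶠ[𝓝 (e x)] (f ∘ c.symm) ∘ (c ∘ e.symm) := by
    have : ∀ᶠ v in 𝓝 (e x), e.symm v ∈ c.source :=
      (e.continuousAt_symm hu).eventually (c.open_source.mem_nhds hu')
    filter_upwards [this] with v hv
    simp [c.left_inv hv]
  exact lapLoc_congr _ h2.symm

/-- The scalar curvature, in any chart. -/
lemma scalarCurvature_eq (he : IsChart e) {x : M} (hx : x ∈ e.source) :
    g.scalarCurvature x = scalLoc (gramE g.form e) (e x) := by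
  set c := chartAt (E n) x
  have hxc : x ∈ c.source := mem_chart_source _ x
  have h0 : g.scalarCurvature x = scalLoc (gramE g.form c) (c x) := rfl
  have hc := isChart_chartAt (n := n) x
  have hu : e x ∈ e.target := e.map_source hx
  have hu' : e.symm (e x) ∈ c.source := by rwa [e.left_inv hx]
  have hφ : (c ∘ e.symm) (e x) = c x := by simp [e.left_inv hx]
  have h1 := (isPullback_transition g he hc hu hu').scalLoc_eq
    (by rw [hφ]; exact metricGerm_gramE g hc (c.map_source hxc)) (metricGerm_gramE g he hu)
  rw [h0, h1, hφ]

/-! #### Smoothness -/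

/-- The entries of the inverse matrix are coordinates of the inverse operator, and inversion of
operators is smooth. -/
lemma contDiffAt_inv_entry {G : E n → Matrix (Fin n) (Fin n) ℝ} {u : E n} (hG : MetricGerm G u)
    (i j : Fin n) : ContDiffAt ℝ ∞ (fun v => (G v)⁻¹ i j) u := by
  have h1 : ContDiffAt ℝ ∞ (fun v => (bil (G v)).inverse) u :=
    ContDiffAt.comp (g := ContinuousLinearMap.inverse) u
      hG.isInner.self_of_nhds.contDiffAt_inverse hG.contDiffAt_bil
  have h2 : ContDiffAt ℝ ∞ (fun v => (EuclideanSpace.proj i : E n →L[ℝ] ℝ)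
      ((bil (G v)).inverse (EuclideanSpace.proj j : E n →L[ℝ] ℝ))) u :=
    (EuclideanSpace.proj i : E n →L[ℝ] ℝ).contDiff.contDiffAt.comp u (h1.clm_apply contDiffAt_const)
  refine h2.congr_of_eventuallyEq ?_
  filter_upwards [hG] with v hv
  rw [proj_apply_coord, inverse_bil hv.2]
  simp [stdVec_apply]

lemma contDiffAt_sqrt_det {G : E n → Matrix (Fin n) (Fin n) ℝ} {u : E n} (hG : MetricGerm G u) :
    ContDiffAt ℝ ∞ (fun v => Real.sqrt (G v).det) u := by
  refine ContDiffAt.sqrt ?_ hG.posDef.det_pos.ne'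
  simp only [Matrix.det_apply]
  exact ContDiffAt.sum fun τ _ => (contDiff_const_smul _).contDiffAt.comp u
    (contDiffAt_prod fun i _ => hG.self_of_nhds.1 _ _)

lemma contDiffAt_pd {F : E n → ℝ} {u : E n} (hF : ContDiffAt ℝ ∞ F u) (i : Fin n) :
    ContDiffAt ℝ ∞ (pd i F) u :=
  (hF.fderiv_right (m := ∞) (by simp)).clm_apply contDiffAt_const

lemma contDiffAt_flux {G : E n → Matrix (Fin n) (Fin n) ℝ} {u : E n} (hG : MetricGerm G u)
    {F : E n → ℝ} (hF : ContDiffAt ℝ ∞ F u) (i : Fin n) : ContDiffAt ℝ ∞ (flux G F i) u :=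
  (contDiffAt_sqrt_det hG).mul (ContDiffAt.sum fun j _ =>
    (contDiffAt_inv_entry hG i j).mul (contDiffAt_pd hF j))

lemma contDiffAt_lapLoc {G : E n → Matrix (Fin n) (Fin n) ℝ} {u : E n} (hG : MetricGerm G u)
    {F : E n → ℝ} (hF : ContDiffAt ℝ ∞ F u) : ContDiffAt ℝ ∞ (lapLoc G F) u :=
  ((contDiffAt_sqrt_det hG).inv (Real.sqrt_pos.2 hG.posDef.det_pos).ne').mul
    (ContDiffAt.sum fun i _ => contDiffAt_pd (contDiffAt_flux hG hF i) i)

lemma contDiffAt_scalLoc {G : E n → Matrix (Fin n) (Fin n) ℝ} {u : E n} (hG : MetricGerm G u) :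
    ContDiffAt ℝ ∞ (scalLoc G) u := by
  have h1 : ∀ k i j, ContDiffAt ℝ ∞ (chrLoc G k i j) u := fun k i j =>
    contDiffAt_const.mul (ContDiffAt.sum fun l _ => (contDiffAt_inv_entry hG k l).mul
      (((contDiffAt_pd (hG.self_of_nhds.1 _ _) _).add (contDiffAt_pd (hG.self_of_nhds.1 _ _) _)).sub
        (contDiffAt_pd (hG.self_of_nhds.1 _ _) _)))
  refine ContDiffAt.sum fun i _ => ContDiffAt.sum fun j _ => (contDiffAt_inv_entry hG i j).mul ?_
  exact ContDiffAt.sum fun k _ => ((contDiffAt_pd (h1 _ _ _) _).sub (contDiffAt_pd (h1 _ _ _) _)).add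
    (ContDiffAt.sum fun l _ => ((h1 _ _ _).mul (h1 _ _ _)).sub ((h1 _ _ _).mul (h1 _ _ _)))

/-- Smooth functions on the manifold. -/
abbrev Smooth (f : M → ℝ) : Prop := ContMDiff (𝓡 n) 𝓘(ℝ) ∞ f

lemma smooth_of_charts {f : M → ℝ} (h : ∀ e : OpenPartialHomeomorph M (E n), IsChart e →
    ∀ u ∈ e.target, ContDiffAt ℝ ∞ (f ∘ e.symm) u) : Smooth (n := n) f := by
  intro x
  have hx := mem_chart_source (E n) x
  have h1 := (h _ (isChart_chartAt x) _ ((chartAt (E n) x).map_source hx)).contMDiffAt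
  have h2 := h1.comp x ((isChart_chartAt (n := n) x).contMDiffAt hx)
  refine h2.congr_of_eventuallyEq ?_
  filter_upwards [(chartAt (E n) x).open_source.mem_nhds hx] with y hy
  simp [(chartAt (E n) x).left_inv hy]

lemma smooth_dual {f k : M → ℝ} (hf : Smooth (n := n) f) (hk : Smooth (n := n) k) :
    Smooth (n := n) fun x => g.dual x (diff f x) (diff k x) := by
  refine smooth_of_charts fun e he u hu => ?_
  have h1 : ContDiffAt ℝ ∞ (fun u => ∑ i, ∑ j, (gramE g.form e u)⁻¹ i j * pd i (f ∘ e.symm) u *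
      pd j (k ∘ e.symm) u) u :=
    ContDiffAt.sum fun i _ => ContDiffAt.sum fun j _ =>
      ((contDiffAt_inv_entry (metricGerm_gramE g he hu) i j).mul
        (contDiffAt_pd (he.contDiffAt_comp_symm le_rfl hu (hf _)) i)).mul
        (contDiffAt_pd (he.contDiffAt_comp_symm le_rfl hu (hk _)) j)
  refine h1.congr_of_eventuallyEq ?_
  filter_upwards [e.open_target.mem_nhds hu] with v hv
  exact dual_diff_eq g he hv ((hf _).mdifferentiableAt (by simp)) ((hk _).mdifferentiableAt (by simp))

lemma smooth_laplacian {f : M → ℝ} (hf : Smooth (n := n) f) :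
    Smooth (n := n) (g.laplacian f) := by
  refine smooth_of_charts fun e he u hu => ?_
  refine (contDiffAt_lapLoc (metricGerm_gramE g he hu)
    (he.contDiffAt_comp_symm le_rfl hu (hf _))).congr_of_eventuallyEq ?_
  filter_upwards [e.open_target.mem_nhds hu] with v hv
  rw [Function.comp, laplacian_eq g he (e.map_target hv) (hf _), e.right_inv hv]

lemma smooth_scalarCurvature : Smooth (n := n) g.scalarCurvature := by
  refine smooth_of_charts fun e he u hu => ?_
  refine (contDiffAt_scalLoc (metricGerm_gramE g he hu)).congr_of_eventuallyEq ?_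
  filter_upwards [e.open_target.mem_nhds hu] with v hv
  rw [Function.comp, scalarCurvature_eq g he (e.map_target hv), e.right_inv hv]

lemma smooth_J : Smooth (n := n) g.J := (smooth_scalarCurvature g).div_const _

end LocalFormulas

/-! ### Product and chain rules for the Laplacian in coordinates, and its conformal change. -/

section LocalCalculus

variable {n : ℕ} {G G' : E n → Matrix (Fin n) (Fin n) ℝ} {u : E n} {F H : E n → ℝ}

lemma flux_mul (G : E n → Matrix (Fin n) (Fin n) ℝ) (hF : DifferentiableAt ℝ F u)
    (hH : DifferentiableAt ℝ H u) (i : Fin n) :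
    flux G (fun v => F v * H v) i u = F u * flux G H i u + H u * flux G F i u := by
  have h1 : ∀ j, pd j (fun v => F v * H v) u = F u * pd j H u + H u * pd j F u := by
    intro j
    rw [pd, fderiv_fun_mul hF hH]
    simp [pd]
  simp only [flux, h1, mul_add, Finset.sum_add_distrib, Finset.mul_sum]
  congr 1 <;> exact Finset.sum_congr rfl fun j _ => by ring

lemma pd_mul (hF : DifferentiableAt ℝ F u) (hH : DifferentiableAt ℝ H u) (i : Fin n) :
    pd i (fun v => F v * H v) u = F u * pd i H u + pd i F u * H u := by
  rw [pd, fderiv_fun_mul hF hH]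
  simp [pd, mul_comm]

lemma pd_add (hF : DifferentiableAt ℝ F u) (hH : DifferentiableAt ℝ H u) (i : Fin n) :
    pd i (fun v => F v + H v) u = pd i F u + pd i H u := by
  rw [pd, fderiv_fun_add hF hH]
  simp [pd]

lemma pd_congr {F H : E n → ℝ} (h : F =ᶠ[𝓝 u] H) (i : Fin n) : pd i F u = pd i H u := by
  rw [pd, pd, h.fderiv_eq]

/-- The pairing `Gⁱʲ ∂ᵢF ∂ⱼH`. -/
def dotLoc (G : E n → Matrix (Fin n) (Fin n) ℝ) (F H : E n → ℝ) (u : E n) : ℝ :=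
  ∑ i, ∑ j, (G u)⁻¹ i j * pd i F u * pd j H u

lemma sum_pd_mul_flux (G : E n → Matrix (Fin n) (Fin n) ℝ) (F H : E n → ℝ) (u : E n) :
    ∑ i, pd i F u * flux G H i u = Real.sqrt (G u).det * dotLoc G F H u := by
  rw [dotLoc, Finset.mul_sum]
  refine Finset.sum_congr rfl fun i _ => ?_
  rw [flux, mul_left_comm, Finset.mul_sum]
  congr 1
  exact Finset.sum_congr rfl fun j _ => by ring

lemma dotLoc_symm (hG : MetricGerm G u) (F H : E n → ℝ) : dotLoc G F H u = dotLoc G H F u := by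
  rw [dotLoc, dotLoc, Finset.sum_comm]
  exact Finset.sum_congr rfl fun i _ => Finset.sum_congr rfl fun j _ => by
    rw [inv_symm hG.posDef j i]; ring

/-- The divergence of `F ∇H`. -/
lemma sum_pd_mul_flux_eq (hG : MetricGerm G u) (hF : DifferentiableAt ℝ F u)
    (hH : ContDiffAt ℝ ∞ H u) :
    ∑ i, pd i (fun v => F v * flux G H i v) u =
      Real.sqrt (G u).det * (F u * lapLoc G H u + dotLoc G F H u) := by
  have hpos : 0 < Real.sqrt (G u).det := Real.sqrt_pos.2 hG.posDef.det_pos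
  have h1 : ∀ i, pd i (fun v => F v * flux G H i v) u =
      F u * pd i (flux G H i) u + pd i F u * flux G H i u := fun i =>
    pd_mul hF ((contDiffAt_flux hG hH i).differentiableAt (by simp)) i
  rw [Finset.sum_congr rfl fun i _ => h1 i, Finset.sum_add_distrib, sum_pd_mul_flux,
    ← Finset.mul_sum, lapLoc_eq_flux]
  field_simp

lemma lapLoc_mul (hG : MetricGerm G u) (hF : ∀ᶠ v in 𝓝 u, ContDiffAt ℝ ∞ F v)
    (hH : ∀ᶠ v in 𝓝 u, ContDiffAt ℝ ∞ H v) :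
    lapLoc G (fun v => F v * H v) u = F u * lapLoc G H u + H u * lapLoc G F u +
      2 * dotLoc G F H u := by
  have hpos : 0 < Real.sqrt (G u).det := Real.sqrt_pos.2 hG.posDef.det_pos
  have h1 : ∀ i, pd i (flux G (fun v => F v * H v) i) u =
      pd i (fun v => F v * flux G H i v) u + pd i (fun v => H v * flux G F i v) u := by
    intro i
    rw [← pd_add]
    · refine pd_congr ?_ i
      filter_upwards [hF, hH] with v h1 h2
      exact flux_mul G (h1.differentiableAt (by simp)) (h2.differentiableAt (by simp)) i
    · exact ((hF.self_of_nhds.mul (contDiffAt_flux hG hH.self_of_nhds i))).differentiableAt (by simp)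
    · exact ((hH.self_of_nhds.mul (contDiffAt_flux hG hF.self_of_nhds i))).differentiableAt (by simp)
  rw [lapLoc_eq_flux, Finset.sum_congr rfl fun i _ => h1 i, Finset.sum_add_distrib,
    sum_pd_mul_flux_eq hG (hF.self_of_nhds.differentiableAt (by simp)) hH.self_of_nhds,
    sum_pd_mul_flux_eq hG (hH.self_of_nhds.differentiableAt (by simp)) hF.self_of_nhds,
    dotLoc_symm hG H F]
  field_simp
  ring

lemma lapLoc_add (hG : MetricGerm G u) (hF : ∀ᶠ v in 𝓝 u, ContDiffAt ℝ ∞ F v)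
    (hH : ∀ᶠ v in 𝓝 u, ContDiffAt ℝ ∞ H v) :
    lapLoc G (fun v => F v + H v) u = lapLoc G F u + lapLoc G H u := by
  have h1 : ∀ i, pd i (flux G (fun v => F v + H v) i) u = pd i (flux G F i) u + pd i (flux G H i) u := by
    intro i
    rw [← pd_add]
    · refine pd_congr ?_ i
      filter_upwards [hF, hH] with v h1 h2
      simp only [flux, pd_add (h1.differentiableAt (by simp)) (h2.differentiableAt (by simp)),
        mul_add, Finset.sum_add_distrib]
    · exact (contDiffAt_flux hG hF.self_of_nhds i).differentiableAt (by simp)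
    · exact (contDiffAt_flux hG hH.self_of_nhds i).differentiableAt (by simp)
  rw [lapLoc_eq_flux, Finset.sum_congr rfl fun i _ => h1 i, Finset.sum_add_distrib, mul_add]
  rfl

lemma pd_comp {ψ : ℝ → ℝ} (hψ : DifferentiableAt ℝ ψ (F u)) (hF : DifferentiableAt ℝ F u)
    (i : Fin n) : pd i (fun v => ψ (F v)) u = deriv ψ (F u) * pd i F u := by
  have := (hψ.hasDerivAt.comp_hasFDerivAt u hF.hasFDerivAt).fderiv
  rw [pd, show (fun v => ψ (F v)) = ψ ∘ F from rfl, this]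
  simp [pd]

lemma lapLoc_exp (hG : MetricGerm G u) (hF : ∀ᶠ v in 𝓝 u, ContDiffAt ℝ ∞ F v) :
    lapLoc G (fun v => Real.exp (F v)) u = Real.exp (F u) * (lapLoc G F u + dotLoc G F F u) := by
  have hpos : 0 < Real.sqrt (G u).det := Real.sqrt_pos.2 hG.posDef.det_pos
  have h0 : ∀ i v, DifferentiableAt ℝ F v →
      pd i (fun v => Real.exp (F v)) v = Real.exp (F v) * pd i F v := by
    intro i v hv
    rw [pd_comp Real.differentiableAt_exp hv, Real.deriv_exp]
  have dF := hF.self_of_nhds.differentiableAt (by simp)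
  have h1 : ∀ i, pd i (flux G (fun v => Real.exp (F v)) i) u =
      pd i (fun v => Real.exp (F v) * flux G F i v) u := by
    intro i
    refine pd_congr ?_ i
    filter_upwards [hF] with v h1
    simp only [flux, h0 _ v (h1.differentiableAt (by simp)), Finset.mul_sum]
    exact Finset.sum_congr rfl fun j _ => by ring
  rw [lapLoc_eq_flux, Finset.sum_congr rfl fun i _ => h1 i,
    sum_pd_mul_flux_eq hG dF.exp hF.self_of_nhds]
  have h2 : dotLoc G (fun v => Real.exp (F v)) F u = Real.exp (F u) * dotLoc G F F u := by
    simp only [dotLoc, h0 _ u dF, Finset.mul_sum]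
    exact Finset.sum_congr rfl fun i _ => Finset.sum_congr rfl fun j _ => by ring
  rw [h2]
  field_simp

/-- The conformal change of the Laplacian. -/
lemma lapLoc_conformal (hG : MetricGerm G u) {η : E n → ℝ} (hη : ContDiffAt ℝ ∞ η u)
    (hG' : ∀ᶠ v in 𝓝 u, G' v = Real.exp (2 * η v) • G v) (hF : ContDiffAt ℝ ∞ F u) :
    lapLoc G' F u = (Real.exp (2 * η u))⁻¹ *
      (lapLoc G F u + ((n : ℝ) - 2) * dotLoc G η F u) := by
  have hpos : 0 < Real.sqrt (G u).det := Real.sqrt_pos.2 hG.posDef.det_pos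
  have hdet : ∀ v, G' v = Real.exp (2 * η v) • G v →
      Real.sqrt (G' v).det = Real.exp (n * η v) * Real.sqrt (G v).det := by
    intro v hv
    rw [hv, Matrix.det_smul, Real.sqrt_mul (by positivity), Fintype.card_fin, ← Real.exp_nat_mul,
      show (n : ℝ) * (2 * η v) = 2 * (n * η v) by ring, two_mul, Real.exp_add, Real.sqrt_mul_self]
    positivity
  -- √det G scales by e^{nη} and the inverse matrix by e^{-2η}, whence the weight n-2. The gradient
  -- of e^{(n-2)η} produces the first-order term of the conformal law.
  have hfl : ∀ i, flux G' F i =ᶠ[𝓝 u] fun v => Real.exp (((n : ℝ) - 2) * η v) * flux G F i v := by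
    intro i
    filter_upwards [hG', hG] with v hv hv2
    have hinv : (G' v)⁻¹ = (Real.exp (2 * η v))⁻¹ • (G v)⁻¹ := by
      have := Matrix.inv_smul' (A := G v) (Units.mk0 (Real.exp (2 * η v)) (Real.exp_pos _).ne')
        (isUnit_iff_ne_zero.2 hv2.2.det_pos.ne')
      rw [hv]
      simpa [Units.smul_def] using this
    rw [flux, flux, hdet v hv, hinv]
    simp only [Matrix.smul_apply, smul_eq_mul, Finset.mul_sum]
    refine Finset.sum_congr rfl fun j _ => ?_
    rw [sub_mul, Real.exp_sub]
    field_simp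
  have dη : DifferentiableAt ℝ (fun v => ((n : ℝ) - 2) * η v) u :=
    (hη.differentiableAt (by simp)).const_mul _
  rw [lapLoc_eq_flux, Finset.sum_congr rfl fun i _ => pd_congr (hfl i) i,
    sum_pd_mul_flux_eq hG dη.exp hF, hdet u hG'.self_of_nhds]
  have h2 : dotLoc G (fun v => Real.exp (((n : ℝ) - 2) * η v)) F u =
      Real.exp (((n : ℝ) - 2) * η u) * (((n : ℝ) - 2) * dotLoc G η F u) := by
    have h0 : ∀ i, pd i (fun v => Real.exp (((n : ℝ) - 2) * η v)) u =
        Real.exp (((n : ℝ) - 2) * η u) * (((n : ℝ) - 2) * pd i η u) := by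
      intro i
      rw [pd_comp Real.differentiableAt_exp dη, Real.deriv_exp]
      simp [pd, fderiv_const_mul (hη.differentiableAt (by simp))]
    simp only [dotLoc, h0, Finset.mul_sum]
    exact Finset.sum_congr rfl fun i _ => Finset.sum_congr rfl fun j _ => by ring
  rw [h2, sub_mul, Real.exp_sub]
  field_simp

end LocalCalculus

/-! ### The same calculus on the manifold, and the conformal laws of Δ and J. -/

section Calculus

variable {n : ℕ} {M : Type*} [TopologicalSpace M] [ChartedSpace (E n) M] [IsManifold (𝓡 n) ∞ M]
  {e : OpenPartialHomeomorph M (E n)} (g : Metric n M) {f k : M → ℝ} {x : M}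

lemma Smooth.mdiff (hf : Smooth (n := n) f) (x : M) : MDifferentiableAt (𝓡 n) 𝓘(ℝ) f x :=
  (hf x).mdifferentiableAt (by simp)

lemma diff_mul (hf : MDifferentiableAt (𝓡 n) 𝓘(ℝ) f x) (hk : MDifferentiableAt (𝓡 n) 𝓘(ℝ) k x) :
    diff (n := n) (fun y => f y * k y) x = f x • diff k x + k x • diff f x :=
  mvfderiv_fun_mul hf hk

lemma diff_add (hf : MDifferentiableAt (𝓡 n) 𝓘(ℝ) f x) (hk : MDifferentiableAt (𝓡 n) 𝓘(ℝ) k x) :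
    diff (n := n) (fun y => f y + k y) x = diff f x + diff k x :=
  mvfderiv_fun_add hf hk

lemma diff_const (c : ℝ) : diff (n := n) (fun _ : M => c) x = 0 := mvfderiv_const c

lemma diff_comp {ψ : ℝ → ℝ} (hψ : DifferentiableAt ℝ ψ (f x))
    (hf : MDifferentiableAt (𝓡 n) 𝓘(ℝ) f x) :
    diff (n := n) (fun y => ψ (f y)) x = deriv ψ (f x) • diff f x := by
  have h : mfderiv (𝓡 n) 𝓘(ℝ) (ψ ∘ f) x =
      (mfderiv 𝓘(ℝ) 𝓘(ℝ) ψ (f x)).comp (mfderiv (𝓡 n) 𝓘(ℝ) f x) :=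
    mfderiv_comp (I' := 𝓘(ℝ)) x hψ.mdifferentiableAt hf
  rw [mfderiv_eq_fderiv] at h
  have h2 : ∀ v : TangentSpace (𝓡 n) x, mfderiv (𝓡 n) 𝓘(ℝ) (ψ ∘ f) x v =
      fderiv ℝ ψ (f x) (diff f x v) := fun v => by rw [h]; rfl
  refine ContinuousLinearMap.ext fun v => (h2 v).trans ?_
  change _ = deriv ψ (f x) * (diff f x v)
  rw [fderiv_eq_smul_deriv, smul_eq_mul, mul_comm]

lemma diff_congr (h : f =ᶠ[𝓝 x] k) : diff (n := n) f x = diff k x := by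
  rw [diff, diff, mvfderiv, mvfderiv, h.mfderiv_eq, h.self_of_nhds]

variable (α β γ : TangentSpace (𝓡 n) x →L[ℝ] ℝ) (c : ℝ)

/-- The components of a covector in the standard basis. -/
def covec {x : M} (α : TangentSpace (𝓡 n) x →L[ℝ] ℝ) : Fin n → ℝ := fun i => α (stdVec n i)

/-- The matrix of a metric at `x` in the standard basis of the tangent space. -/
def Metric.matAt (g : Metric n M) (x : M) : Matrix (Fin n) (Fin n) ℝ :=
  Matrix.of fun i j => g.bilAt x (stdVec n i) (stdVec n j)

lemma posDef_matAt (x : M) : (g.matAt x).PosDef :=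
  posDef_of_isInner (b := g.bilAt x) (g.isInner_bilAt x) fun _ _ => rfl

lemma dual_eq_dotProduct :
    g.dual x α β = covec α ⬝ᵥ ((g.matAt x)⁻¹).mulVec (covec β) := by
  simp only [dotProduct, Matrix.mulVec, Finset.mul_sum]
  refine Finset.sum_congr rfl fun i _ => Finset.sum_congr rfl fun j _ => ?_
  rw [← mul_assoc, mul_comm (covec α i)]
  rfl

lemma covec_add : covec (α + β) = covec α + covec β := rfl

lemma covec_smul : covec (c • α) = c • covec α := rfl

lemma covec_zero : covec (0 : TangentSpace (𝓡 n) x →L[ℝ] ℝ) = 0 := rfl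

lemma dual_add_left : g.dual x (α + β) γ = g.dual x α γ + g.dual x β γ := by
  simp only [dual_eq_dotProduct, covec_add, add_dotProduct]

lemma dual_smul_left : g.dual x (c • α) γ = c * g.dual x α γ := by
  simp only [dual_eq_dotProduct, covec_smul, smul_dotProduct, smul_eq_mul]

lemma dual_symm : g.dual x α β = g.dual x β α := by
  have h : ((g.matAt x)⁻¹).transpose = (g.matAt x)⁻¹ := by
    ext i j; exact inv_symm (posDef_matAt g x) j i
  rw [dual_eq_dotProduct, dual_eq_dotProduct, dotProduct_comm, Matrix.dotProduct_mulVec,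
    ← Matrix.mulVec_transpose, h, dotProduct_comm, dotProduct_comm]

lemma dual_add_right : g.dual x γ (α + β) = g.dual x γ α + g.dual x γ β := by
  rw [dual_symm, dual_add_left, dual_symm, dual_symm g β]

lemma dual_smul_right : g.dual x γ (c • α) = c * g.dual x γ α := by
  rw [dual_symm, dual_smul_left, dual_symm]

lemma dual_zero_left : g.dual x 0 γ = 0 := by
  rw [dual_eq_dotProduct, covec_zero, zero_dotProduct]

lemma dual_sub_right : g.dual x γ (α - β) = g.dual x γ α - g.dual x γ β := by
  have : α - β = α + (-1 : ℝ) • β := by ext; simp [sub_eq_add_neg]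
  rw [this, dual_add_right, dual_smul_right]; ring

lemma dual_self_pos (hα : α ≠ 0) : 0 < g.dual x α α := by
  have hα' : covec α ≠ 0 := by
    intro h
    refine hα (ContinuousLinearMap.ext fun v => ?_)
    let a : E n →L[ℝ] ℝ := α
    have h0 : ∀ i, a (stdVec n i) = 0 := congrFun h
    have h1 : ∀ v : E n, a v = 0 := fun v => by
      rw [← sum_smul_stdVec v, map_sum]
      exact Finset.sum_eq_zero fun i _ => by rw [map_smul, h0, smul_zero]
    exact h1 v
  have := (posDef_matAt g x).inv.dotProduct_mulVec_pos hα'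
  rw [dual_eq_dotProduct]
  exact this

lemma dual_eq_dotLoc (he : IsChart e) (hx : x ∈ e.source)
    (hf : MDifferentiableAt (𝓡 n) 𝓘(ℝ) f x) (hk : MDifferentiableAt (𝓡 n) 𝓘(ℝ) k x) :
    g.dual x (diff f x) (diff k x) = dotLoc (gramE g.form e) (f ∘ e.symm) (k ∘ e.symm) (e x) := by
  have h := dual_diff_eq g he (f := f) (k := k) (e.map_source hx)
  rw [e.left_inv hx] at h
  exact h hf hk

lemma eventually_contDiffAt_chart (he : IsChart e) (hf : Smooth (n := n) f) (hx : x ∈ e.source) :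
    ∀ᶠ v in 𝓝 (e x), ContDiffAt ℝ ∞ (f ∘ e.symm) v := by
  filter_upwards [e.open_target.mem_nhds (e.map_source hx)] with v hv
    using he.contDiffAt_comp_symm le_rfl hv (hf _)

lemma laplacian_mul (hf : Smooth (n := n) f) (hk : Smooth (n := n) k) (x : M) :
    g.laplacian (fun y => f y * k y) x = f x * g.laplacian k x + k x * g.laplacian f x +
      2 * g.dual x (diff f x) (diff k x) := by
  have hfk : Smooth (n := n) fun y => f y * k y := hf.mul hk
  have hx := mem_chart_source (E n) x
  have he := isChart_chartAt (n := n) x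
  rw [laplacian_eq g he hx (hf x), laplacian_eq g he hx (hk x), dual_eq_dotLoc g he hx (hf.mdiff x)
    (hk.mdiff x), laplacian_eq g he hx (hfk x)]
  have := lapLoc_mul (metricGerm_gramE g he ((chartAt (E n) x).map_source hx))
    (eventually_contDiffAt_chart he hf hx) (eventually_contDiffAt_chart he hk hx)
  simp only [Function.comp, (chartAt (E n) x).left_inv hx] at this
  exact this

lemma laplacian_add (hf : Smooth (n := n) f) (hk : Smooth (n := n) k) (x : M) :
    g.laplacian (fun y => f y + k y) x = g.laplacian f x + g.laplacian k x := by
  have hfk : Smooth (n := n) fun y => f y + k y := hf.add hk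
  have hx := mem_chart_source (E n) x
  have he := isChart_chartAt (n := n) x
  rw [laplacian_eq g he hx (hf x), laplacian_eq g he hx (hk x), laplacian_eq g he hx (hfk x)]
  exact lapLoc_add (metricGerm_gramE g he ((chartAt (E n) x).map_source hx))
    (eventually_contDiffAt_chart he hf hx) (eventually_contDiffAt_chart he hk hx)

lemma laplacian_exp (hf : Smooth (n := n) f) (x : M) :
    g.laplacian (fun y => Real.exp (f y)) x =
      Real.exp (f x) * (g.laplacian f x + g.dual x (diff f x) (diff f x)) := by
  have hx := mem_chart_source (E n) x
  have he := isChart_chartAt (n := n) x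
  have hexp : Smooth (n := n) fun y => Real.exp (f y) := Real.contDiff_exp.contMDiff.comp hf
  rw [laplacian_eq g he hx (hf x), dual_eq_dotLoc g he hx (hf.mdiff x) (hf.mdiff x),
    laplacian_eq g he hx (hexp x)]
  have := lapLoc_exp (metricGerm_gramE g he ((chartAt (E n) x).map_source hx))
    (eventually_contDiffAt_chart he hf hx)
  simp only [Function.comp, (chartAt (E n) x).left_inv hx] at this
  exact this

lemma laplacian_const (c : ℝ) (x : M) : g.laplacian (fun _ => c) x = 0 := by
  have h1 : ∀ i u, flux (gram g.form x) (fun _ => c) i u = 0 := fun i u => by simp [flux, pd]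
  have h2 : g.laplacian (fun _ => c) x =
    lapLoc (gram g.form x) (fun _ => c) (chartAt (E n) x x) := rfl
  rw [h2, lapLoc_eq_flux]
  simp only [pd, funext (h1 _)]
  simp

lemma laplacian_const_mul (hf : Smooth (n := n) f) (c : ℝ) (x : M) :
    g.laplacian (fun y => c * f y) x = c * g.laplacian f x := by
  rw [laplacian_mul g contMDiff_const hf, laplacian_const, diff_const, dual_zero_left]
  ring

/-! #### Conformal changes -/

variable {g} {g' : Metric n M} {Ω : M → ℝ}

lemma IsRescaling.smooth_log (h : IsRescaling g g' Ω) : Smooth (n := n) fun y => Real.log (Ω y) := by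
  intro y
  exact (Real.contDiffAt_log.2 (h.2.1 y).ne').contMDiffAt.comp y (h.1 y)

lemma IsRescaling.exp_log (h : IsRescaling g g' Ω) (y : M) : Real.exp (Real.log (Ω y)) = Ω y :=
  Real.exp_log (h.2.1 y)

lemma IsRescaling.exp_two_log (h : IsRescaling g g' Ω) (y : M) :
    Real.exp (2 * Real.log (Ω y)) = Ω y ^ 2 := by
  rw [two_mul, Real.exp_add, h.exp_log, sq]

lemma IsRescaling.gramE_eq (h : IsRescaling g g' Ω) (e : OpenPartialHomeomorph M (E n)) (u : E n) :
    gramE g'.form e u = Ω (e.symm u) ^ 2 • gramE g.form e u := by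
  ext i j
  exact h.2.2 _ _ _

lemma IsRescaling.dual_eq (h : IsRescaling g g' Ω) (α β : TangentSpace (𝓡 n) x →L[ℝ] ℝ) :
    g'.dual x α β = (Ω x ^ 2)⁻¹ * g.dual x α β := by
  have hH := posDef_of_isInner (b := g.bilAt x) (g.isInner_bilAt x) fun i j => rfl
  have hΩ : Ω x ^ 2 ≠ 0 := pow_ne_zero _ (h.2.1 x).ne'
  have h1 : (Matrix.of fun i j => g'.inner x (stdVec n i) (stdVec n j)) =
      Ω x ^ 2 • Matrix.of fun i j => g.inner x (stdVec n i) (stdVec n j) := by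
    ext i j; exact h.2.2 _ _ _
  have h2 := Matrix.inv_smul' (A := Matrix.of fun i j => g.inner x (stdVec n i) (stdVec n j))
    (Units.mk0 (Ω x ^ 2) hΩ) (isUnit_iff_ne_zero.2 hH.det_pos.ne')
  simp only [Units.smul_def, Units.val_mk0, ← h1] at h2
  simp only [Metric.dual]
  rw [h2]
  simp only [Matrix.smul_apply, Units.val_inv_eq_inv_val, Units.val_mk0, smul_eq_mul,
    Finset.mul_sum, mul_assoc]

lemma IsRescaling.laplacian_eq (h : IsRescaling g g' Ω) (hf : Smooth (n := n) f) (x : M) :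
    g'.laplacian f x = (Ω x ^ 2)⁻¹ * (g.laplacian f x +
      ((n : ℝ) - 2) * g.dual x (diff (fun y => Real.log (Ω y)) x) (diff f x)) := by
  have hx := mem_chart_source (E n) x
  have he := isChart_chartAt (n := n) x
  have hη := h.smooth_log
  rw [RenVol.laplacian_eq g he hx (hf x), RenVol.laplacian_eq g' he hx (hf x),
    dual_eq_dotLoc g he hx (hη.mdiff x) (hf.mdiff x),
    lapLoc_conformal (metricGerm_gramE g he ((chartAt (E n) x).map_source hx))
      (eventually_contDiffAt_chart he hη hx).self_of_nhds
      (Eventually.of_forall fun v => ?_) (eventually_contDiffAt_chart he hf hx).self_of_nhds]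
  · simp only [Function.comp, (chartAt (E n) x).left_inv hx, h.exp_two_log]
  · simp only [Function.comp, h.exp_two_log, h.gramE_eq]

/-- The factor 2(n-1) in the law of the scalar curvature is removed by the normalization of J; this
is where division by n-1 requires n ≥ 2. -/
lemma IsRescaling.J_eq (hn : 2 ≤ n) (h : IsRescaling g g' Ω) (x : M) :
    g'.J x = (Ω x ^ 2)⁻¹ * (g.J x - g.laplacian (fun y => Real.log (Ω y)) x -
      ((n : ℝ) - 2) / 2 * g.dual x (diff (fun y => Real.log (Ω y)) x)
        (diff (fun y => Real.log (Ω y)) x)) := by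
  have hx := mem_chart_source (E n) x
  have he := isChart_chartAt (n := n) x
  have hη := h.smooth_log
  have hn' : (n : ℝ) - 1 ≠ 0 := by
    have : (2 : ℝ) ≤ n := by exact_mod_cast hn
    linarith
  have h1 := scalLoc_conformal (metricGerm_gramE g he ((chartAt (E n) x).map_source hx))
    (metricGerm_gramE g' he ((chartAt (E n) x).map_source hx))
    (eventually_contDiffAt_chart he hη hx).self_of_nhds
    (Eventually.of_forall fun v => by simp only [Function.comp, h.exp_two_log, h.gramE_eq])
  rw [← scalarCurvature_eq g' he hx, ← scalarCurvature_eq g he hx,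
    ← RenVol.laplacian_eq g he hx (hη x)] at h1
  have h2 := dual_eq_dotLoc g he hx (hη.mdiff x) (hη.mdiff x)
  simp only [dotLoc, pd] at h2
  rw [← h2] at h1
  simp only [Function.comp, (chartAt (E n) x).left_inv hx, h.exp_two_log] at h1
  have hΩ : Ω x ≠ 0 := (h.2.1 x).ne'
  rw [Metric.J, Metric.J, h1]
  field_simp

end Calculus

/-! ### Conformal covariance of S, of the Laplace–Robin operator and of its logarithmic version. -/

section Covariance

variable {n : ℕ} {M : Type*} [TopologicalSpace M] [ChartedSpace (E n) M] [IsManifold (𝓡 n) ∞ M]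
  {g g' : Metric n M} {Ω f s : M → ℝ} {x : M}

lemma rpow_eq_exp_log (h : IsRescaling g g' Ω) (w : ℝ) :
    (fun y => Ω y ^ w) = fun y => Real.exp (w * Real.log (Ω y)) := by
  funext y; rw [Real.rpow_def_of_pos (h.2.1 y), mul_comm]

lemma IsRescaling.smooth_const_mul_log (h : IsRescaling g g' Ω) (w : ℝ) :
    Smooth (n := n) fun y => w * Real.log (Ω y) := contMDiff_const.mul h.smooth_log

lemma diff_const_mul (hf : MDifferentiableAt (𝓡 n) 𝓘(ℝ) f x) (c : ℝ) :
    diff (n := n) (fun y => c * f y) x = c • diff f x := by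
  have h := diff_mul (n := n) (f := fun _ => c) mdifferentiableAt_const hf
  rw [diff_const, smul_zero, add_zero] at h
  exact h

lemma IsRescaling.smooth_rpow (h : IsRescaling g g' Ω) (w : ℝ) : Smooth (n := n) fun y => Ω y ^ w := by
  rw [rpow_eq_exp_log h]
  exact Real.contDiff_exp.contMDiff.comp (h.smooth_const_mul_log w)

lemma IsRescaling.diff_rpow (h : IsRescaling g g' Ω) (w : ℝ) (x : M) :
    diff (n := n) (fun y => Ω y ^ w) x = (Ω x ^ w * w) • diff (fun y => Real.log (Ω y)) x := by
  rw [rpow_eq_exp_log h, diff_comp (ψ := Real.exp) Real.differentiableAt_exp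
    ((h.smooth_const_mul_log w).mdiff x), diff_const_mul (h.smooth_log.mdiff x), smul_smul,
    Real.deriv_exp, congrFun (rpow_eq_exp_log h w) x]

lemma IsRescaling.laplacian_rpow (h : IsRescaling g g' Ω) (w : ℝ) (x : M) :
    g.laplacian (fun y => Ω y ^ w) x = Ω x ^ w * (w * g.laplacian (fun y => Real.log (Ω y)) x +
      w ^ 2 * g.dual x (diff (fun y => Real.log (Ω y)) x) (diff (fun y => Real.log (Ω y)) x)) := by
  rw [rpow_eq_exp_log h, laplacian_exp g (h.smooth_const_mul_log w),
    laplacian_const_mul g h.smooth_log, diff_const_mul (h.smooth_log.mdiff x), dual_smul_left,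
    dual_smul_right, congrFun (rpow_eq_exp_log h w) x]
  ring

lemma IsRescaling.diff_rpow_mul (h : IsRescaling g g' Ω) (hf : Smooth (n := n) f) (w : ℝ) (x : M) :
    diff (n := n) (fun y => Ω y ^ w * f y) x =
      Ω x ^ w • (diff f x + (w * f x) • diff (fun y => Real.log (Ω y)) x) := by
  rw [diff_mul ((h.smooth_rpow w).mdiff x) (hf.mdiff x), h.diff_rpow, smul_add, smul_smul, smul_smul]
  congr 2; ring

lemma IsRescaling.laplacian_rpow_mul (h : IsRescaling g g' Ω) (hf : Smooth (n := n) f) (w : ℝ)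
    (x : M) :
    g.laplacian (fun y => Ω y ^ w * f y) x = Ω x ^ w * (g.laplacian f x +
      2 * w * g.dual x (diff (fun y => Real.log (Ω y)) x) (diff f x) +
      f x * (w * g.laplacian (fun y => Real.log (Ω y)) x +
      w ^ 2 * g.dual x (diff (fun y => Real.log (Ω y)) x) (diff (fun y => Real.log (Ω y)) x))) := by
  rw [laplacian_mul g (h.smooth_rpow w) hf, h.laplacian_rpow, h.diff_rpow, dual_smul_left]
  ring

lemma IsRescaling.diff_mul (h : IsRescaling g g' Ω) (hf : Smooth (n := n) f) (x : M) :
    diff (n := n) (fun y => Ω y * f y) x =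
      Ω x • (diff f x + f x • diff (fun y => Real.log (Ω y)) x) := by
  simpa using h.diff_rpow_mul hf 1 x

lemma IsRescaling.laplacian_mul (h : IsRescaling g g' Ω) (hf : Smooth (n := n) f) (x : M) :
    g.laplacian (fun y => Ω y * f y) x = Ω x * (g.laplacian f x +
      2 * g.dual x (diff (fun y => Real.log (Ω y)) x) (diff f x) +
      f x * (g.laplacian (fun y => Real.log (Ω y)) x +
      g.dual x (diff (fun y => Real.log (Ω y)) x) (diff (fun y => Real.log (Ω y)) x))) := by
  simpa using h.laplacian_rpow_mul hf 1 x

lemma IsRescaling.smooth_rpow_mul (h : IsRescaling g g' Ω) (hf : Smooth (n := n) f) (w : ℝ) :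
    Smooth (n := n) fun y => Ω y ^ w * f y := (h.smooth_rpow w).mul hf

lemma IsRescaling.smooth_mul (h : IsRescaling g g' Ω) (hf : Smooth (n := n) f) :
    Smooth (n := n) fun y => Ω y * f y := ContMDiff.mul h.1 hf

/-- The function `Δs + Js`. -/
def Metric.yamabe (g : Metric n M) (s : M → ℝ) (x : M) : ℝ := g.laplacian s x + g.J x * s x

/-- The `S`-curvature of `s` in the scale `g`. -/
def Metric.scurv (g : Metric n M) (s : M → ℝ) (x : M) : ℝ :=
  g.dual x (diff s x) (diff s x) - 2 * s x / (n : ℝ) * (g.laplacian s x + s x * g.J x)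

/-- The Laplace–Robin operator in the scale `g`. -/
def Metric.robin (g : Metric n M) (s : M → ℝ) (w : ℝ) (f : M → ℝ) (x : M) : ℝ :=
  ((n : ℝ) + 2 * w - 2) * (g.dual x (diff s x) (diff f x) + w * (-(1 / (n : ℝ)) * g.yamabe s x) * f x)
    - s x * (g.laplacian f x + w * g.J x * f x)

/-- The Laplace–Robin operator on log-densities of weight `1` in the scale `g`. -/
def Metric.robinLog (g : Metric n M) (s l : M → ℝ) (x : M) : ℝ :=
  ((n : ℝ) - 2) * (g.dual x (diff s x) (diff l x) + -(1 / (n : ℝ)) * g.yamabe s x)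
    - s x * (g.laplacian l x + g.J x)

/-- The function `S⁻¹ D log τ - ⟨dS⁻¹, ∇^σ log τ⟩` in the scale `g`, with `l = log τ`. -/
def Metric.inner₀ (g : Metric n M) (s l : M → ℝ) (x : M) : ℝ :=
  (g.scurv s x)⁻¹ * g.robinLog s l x
    - (s x * g.dual x (diff (fun z => (g.scurv s z)⁻¹) x) (diff l x)
      - g.dual x (diff (fun z => (g.scurv s z)⁻¹) x) (diff s x))

lemma SCurv_eq (σ : Family n M M) (g : Metric n M) : SCurv σ g = g.scurv (σ g) := rfl

lemma laplaceRobin_eq (σ f : Family n M M) (w : ℝ) (g : Metric n M) :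
    laplaceRobin σ w f g = g.robin (σ g) w (f g) := rfl

lemma laplaceRobinLog_eq (σ l : Family n M M) (g : Metric n M) :
    laplaceRobinLog σ 1 l g = g.robinLog (σ g) (l g) := by
  funext x
  simp only [laplaceRobinLog, Metric.robinLog, one_mul, rho, Metric.yamabe]

lemma innerTerm_eq (σ τ : Family n M M) (g : Metric n M) :
    innerTerm σ τ g = g.inner₀ (σ g) (logFam τ g) := by
  funext x
  rw [innerTerm, laplaceRobinLog_eq, nablaSigmaLog, dual_sub_right, dual_smul_right, one_smul]
  rfl

/-! #### Conformal covariance -/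

/-- In weight 1 the term sΔ(log Ω) coming from Δ(Ωs) cancels against the one coming from J, so only
first derivatives of log Ω survive. -/
lemma yamabe_conformal (hn : 2 ≤ n) (h : IsRescaling g g' Ω) (hs : Smooth (n := n) s) (x : M) :
    g'.yamabe (fun y => Ω y * s y) x = (Ω x)⁻¹ * (g.yamabe s x +
      n * g.dual x (diff (fun y => Real.log (Ω y)) x) (diff s x) +
      n / 2 * s x *
        g.dual x (diff (fun y => Real.log (Ω y)) x) (diff (fun y => Real.log (Ω y)) x)) := by
  have hΩ := (h.2.1 x).ne'
  simp only [Metric.yamabe]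
  rw [h.laplacian_eq (h.smooth_mul hs), h.laplacian_mul hs, h.diff_mul hs, h.J_eq hn,
    dual_smul_right, dual_add_right, dual_smul_right]
  field_simp
  ring

/-- The first-order terms produced by |d(Ωs)|² are exactly those of (2s/n) times the law of Δs + Js.
-/
lemma scurv_conformal (hn : 2 ≤ n) (h : IsRescaling g g' Ω) (hs : Smooth (n := n) s) (x : M) :
    g'.scurv (fun y => Ω y * s y) x = g.scurv s x := by
  have hΩ := (h.2.1 x).ne'
  have hn' : (n : ℝ) ≠ 0 := by positivity
  have hY := yamabe_conformal hn h hs x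
  simp only [Metric.yamabe] at hY
  rw [Metric.scurv, Metric.scurv, mul_comm _ (g'.J x), hY, h.dual_eq, h.diff_mul hs]
  simp only [dual_smul_left, dual_smul_right, dual_add_left, dual_add_right]
  rw [dual_symm g (diff s x) (diff (fun y => Real.log (Ω y)) x)]
  field_simp
  ring

/-- The coefficient n+2w-2 is the one for which the terms s⟨d log Ω, df⟩ cancel: Δ contributes 2w
from the product rule and n-2 from its own conformal change. Second derivatives of log Ω cancel
between wfΔ(log Ω) and wJf. -/
lemma robin_conformal (hn : 2 ≤ n) (h : IsRescaling g g' Ω) (hs : Smooth (n := n) s)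
    (hf : Smooth (n := n) f) (w : ℝ) (x : M) :
    g'.robin (fun y => Ω y * s y) w (fun y => Ω y ^ w * f y) x =
      Ω x ^ (w - 1) * g.robin s w f x := by
  have hΩ := (h.2.1 x).ne'
  have hn' : (n : ℝ) ≠ 0 := by positivity
  rw [Real.rpow_sub_one hΩ]
  simp only [Metric.robin]
  rw [yamabe_conformal hn h hs, h.dual_eq, h.diff_mul hs, h.diff_rpow_mul hf,
    h.laplacian_eq (h.smooth_rpow_mul hf w), h.laplacian_rpow_mul hf, h.diff_rpow_mul hf, h.J_eq hn]
  simp only [dual_smul_left, dual_smul_right, dual_add_left, dual_add_right]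
  rw [dual_symm g (diff s x) (diff (fun y => Real.log (Ω y)) x)]
  generalize Ω x ^ w = P
  field_simp
  ring

lemma robinLog_conformal (hn : 2 ≤ n) (h : IsRescaling g g' Ω) (hs : Smooth (n := n) s)
    (hf : Smooth (n := n) f) (x : M) :
    g'.robinLog (fun y => Ω y * s y) (fun y => Real.log (Ω y) + f y) x =
      (Ω x)⁻¹ * g.robinLog s f x := by
  have hΩ := (h.2.1 x).ne'
  have hn' : (n : ℝ) ≠ 0 := by positivity
  have hl : Smooth (n := n) fun y => Real.log (Ω y) + f y := h.smooth_log.add hf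
  simp only [Metric.robinLog]
  rw [yamabe_conformal hn h hs, h.dual_eq, h.diff_mul hs, h.laplacian_eq hl,
    laplacian_add g h.smooth_log hf, diff_add (h.smooth_log.mdiff x) (hf.mdiff x), h.J_eq hn]
  simp only [dual_smul_left, dual_add_left, dual_add_right]
  rw [dual_symm g (diff s x) (diff (fun y => Real.log (Ω y)) x)]
  field_simp
  ring

/-- S has weight 0, so dS⁻¹ does not change, and in s·dl - ds the summand log Ω of the log-density
cancels against the derivative of Ω in d(Ωs). -/
lemma inner₀_conformal (hn : 2 ≤ n) (h : IsRescaling g g' Ω) (hs : Smooth (n := n) s)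
    (hf : Smooth (n := n) f) (x : M) :
    g'.inner₀ (fun y => Ω y * s y) (fun y => Real.log (Ω y) + f y) x =
      (Ω x)⁻¹ * g.inner₀ s f x := by
  have hΩ := (h.2.1 x).ne'
  have hS : (fun z => (g'.scurv (fun y => Ω y * s y) z)⁻¹) = fun z => (g.scurv s z)⁻¹ :=
    funext fun z => by rw [scurv_conformal hn h hs]
  simp only [Metric.inner₀]
  rw [hS, scurv_conformal hn h hs, robinLog_conformal hn h hs hf, h.dual_eq, h.dual_eq,
    h.diff_mul hs, diff_add (h.smooth_log.mdiff x) (hf.mdiff x)]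
  simp only [dual_smul_right, dual_add_right]
  field_simp
  ring

/-! #### Smoothness -/

lemma smooth_yamabe (g : Metric n M) (hs : Smooth (n := n) s) : Smooth (n := n) (g.yamabe s) :=
  (smooth_laplacian g hs).add ((smooth_J g).mul hs)

lemma smooth_scurv (g : Metric n M) (hs : Smooth (n := n) s) : Smooth (n := n) (g.scurv s) := by
  have h : g.scurv s = fun x => g.dual x (diff s x) (diff s x) -
      2 / (n : ℝ) * s x * (g.laplacian s x + s x * g.J x) := by
    funext x; rw [Metric.scurv]; ring
  rw [h]
  exact (smooth_dual g hs hs).sub ((contMDiff_const.mul hs).mul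
    ((smooth_laplacian g hs).add (hs.mul (smooth_J g))))

lemma Smooth.inv (hs : Smooth (n := n) s) (h0 : ∀ x, s x ≠ 0) : Smooth (n := n) fun x => (s x)⁻¹ :=
  fun x => (contDiffAt_inv ℝ (h0 x)).contMDiffAt.comp x (hs x)

lemma smooth_robin (g : Metric n M) (hs : Smooth (n := n) s) (hf : Smooth (n := n) f) (w : ℝ) :
    Smooth (n := n) (g.robin s w f) := by
  have h1 : Smooth (n := n) fun x => g.dual x (diff s x) (diff f x) := smooth_dual g hs hf
  exact (contMDiff_const.mul (h1.add ((contMDiff_const.mul (contMDiff_const.mul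
    (smooth_yamabe g hs))).mul hf))).sub (hs.mul ((smooth_laplacian g hf).add
      ((contMDiff_const.mul (smooth_J g)).mul hf)))

lemma smooth_robinLog (g : Metric n M) (hs : Smooth (n := n) s) (hf : Smooth (n := n) f) :
    Smooth (n := n) (g.robinLog s f) :=
  (contMDiff_const.mul ((smooth_dual g hs hf).add (contMDiff_const.mul
    (smooth_yamabe g hs)))).sub (hs.mul ((smooth_laplacian g hf).add (smooth_J g)))

lemma smooth_inner₀ (g : Metric n M) (hs : Smooth (n := n) s) (hf : Smooth (n := n) f)
    (h0 : ∀ x, g.scurv s x ≠ 0) : Smooth (n := n) (g.inner₀ s f) := by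
  have hS := (smooth_scurv g hs).inv h0
  exact (hS.mul (smooth_robinLog g hs hf)).sub
    ((hs.mul (smooth_dual g hS hf)).sub (smooth_dual g hS hs))

end Covariance

/-! ### Weights of the densities entering the Q-curvature. -/

section Densities

variable {n : ℕ} {M : Type*} [TopologicalSpace M] [ChartedSpace (E n) M] [IsManifold (𝓡 n) ∞ M]
  {c : Set (Metric n M)} {σ τ f : Family n M M} {Z : Set M}

lemma IsDensity.smooth {w : ℝ} (hf : IsDensity c w f) {g : Metric n M} (hg : g ∈ c) :
    Smooth (n := n) (f g) := hf.1 g hg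

lemma IsDensity.rescale {w : ℝ} (hf : IsDensity c w f) {g g' : Metric n M} (hg : g ∈ c)
    (hg' : g' ∈ c) {Ω : M → ℝ} (h : IsRescaling g g' Ω) : f g' = fun y => Ω y ^ w * f g y :=
  funext fun y => hf.2 g hg g' hg' Ω h y

lemma IsDensity.rescale_one (hf : IsDensity c 1 f) {g g' : Metric n M} (hg : g ∈ c)
    (hg' : g' ∈ c) {Ω : M → ℝ} (h : IsRescaling g g' Ω) : f g' = fun y => Ω y * f g y := by
  rw [hf.rescale hg hg' h]; simp only [Real.rpow_one]

lemma IsTrueScale.smooth_log (hτ : IsTrueScale c τ) {g : Metric n M} (hg : g ∈ c) :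
    Smooth (n := n) (logFam τ g) := fun x =>
  (Real.contDiffAt_log.2 (hτ.2 g hg x).ne').contMDiffAt.comp x (hτ.1.smooth hg x)

lemma isDensity_innerTerm (hn : 2 ≤ n) (hσ : IsDensity c 1 σ) (hτ : IsTrueScale c τ)
    (hS : ∀ g ∈ c, ∀ x, SCurv σ g x ≠ 0) : IsDensity c (-1) (innerTerm σ τ) := by
  refine ⟨fun g hg => ?_, fun g hg g' hg' Ω h y => ?_⟩
  · rw [innerTerm_eq]
    exact smooth_inner₀ g (hσ.smooth hg) (hτ.smooth_log hg) (hS g hg)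
  · have hl : logFam τ g' = fun y => Real.log (Ω y) + logFam τ g y := by
      funext y
      rw [logFam, hτ.1.rescale_one hg hg' h, Real.log_mul (h.2.1 y).ne' (hτ.2 g hg y).ne']
      rfl
    rw [innerTerm_eq, innerTerm_eq, hl, hσ.rescale_one hg hg' h,
      inner₀_conformal hn h (hσ.smooth hg) (hτ.smooth_log hg), Real.rpow_neg_one]

lemma isDensity_SCurv (hn : 2 ≤ n) (hσ : IsDensity c 1 σ) : IsDensity c 0 (SCurv σ) := by
  refine ⟨fun g hg => smooth_scurv g (hσ.smooth hg), fun g hg g' hg' Ω h y => ?_⟩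
  rw [Real.rpow_zero, one_mul, SCurv_eq, SCurv_eq, hσ.rescale_one hg hg' h,
    scurv_conformal hn h (hσ.smooth hg)]

lemma isDensity_laplaceRobin (hn : 2 ≤ n) (hσ : IsDensity c 1 σ) {w : ℝ} (hf : IsDensity c w f) :
    IsDensity c (w - 1) (laplaceRobin σ w f) := by
  refine ⟨fun g hg => smooth_robin g (hσ.smooth hg) (hf.smooth hg) w, fun g hg g' hg' Ω h y => ?_⟩
  rw [laplaceRobin_eq, laplaceRobin_eq, hσ.rescale_one hg hg' h, hf.rescale hg hg' h,
    robin_conformal hn h (hσ.smooth hg) (hf.smooth hg)]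

lemma isDensity_negDSinvPow (hn : 2 ≤ n) (hσ : IsDensity c 1 σ)
    (hS : ∀ g ∈ c, ∀ x, SCurv σ g x ≠ 0) (k : ℕ) : ∀ {w : ℝ} {f : Family n M M},
    IsDensity c w f → IsDensity c (w - k) (negDSinvPow σ k w f) := by
  induction k with
  | zero => intro w f hf; simpa [negDSinvPow] using hf
  | succ k ih =>
    intro w f hf
    have h1 : IsDensity c w (fun g z => (SCurv σ g z)⁻¹ * f g z) := by
      have hd := isDensity_SCurv hn hσ
      refine ⟨fun g hg => ((hd.smooth hg).inv (hS g hg)).mul (hf.smooth hg),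
        fun g hg g' hg' Ω h y => ?_⟩
      simp only [hd.rescale hg hg' h, hf.rescale hg hg' h, Real.rpow_zero, one_mul]
      ring
    have h2 := isDensity_laplaceRobin hn hσ h1
    have h3 : IsDensity c (w - 1)
        (fun g x => -laplaceRobin σ w (fun g' z => (SCurv σ g' z)⁻¹ * f g' z) g x) :=
      ⟨fun g hg => (h2.smooth hg).neg, fun g hg g' hg' Ω h y => by
        simp only [h2.rescale hg hg' h]; ring⟩
    have h4 := ih h3
    rw [show w - ((k + 1 : ℕ) : ℝ) = w - 1 - k by push_cast; ring]
    exact h4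

/-- On Σ the curvature S reduces to |dσ|². Elsewhere S is only known to be nonzero and may be
negative. -/
lemma scurv_pos (hσ : IsDefiningDensity c Z σ) {g : Metric n M} (hg : g ∈ c) {x : M} (hx : x ∈ Z) :
    0 < SCurv σ g x := by
  have h0 : σ g x = 0 := by
    have := hσ.2.1 g hg
    rw [← this] at hx; exact hx
  rw [SCurv, h0]
  simpa using dual_self_pos g _ (hσ.2.2 g hg x hx)

/-- The inner term has weight -1 and each of the n-2 factors lowers it by one. Smoothness of
S^{-1/2} is available only along Σ, where S is positive, so the restriction precedes the square
root. -/
theorem isDensityAlong_QCurv (hn : 2 ≤ n) {m : ℕ} {N : Type*} [TopologicalSpace N]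
    [ChartedSpace (E m) N] {ι : N → M} (hι : ContMDiff (𝓡 m) (𝓡 n) ∞ ι)
    (hσ : IsDefiningDensity c (range ι) σ) (hτ : IsTrueScale c τ)
    (hS : ∀ g ∈ c, ∀ x, SCurv σ g x ≠ 0) :
    IsDensityAlong (m := m) ι c (1 - (n : ℝ)) (QCurv σ τ ι) := by
  have hd := isDensity_SCurv hn hσ.1
  have hp := isDensity_negDSinvPow hn hσ.1 hS (n - 2) (isDensity_innerTerm hn hσ.1 hτ hS)
  rw [show (-1 : ℝ) - ((n - 2 : ℕ) : ℝ) = 1 - n by push_cast [hn]; ring] at hp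
  refine ⟨fun g hg => ?_, fun g hg g' hg' Ω h y => ?_⟩
  · have h1 : ContMDiff (𝓡 m) 𝓘(ℝ) ∞ fun y => -(1 / Real.sqrt (SCurv σ g (ι y))) := by
      intro y
      have hpos := scurv_pos hσ hg (mem_range_self y)
      have h2 : ContDiffAt ℝ ∞ (fun t => -(1 / Real.sqrt t)) (SCurv σ g (ι y)) :=
        (contDiffAt_const.div (Real.contDiffAt_sqrt hpos.ne')
          (Real.sqrt_pos.2 hpos).ne').neg
      have h3 : ContMDiffAt (𝓡 m) 𝓘(ℝ) ∞ (fun y => SCurv σ g (ι y)) y := (hd.smooth hg).comp hι y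
      exact ContMDiffAt.comp (g := fun t => -(1 / Real.sqrt t)) y h2.contMDiffAt h3
    exact h1.mul ((hp.smooth hg).comp hι)
  · simp only [QCurv, QCurvBulk, hd.rescale hg hg' h, hp.rescale hg hg' h, Real.rpow_zero, one_mul]
    ring

end Densities

/-! ### The Riemannian volume measure: independence of charts, local finiteness, rescaling. -/

section VolumeMeasure

variable {n : ℕ} {M : Type*} [TopologicalSpace M] [ChartedSpace (E n) M] [MeasurableSpace M]
  [BorelSpace M] {h h' : FormField n M} {e e' : OpenPartialHomeomorph M (E n)}

/-- The volume element `√(det hᵢⱼ) du¹⋯duⁿ` of `h` on the domain of the chart `e`. -/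
def chartVol (h : FormField n M) (e : OpenPartialHomeomorph M (E n)) : Measure M :=
  Measure.map e.symm (((volume : Measure (E n)).restrict e.target).withDensity
    fun u => ENNReal.ofReal (Real.sqrt (gramE h e u).det))

lemma aemeasurable_symm (e : OpenPartialHomeomorph M (E n)) :
    AEMeasurable e.symm ((volume : Measure (E n)).restrict e.target) :=
  e.continuousOn_symm.aemeasurable e.open_target.measurableSet

lemma measurableSet_target_inter (e : OpenPartialHomeomorph M (E n)) {A : Set M}
    (hA : MeasurableSet A) : MeasurableSet (e.symm ⁻¹' A ∩ e.target) := by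
  have h1 := (continuousOn_iff_continuous_domRestrict.1 e.continuousOn_symm).measurable hA
  have h2 := e.open_target.measurableSet.subtype_image h1
  convert h2 using 1
  ext u
  simp only [mem_inter_iff, mem_preimage, mem_image, Subtype.exists, Set.domRestrict_apply,
    exists_and_left, exists_prop, exists_eq_right_right]

lemma chartVol_apply (h : FormField n M) (e : OpenPartialHomeomorph M (E n)) {A : Set M}
    (hA : MeasurableSet A) : chartVol h e A =
      ∫⁻ u in e.symm ⁻¹' A ∩ e.target, ENNReal.ofReal (Real.sqrt (gramE h e u).det) := by
  rw [chartVol, Measure.map_apply_of_aemeasurable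
    ((aemeasurable_symm e).mono_ac (withDensity_absolutelyContinuous _ _)) hA,
    withDensity_apply', Measure.restrict_restrict' e.open_target.measurableSet]

lemma chartVol_compl (h : FormField n M) (e : OpenPartialHomeomorph M (E n)) :
    chartVol h e e.sourceᶜ = 0 := by
  rw [chartVol_apply h e e.open_source.measurableSet.compl]
  have : e.symm ⁻¹' e.sourceᶜ ∩ e.target = ∅ := by
    ext u
    simp only [mem_inter_iff, mem_preimage, mem_compl_iff, mem_empty_iff_false, iff_false, not_and]
    exact fun h1 h2 => h1 (e.map_target h2)
  rw [this]; simp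

lemma chartVol_restrict_source (h : FormField n M) (e : OpenPartialHomeomorph M (E n)) :
    (chartVol h e).restrict e.source = chartVol h e :=
  Measure.restrict_eq_self_of_ae_mem (by
    rw [ae_iff]; exact chartVol_compl h e)

variable [IsManifold (𝓡 n) ∞ M]

/-- A field of bilinear forms which is continuous in every chart. -/
structure IsContForm (h : FormField n M) : Prop where
  bilin : ∃ B : M → Bil (E n), ∀ (x : M) (v w : E n), h x v w = B x v w
  cont : ∀ e : OpenPartialHomeomorph M (E n), IsChart e → ∀ i j,
    ContinuousOn (fun u => gramE h e u i j) e.target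

lemma IsContForm.continuousOn_sqrt_det (hh : IsContForm h) (he : IsChart e) :
    ContinuousOn (fun u => Real.sqrt (gramE h e u).det) e.target := by
  refine Real.continuous_sqrt.comp_continuousOn ?_
  have h1 : ContinuousOn (fun u => gramE h e u) e.target :=
    continuousOn_pi.2 fun i => continuousOn_pi.2 fun j => hh.cont e he i j
  exact (Continuous.matrix_det continuous_id).comp_continuousOn h1

lemma IsContForm.aemeasurable_density (hh : IsContForm h) (he : IsChart e) :
    AEMeasurable (fun u => ENNReal.ofReal (Real.sqrt (gramE h e u).det))
      ((volume : Measure (E n)).restrict e.target) :=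
  ((hh.continuousOn_sqrt_det he).aemeasurable e.open_target.measurableSet).ennreal_ofReal

lemma gramE_eq_bil (hh : IsContForm h) (e : OpenPartialHomeomorph M (E n)) (u X Y : E n) :
    bil (gramE h e u) X Y = h (e.symm u) (coordE e u X) (coordE e u Y) := by
  obtain ⟨B, hB⟩ := hh.bilin
  have h1 := bil_eq_of_basis (b := (B (e.symm u)).bilinearComp (coordE e u) (coordE e u))
    (G := gramE h e u) (fun i j => (hB _ _ _).symm)
  rw [← h1]
  exact (hB _ _ _).symm

lemma det_bil_comp (G : Matrix (Fin n) (Fin n) ℝ) (A : E n →L[ℝ] E n) :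
    (Matrix.of fun i j => bil G (A (stdVec n i)) (A (stdVec n j))).det =
      A.det ^ 2 * G.det := by
  have hA : A.det = (Matrix.of fun i j => A (stdVec n j) i).det := by
    rw [ContinuousLinearMap.det, ← LinearMap.det_toMatrix
      (EuclideanSpace.basisFun (Fin n) ℝ).toBasis]
    congr 1
  have h1 : (Matrix.of fun i j => bil G (A (stdVec n i)) (A (stdVec n j))) =
      (Matrix.of fun i j => A (stdVec n j) i).transpose * G * Matrix.of fun i j => A (stdVec n j) i := by
    ext i j
    rw [Matrix.of_apply, bil_apply, Matrix.mul_assoc, Matrix.mul_apply]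
    refine Finset.sum_congr rfl fun k _ => ?_
    rw [Matrix.mul_apply, Finset.mul_sum]
    refine Finset.sum_congr rfl fun l _ => ?_
    simp only [Matrix.transpose_apply, Matrix.of_apply]
    ring
  rw [h1, Matrix.det_mul, Matrix.det_mul, Matrix.det_transpose, hA]
  ring

lemma IsContForm.sqrt_det_transition (hh : IsContForm h) (he : IsChart e) (he' : IsChart e')
    {u : E n} (hu : u ∈ e.target) (hu' : e.symm u ∈ e'.source) :
    Real.sqrt (gramE h e u).det = |(fderiv ℝ (e' ∘ e.symm) u).det| *
      Real.sqrt (gramE h e' (e' (e.symm u))).det := by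
  have h1 : gramE h e u = Matrix.of fun i j => bil (gramE h e' (e' (e.symm u)))
      (fderiv ℝ (e' ∘ e.symm) u (stdVec n i)) (fderiv ℝ (e' ∘ e.symm) u (stdVec n j)) := by
    ext i j
    rw [Matrix.of_apply, gramE_eq_bil hh]
    exact he.form_transition he' h hu hu' _ _
  rw [h1, det_bil_comp, Real.sqrt_mul (sq_nonneg _), Real.sqrt_sq_eq_abs]

/-- The local volume elements of two charts agree on the overlap. -/
lemma chartVol_eq_of_subset (hh : IsContForm h) (he : IsChart e) (he' : IsChart e') {A : Set M}
    (hA : MeasurableSet A) (h1 : A ⊆ e.source) (h2 : A ⊆ e'.source) :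
    chartVol h e A = chartVol h e' A := by
  rw [chartVol_apply h e hA, chartVol_apply h e' hA]
  set s := e.symm ⁻¹' A ∩ e.target
  have hs : MeasurableSet s := measurableSet_target_inter e hA
  have himg : (e' ∘ e.symm) '' s = e'.symm ⁻¹' A ∩ e'.target := by
    ext v
    constructor
    · rintro ⟨u, ⟨hu1, hu2⟩, rfl⟩
      refine ⟨?_, e'.map_source (h2 hu1)⟩
      simpa only [mem_preimage, Function.comp, e'.left_inv (h2 hu1)] using hu1
    · rintro ⟨hv1, hv2⟩
      refine ⟨e (e'.symm v), ⟨?_, e.map_source (h1 hv1)⟩, ?_⟩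
      · simpa only [mem_preimage, e.left_inv (h1 hv1)] using hv1
      · simp only [Function.comp, e.left_inv (h1 hv1), e'.right_inv hv2]
  have hderiv : ∀ u ∈ s, HasFDerivWithinAt (e' ∘ e.symm) (fderiv ℝ (e' ∘ e.symm) u) s u :=
    fun u hu => ((he.contDiffAt_transition he' hu.2 (h2 hu.1)).differentiableAt
      (by simp)).hasFDerivAt.hasFDerivWithinAt
  have hinj : InjOn (e' ∘ e.symm) s := by
    intro u hu v hv huv
    have h3 := e'.injOn (h2 hu.1) (h2 hv.1) huv
    exact e.symm.injOn hu.2 hv.2 h3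
  rw [← himg, lintegral_image_eq_lintegral_abs_det_fderiv_mul volume hs hderiv hinj]
  refine setLIntegral_congr_fun hs fun u hu => ?_
  simp only [hh.sqrt_det_transition he he' hu.2 (h2 hu.1), ENNReal.ofReal_mul (abs_nonneg _),
    Function.comp]

lemma chartVol_restrict_eq (hh : IsContForm h) (he : IsChart e) (he' : IsChart e') {A : Set M}
    (hA : MeasurableSet A) (h1 : A ⊆ e.source) (h2 : A ⊆ e'.source) :
    (chartVol h e).restrict A = (chartVol h e').restrict A := by
  ext s hs
  rw [Measure.restrict_apply hs, Measure.restrict_apply hs]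
  exact chartVol_eq_of_subset hh he he' (hs.inter hA) (inter_subset_right.trans h1)
    (inter_subset_right.trans h2)

variable [T2Space M] [SigmaCompactSpace M]

lemma chartPartition_tsupport (p : M) : tsupport (chartPartition n M p) ⊆ (chartAt (E n) p).source :=
  (SmoothPartitionOfUnity.exists_isSubordinate_chartAt_source (𝓡 n) M).choose_spec p

/-- The partition is indexed by all points of M. Local finiteness and σ-compactness leave only
countably many nonzero members, which allows the sum to be exchanged with the integral. -/
lemma countable_chartPartition :
    {p : M | (Function.support (chartPartition n M p)).Nonempty}.Countable := by
  have h1 := ((chartPartition n M).locallyFinite.comp_injective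
    (Subtype.val_injective (p := fun p => (Function.support (chartPartition n M p)).Nonempty)))
  exact countable_univ_iff.1 (h1.countable_univ fun p => p.2)

lemma tsum_chartPartition (x : M) :
    ∑' p : M, ENNReal.ofReal (chartPartition n M p x) = 1 := by
  have h1 := (chartPartition n M).sum_eq_one (mem_univ x)
  have h2 : (Function.support fun p => chartPartition n M p x).Finite :=
    (chartPartition n M).locallyFinite.point_finite x
  rw [finsum_eq_sum _ h2] at h1
  rw [tsum_eq_sum (s := h2.toFinset), ← ENNReal.ofReal_sum_of_nonneg, h1, ENNReal.ofReal_one]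
  · exact fun p _ => (chartPartition n M).nonneg p x
  · intro p hp
    simp only [Finite.mem_toFinset, Function.mem_support, not_not] at hp
    rw [hp, ENNReal.ofReal_zero]

lemma volumeMeasure_apply (h : FormField n M) {A : Set M} (hA : MeasurableSet A) :
    volumeMeasure h A = ∑' p : M, ∫⁻ x in A, ENNReal.ofReal (chartPartition n M p x)
      ∂chartVol h (chartAt (E n) p) := by
  rw [volumeMeasure, Measure.sum_apply _ hA]
  refine tsum_congr fun p => ?_
  rw [withDensity_apply _ hA]
  rfl

/-- In every chart, the volume measure is the local volume element. -/
theorem volumeMeasure_restrict (hh : IsContForm h) (he : IsChart e) :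
    (volumeMeasure h).restrict e.source = chartVol h e := by
  ext A hA
  set ρ : M → M → ENNReal := fun p x => ENNReal.ofReal (chartPartition n M p x) with hρ
  have hA' := hA.inter e.open_source.measurableSet
  -- On the support of the p-th weight both charts are defined and their volume elements agree. Once
  -- all terms use the chart `e`, the weights add up to one.
  have h1 : ∀ p : M, ∫⁻ x in A ∩ e.source, ρ p x ∂chartVol h (chartAt (E n) p) =
      ∫⁻ x in A ∩ e.source, ρ p x ∂chartVol h e := by
    intro p
    have hind : ρ p = (chartAt (E n) p).source.indicator (ρ p) := by
      refine (indicator_eq_self.2 fun x hx => ?_).symm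
      refine chartPartition_tsupport p (subset_tsupport _ ?_)
      intro h0
      exact hx (by simp only [hρ, h0, ENNReal.ofReal_zero])
    have ho := (chartAt (E n) p).open_source.measurableSet
    rw [hind, setLIntegral_indicator ho, setLIntegral_indicator ho]
    rw [chartVol_restrict_eq hh he (isChart_chartAt p) (ho.inter hA')
      (inter_subset_right.trans inter_subset_right) inter_subset_left]
  rw [Measure.restrict_apply hA, volumeMeasure_apply h hA', tsum_congr h1]
  have hc := countable_chartPartition (n := n) (M := M)
  set S := {p : M | (Function.support (chartPartition n M p)).Nonempty}
  have : Countable S := hc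
  have hS : ∀ p ∉ S, ρ p = 0 := by
    intro p hp
    funext x
    have : chartPartition n M p x = 0 := by
      by_contra h0
      exact hp ⟨x, h0⟩
    simp only [hρ, this, ENNReal.ofReal_zero, Pi.zero_apply]
  have hmeas : ∀ p, Measurable (ρ p) := fun p =>
    ((chartPartition n M p).contMDiff.continuous.measurable).ennreal_ofReal
  rw [← tsum_subtype_eq_of_support_subset (s := S), ← lintegral_tsum]
  · have h2 : ∀ x, ∑' p : S, ρ p x = 1 := by
      intro x
      rw [tsum_subtype_eq_of_support_subset (f := fun p => ρ p x) (s := S)]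
      · exact tsum_chartPartition x
      · intro p hp
        by_contra h0
        exact hp (congrFun (hS p h0) x)
    simp only [h2, lintegral_one, Measure.restrict_apply_univ]
    rw [← Measure.restrict_apply hA, chartVol_restrict_source]
  · exact fun p => (hmeas p).aemeasurable
  · intro p hp
    by_contra h0
    refine hp ?_
    simp [hS p h0]

lemma isLocallyFiniteMeasure_volumeMeasure (hh : IsContForm h) :
    IsLocallyFiniteMeasure (volumeMeasure h) := by
  refine ⟨fun x => ?_⟩
  set e := chartAt (E n) x
  have he : IsChart (n := n) e := isChart_chartAt x
  have hx : x ∈ e.source := mem_chart_source _ x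
  obtain ⟨r, hr, hball⟩ := Metric.nhds_basis_closedBall.mem_iff.1
    (e.open_target.mem_nhds (e.map_source hx))
  refine ⟨e.source ∩ e ⁻¹' Metric.ball (e x) r,
    (e.isOpen_inter_preimage Metric.isOpen_ball).mem_nhds ⟨hx, Metric.mem_ball_self hr⟩, ?_⟩
  have hO := (e.isOpen_inter_preimage (Metric.isOpen_ball (x := e x) (ε := r))).measurableSet
  set O := e.source ∩ e ⁻¹' Metric.ball (e x) r
  rw [← inter_eq_left.2 (show O ⊆ e.source from inter_subset_left), ← Measure.restrict_apply hO,
    volumeMeasure_restrict hh he, chartVol_apply h e hO]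
  obtain ⟨C, hC⟩ := (isCompact_closedBall (e x) r).exists_bound_of_continuousOn
    ((hh.continuousOn_sqrt_det he).mono hball)
  have hsub : e.symm ⁻¹' O ∩ e.target ⊆ Metric.closedBall (e x) r := by
    rintro u ⟨hu1, hu2⟩
    have := hu1.2
    rw [mem_preimage, e.right_inv hu2] at this
    exact Metric.ball_subset_closedBall this
  calc _ ≤ ∫⁻ u in e.symm ⁻¹' O ∩ e.target, ENNReal.ofReal C :=
        setLIntegral_mono measurable_const fun u hu =>
          ENNReal.ofReal_le_ofReal ((le_abs_self _).trans (hC u (hsub hu)))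
    _ = ENNReal.ofReal C * volume (e.symm ⁻¹' O ∩ e.target) := setLIntegral_const _ _
    _ < ⊤ := ENNReal.mul_lt_top ENNReal.ofReal_lt_top
        ((measure_mono hsub).trans_lt measure_closedBall_lt_top)

/-- Integration in a chart. -/
lemma integral_eq_chart (hh : IsContForm h) (he : IsChart e) {f : M → ℝ} (hf : Measurable f)
    (hsupp : Function.support f ⊆ e.source) :
    ∫ x, f x ∂volumeMeasure h =
      ∫ u in e.target, Real.sqrt (gramE h e u).det * f (e.symm u) := by
  rw [← setIntegral_eq_integral_of_forall_compl_eq_zero (s := e.source)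
    (fun x hx => by_contra fun h0 => hx (hsupp h0)), volumeMeasure_restrict hh he, chartVol,
    integral_map ((aemeasurable_symm e).mono_ac (withDensity_absolutelyContinuous _ _))
      hf.aestronglyMeasurable,
    integral_withDensity_eq_integral_toReal_smul₀ (hh.aemeasurable_density he)
      (Eventually.of_forall fun _ => ENNReal.ofReal_lt_top)]
  simp only [ENNReal.toReal_ofReal (Real.sqrt_nonneg _), smul_eq_mul]

lemma chartVol_rescale {a : M → ℝ} (ha : Continuous a) (ha0 : ∀ x, 0 < a x)
    (hh : IsContForm h) (he : IsChart e)
    (hh' : ∀ (x : M) (v w : TangentSpace (𝓡 n) x), h' x v w = a x ^ 2 * h x v w) :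
    chartVol h' e = (chartVol h e).withDensity fun x => ENNReal.ofReal (a x ^ n) := by
  ext A hA
  have h1 : ∀ u, gramE h' e u = a (e.symm u) ^ 2 • gramE h e u := by
    intro u; ext i j; exact hh' _ _ _
  have h2 : ∀ u, ENNReal.ofReal (Real.sqrt (gramE h' e u).det) =
      ENNReal.ofReal (Real.sqrt (gramE h e u).det) * ENNReal.ofReal (a (e.symm u) ^ n) := by
    intro u
    rw [h1, Matrix.det_smul, Fintype.card_fin, Real.sqrt_mul (by positivity), ← pow_mul,
      mul_comm 2 n, pow_mul, Real.sqrt_sq (pow_pos (ha0 _) n).le, mul_comm,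
      ENNReal.ofReal_mul (Real.sqrt_nonneg _)]
  have hae := (aemeasurable_symm e).mono_ac (withDensity_absolutelyContinuous
    ((volume : Measure (E n)).restrict e.target)
    fun u => ENNReal.ofReal (Real.sqrt (gramE h e u).det))
  have hmeas : Measurable fun x => ENNReal.ofReal (a x ^ n) :=
    ((ha.pow n).measurable).ennreal_ofReal
  have h3 := lintegral_withDensity_eq_lintegral_mul₀ (hh.aemeasurable_density he)
    (g := fun u => A.indicator (fun x => ENNReal.ofReal (a x ^ n)) (e.symm u))
    ((hmeas.indicator hA).comp_aemeasurable (aemeasurable_symm e))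
  rw [withDensity_apply _ hA, chartVol_apply h' e hA, ← lintegral_indicator hA, chartVol,
    lintegral_map' (hmeas.indicator hA).aemeasurable hae, h3,
    ← Measure.restrict_restrict' e.open_target.measurableSet,
    ← lintegral_indicator₀ ((aemeasurable_symm e).nullMeasurable hA)]
  refine lintegral_congr fun u => ?_
  by_cases hu : e.symm u ∈ A
  · simp only [Pi.mul_apply, indicator_of_mem hu, indicator_of_mem (show u ∈ e.symm ⁻¹' A from hu),
      h2]
  · simp only [Pi.mul_apply, indicator_of_notMem hu,
      indicator_of_notMem (show u ∉ e.symm ⁻¹' A from hu), mul_zero]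

/-- The volume measure of a rescaled form. -/
theorem volumeMeasure_rescale {a : M → ℝ} (ha : Continuous a) (ha0 : ∀ x, 0 < a x)
    (hh : IsContForm h)
    (hh' : ∀ (x : M) (v w : TangentSpace (𝓡 n) x), h' x v w = a x ^ 2 * h x v w) :
    volumeMeasure h' = (volumeMeasure h).withDensity fun x => ENNReal.ofReal (a x ^ n) := by
  rw [volumeMeasure, volumeMeasure, withDensity_sum]
  congr 1
  funext p
  have h1 : chartVolume h' p = chartVol h' (chartAt (E n) p) := rfl
  have h2 : chartVolume h p = chartVol h (chartAt (E n) p) := rfl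
  have hm1 : Measurable fun x => ENNReal.ofReal (a x ^ n) := ((ha.pow n).measurable).ennreal_ofReal
  have hm2 : Measurable fun x => ENNReal.ofReal (chartPartition n M p x) :=
    ((chartPartition n M p).contMDiff.continuous.measurable).ennreal_ofReal
  rw [h1, h2, chartVol_rescale ha ha0 hh (isChart_chartAt p) hh', ← withDensity_mul _ hm1 hm2,
    ← withDensity_mul _ hm2 hm1, mul_comm]

end VolumeMeasure

/-! ### Extension by zero and integration by parts in ℝⁿ. -/

section CompactSupport

variable {V : Type*} [NormedAddCommGroup V] [NormedSpace ℝ V] {s K : Set V} {F : V → ℝ}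

lemma tsupport_indicator_subset (hK : IsClosed K) (h0 : ∀ u ∈ s \ K, F u = 0) :
    tsupport (s.indicator F) ⊆ K := by
  refine closure_minimal (fun u hu => ?_) hK
  by_contra hK'
  refine hu ?_
  by_cases hs : u ∈ s
  · rw [indicator_of_mem hs, h0 u ⟨hs, hK'⟩]
  · rw [indicator_of_notMem hs]

/-- Around a point outside `s`, the complement of the closed set `K` is a neighbourhood on which the
extension is identically zero. -/
lemma contDiff_indicator {r : ℕ∞ω} (hs : IsOpen s) (hK : IsClosed K) (hKs : K ⊆ s)
    (hF : ∀ u ∈ s, ContDiffAt ℝ r F u) (h0 : ∀ u ∈ s \ K, F u = 0) :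
    ContDiff ℝ r (s.indicator F) := by
  refine contDiff_iff_contDiffAt.2 fun u => ?_
  by_cases hu : u ∈ s
  · refine (hF u hu).congr_of_eventuallyEq ?_
    filter_upwards [hs.mem_nhds hu] with v hv using indicator_of_mem hv F
  · have : s.indicator F =ᶠ[𝓝 u] fun _ => 0 := by
      filter_upwards [hK.isOpen_compl.mem_nhds fun h => hu (hKs h)] with v hv
      by_cases hvs : v ∈ s
      · rw [indicator_of_mem hvs, h0 v ⟨hvs, hv⟩]
      · rw [indicator_of_notMem hvs]
    exact contDiffAt_const.congr_of_eventuallyEq this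

/-- Integration by parts against the constant function 1. -/
lemma integral_pd_eq_zero {n : ℕ} {F : E n → ℝ} (hF : ContDiff ℝ 1 F) (hc : HasCompactSupport F)
    (i : Fin n) : ∫ u, pd i F u = 0 := by
  have h1 : Continuous fun u => fderiv ℝ F u (stdVec n i) :=
    (hF.continuous_fderiv (by simp)).clm_apply continuous_const
  have h2 : Integrable fun u => fderiv ℝ F u (stdVec n i) :=
    h1.integrable_of_hasCompactSupport (hc.fderiv_apply (𝕜 := ℝ) _)
  have h3 := integral_mul_fderiv_eq_neg_fderiv_mul_of_integrable (μ := (volume : Measure (E n)))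
    (f := fun _ => (1 : ℝ)) (g := F) (v := stdVec n i) (by simp) (by simpa using h2)
    (by simpa using hF.continuous.integrable_of_hasCompactSupport hc)
    (fun _ _ => by fun_prop) (fun x _ => (hF.differentiable (by simp)) x)
  simpa [pd] using h3

end CompactSupport

/-! ### Localization of compactly supported functions and Green's identity. -/

section Green

variable {n : ℕ} {M : Type*} [TopologicalSpace M] [ChartedSpace (E n) M] [IsManifold (𝓡 n) ∞ M]
  {e : OpenPartialHomeomorph M (E n)}

lemma isContForm_form (g : Metric n M) : IsContForm g.form where
  bilin := ⟨g.bilAt, fun _ _ _ => rfl⟩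
  cont _ he i j _ hu := ((metricGerm_gramE g he hu).self_of_nhds.1 i j).continuousAt.continuousWithinAt

lemma isContForm_pullback (g : Metric n M) {m : ℕ} {N : Type*} [TopologicalSpace N]
    [ChartedSpace (E m) N] [IsManifold (𝓡 m) ∞ N] {ι : N → M} (hι : ContMDiff (𝓡 m) (𝓡 n) ∞ ι) :
    IsContForm (g.pullback ι : FormField m N) where
  bilin := ⟨fun y => (g.bilAt (ι y)).bilinearComp (mfderiv (𝓡 m) (𝓡 n) ι y)
    (mfderiv (𝓡 m) (𝓡 n) ι y), fun _ _ _ => rfl⟩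
  cont e he i j u hu := by
    have h1 : ∀ v ∈ e.target, ContMDiffAt 𝓘(ℝ, E m) (𝓡 n) ∞ (ι ∘ e.symm) v := fun v hv =>
      (hι _).comp v (he.contMDiffAt_symm hv)
    have h2 := g.contDiffAt_inner (f := ι ∘ e.symm) (u := u)
      (by filter_upwards [e.open_target.mem_nhds hu] with v hv using h1 v hv)
      (stdVec m i) (stdVec m j)
    refine (h2.continuousAt.congr ?_).continuousWithinAt
    filter_upwards [e.open_target.mem_nhds hu] with v hv
    have h3 := mfderiv_comp v (I' := 𝓡 m) ((hι (e.symm v)).mdifferentiableAt (by simp))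
      ((he.contMDiffAt_symm hv).mdifferentiableAt (by simp))
    rw [h3]
    rfl

variable [T2Space M] [SigmaCompactSpace M]

/-- A property of compactly supported functions of class `C^r` which is additive and holds for
functions with small support holds for all of them. -/
theorem compactSupport_induction {r : ℕ∞ω} (hr : r ≤ ∞) {P : (M → ℝ) → Prop} {k : M → ℝ}
    (hk : ContMDiff (𝓡 n) 𝓘(ℝ) r k) (hc : HasCompactSupport k) (h0 : P fun _ => 0)
    (hadd : ∀ f f' : M → ℝ, ContMDiff (𝓡 n) 𝓘(ℝ) r f → HasCompactSupport f →
      ContMDiff (𝓡 n) 𝓘(ℝ) r f' → HasCompactSupport f' → tsupport f ⊆ tsupport k →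
      tsupport f' ⊆ tsupport k → P f → P f' → P fun x => f x + f' x)
    (hloc : ∀ x : M, ∃ O ∈ 𝓝 x, ∀ f : M → ℝ, ContMDiff (𝓡 n) 𝓘(ℝ) r f → HasCompactSupport f →
      tsupport f ⊆ O → tsupport f ⊆ tsupport k → P f) : P k := by
  choose O hO hP using hloc
  -- Only finitely many members of the partition meet the compact support of `k`, so `k` is a finite
  -- sum of functions with small support.
  obtain ⟨φ, hφ⟩ := SmoothPartitionOfUnity.exists_isSubordinate (𝓡 n) (isClosed_tsupport k)
    (fun x => interior (O x)) (fun x => isOpen_interior)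
    (fun x _ => mem_iUnion.2 ⟨x, mem_interior_iff_mem_nhds.2 (hO x)⟩)
  have hfin := φ.locallyFinite.finite_nonempty_inter_compact hc.isCompact
  have hpiece : ∀ i, ContMDiff (𝓡 n) 𝓘(ℝ) r (fun x => φ i x * k x) := fun i =>
    ((φ i).contMDiff.of_le hr).mul hk
  have hts : ∀ i, tsupport (fun x => φ i x * k x) ⊆ tsupport k := fun i => tsupport_mul_subset_right
  have hcs : ∀ i, HasCompactSupport (fun x => φ i x * k x) := fun i => hc.mul_left
  have key : ∀ s : Finset M, ContMDiff (𝓡 n) 𝓘(ℝ) r (fun x => ∑ i ∈ s, φ i x * k x) ∧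
      HasCompactSupport (fun x => ∑ i ∈ s, φ i x * k x) ∧
      tsupport (fun x => ∑ i ∈ s, φ i x * k x) ⊆ tsupport k ∧ P fun x => ∑ i ∈ s, φ i x * k x := by
    classical
    intro s
    induction s using Finset.induction_on with
    | empty =>
      refine ⟨by simpa using contMDiff_const, HasCompactSupport.zero, ?_, by simpa using h0⟩
      simp [tsupport]
    | insert a s ha ih =>
      have h1 : (fun x => ∑ i ∈ insert a s, φ i x * k x) =
          fun x => φ a x * k x + ∑ i ∈ s, φ i x * k x := by
        funext x; rw [Finset.sum_insert ha]
      rw [h1]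
      refine ⟨(hpiece a).add ih.1, (hcs a).add ih.2.1, ?_, ?_⟩
      · exact (tsupport_add _ _).trans (union_subset (hts a) ih.2.2.1)
      · exact hadd _ _ (hpiece a) (hcs a) ih.1 ih.2.1 (hts a) ih.2.2.1
          (hP a _ (hpiece a) (hcs a) ((tsupport_mul_subset_left.trans (hφ a)).trans interior_subset)
            (hts a)) ih.2.2.2
  have h2 : k = fun x => ∑ i ∈ hfin.toFinset, φ i x * k x := by
    funext x
    by_cases hx : x ∈ tsupport k
    · have h3 := φ.sum_eq_one hx
      rw [finsum_eq_sum_of_support_subset _ (s := hfin.toFinset)] at h3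
      · rw [← Finset.sum_mul, h3, one_mul]
      · intro i hi
        simp only [Finite.coe_toFinset, mem_ofPred_eq]
        exact ⟨x, hi, hx⟩
    · have h3 : k x = 0 := image_eq_zero_of_notMem_tsupport hx
      simp [h3]
  rw [h2]
  exact (key _).2.2.2

lemma diff_eq_zero_of_notMem_tsupport {f : M → ℝ} {x : M} (hx : x ∉ tsupport f) :
    diff (n := n) f x = 0 := by
  have h : f =ᶠ[𝓝 x] fun _ => 0 := notMem_tsupport_iff_eventuallyEq.1 hx
  rw [diff_congr h, diff_const]

lemma continuous_dual (g : Metric n M) {f k : M → ℝ} (hf : ContMDiff (𝓡 n) 𝓘(ℝ) 1 f)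
    (hk : Smooth (n := n) k) : Continuous fun x => g.dual x (diff f x) (diff k x) := by
  refine continuous_iff_continuousAt.2 fun x => ?_
  set e := chartAt (E n) x
  have he : IsChart (n := n) e := isChart_chartAt x
  have hx : x ∈ e.source := mem_chart_source _ x
  have hu := e.map_source hx
  have hpd : ∀ i, ContinuousAt (pd i (f ∘ e.symm)) (e x) := fun i =>
    ((he.contDiffAt_comp_symm (by simp) hu (hf _)).continuousAt_fderiv (by simp)).clm_apply
      continuousAt_const
  have h1 : ContinuousAt (fun u => ∑ i, ∑ j, (gramE g.form e u)⁻¹ i j * pd i (f ∘ e.symm) u *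
      pd j (k ∘ e.symm) u) (e x) :=
    tendsto_finsetSum _ fun i _ => tendsto_finsetSum _ fun j _ =>
      ((contDiffAt_inv_entry (metricGerm_gramE g he hu) i j).continuousAt.mul (hpd i)).mul
        (contDiffAt_pd (he.contDiffAt_comp_symm le_rfl hu (hk _)) j).continuousAt
  refine (h1.comp (e.continuousAt hx)).congr ?_
  filter_upwards [e.open_source.mem_nhds hx] with y hy
  have h2 := dual_diff_eq g he (f := f) (k := k) (e.map_source hy)
  rw [e.left_inv hy] at h2
  exact (h2 ((hf _).mdifferentiableAt (by simp)) (hk.mdiff _)).symm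

variable [MeasurableSpace M] [BorelSpace M]

/-- The components of the vector density `√(det G) f ∇h` in a chart, extended by zero. -/
def chartFlux (g : Metric n M) (e : OpenPartialHomeomorph M (E n)) (f h : M → ℝ) (i : Fin n) :
    E n → ℝ :=
  e.target.indicator fun u => f (e.symm u) * flux (gramE g.form e) (h ∘ e.symm) i u

section ChartFlux

variable (g : Metric n M) {f h : M → ℝ} (he : IsChart e) (hf : ContMDiff (𝓡 n) 𝓘(ℝ) 1 f)
  (hc : HasCompactSupport f) (hfe : tsupport f ⊆ e.source) (hh : Smooth (n := n) h)
include hc hfe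

omit [IsManifold (𝓡 n) ∞ M] [T2Space M] [SigmaCompactSpace M] in
lemma isCompact_image_tsupport : IsCompact (e '' tsupport f) :=
  hc.isCompact.image_of_continuousOn (e.continuousOn.mono hfe)

omit [T2Space M] [SigmaCompactSpace M] in
lemma tsupport_chartFlux (i : Fin n) : tsupport (chartFlux g e f h i) ⊆ e '' tsupport f := by
  refine tsupport_indicator_subset (isCompact_image_tsupport hc hfe).isClosed fun u hu => ?_
  rw [image_eq_zero_of_notMem_tsupport (f := f) (x := e.symm u)
      fun h0 => hu.2 ⟨_, h0, e.right_inv hu.1⟩, zero_mul]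

omit [T2Space M] [SigmaCompactSpace M] in
lemma hasCompactSupport_chartFlux (i : Fin n) : HasCompactSupport (chartFlux g e f h i) :=
  HasCompactSupport.of_support_subset_isCompact (isCompact_image_tsupport hc hfe)
    ((subset_tsupport _).trans (tsupport_chartFlux g hc hfe i))

include he hf hh

omit [T2Space M] [SigmaCompactSpace M] in
lemma contDiff_chartFlux (i : Fin n) : ContDiff ℝ 1 (chartFlux g e f h i) := by
  refine contDiff_indicator e.open_target (isCompact_image_tsupport hc hfe).isClosed ?_
    (fun u hu => ContDiffAt.mul (he.contDiffAt_comp_symm (f := f) (by simp) hu (hf _))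
      ((contDiffAt_flux (metricGerm_gramE g he hu)
        (he.contDiffAt_comp_symm le_rfl hu (hh _)) i).of_le (by simp)))
      fun u hu => ?_
  · rintro _ ⟨x, hx, rfl⟩; exact e.map_source (hfe hx)
  · rw [image_eq_zero_of_notMem_tsupport (f := f) (x := e.symm u)
      fun h0 => hu.2 ⟨_, h0, e.right_inv hu.1⟩, zero_mul]

omit [T2Space M] [SigmaCompactSpace M] hc hfe in
lemma sum_pd_chartFlux {u : E n} (hu : u ∈ e.target) :
    ∑ i, pd i (chartFlux g e f h i) u = Real.sqrt (gramE g.form e u).det *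
      (g.dual (e.symm u) (diff f (e.symm u)) (diff h (e.symm u)) +
        f (e.symm u) * g.laplacian h (e.symm u)) := by
  have h1 : ∀ i, pd i (chartFlux g e f h i) u =
      pd i (fun v => (f ∘ e.symm) v * flux (gramE g.form e) (h ∘ e.symm) i v) u := fun i =>
    pd_congr (by filter_upwards [e.open_target.mem_nhds hu] with v hv using indicator_of_mem hv _) i
  rw [Finset.sum_congr rfl fun i _ => h1 i, sum_pd_mul_flux_eq (metricGerm_gramE g he hu)
    ((he.contDiffAt_comp_symm (f := f) (by simp) hu (hf _)).differentiableAt (by simp))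
    (he.contDiffAt_comp_symm le_rfl hu (hh _)),
    laplacian_eq g he (e.map_target hu) (hh _), dual_diff_eq g he hu
      ((hf _).mdifferentiableAt (by simp)) (hh.mdiff _), e.right_inv hu, add_comm]
  rfl

omit [T2Space M] [SigmaCompactSpace M] he hf hh in
lemma sum_pd_chartFlux_eq_zero {u : E n} (hu : u ∉ e '' tsupport f) :
    ∑ i, pd i (chartFlux g e f h i) u = 0 := by
  refine Finset.sum_eq_zero fun i _ => ?_
  rw [pd_congr (notMem_tsupport_iff_eventuallyEq.1 fun h0 => hu (tsupport_chartFlux g hc hfe i h0))]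
  simp [pd]

end ChartFlux

lemma measurable_divergence (g : Metric n M) {f h : M → ℝ} (hf : ContMDiff (𝓡 n) 𝓘(ℝ) 1 f)
    (hh : Smooth (n := n) h) :
    Measurable fun x => g.dual x (diff f x) (diff h x) + f x * g.laplacian h x :=
  ((continuous_dual g hf hh).add (hf.continuous.mul (smooth_laplacian g hh).continuous)).measurable

omit [MeasurableSpace M] [BorelSpace M] in
lemma divergence_eq_zero (g : Metric n M) {f h : M → ℝ} {x : M} (hx : x ∉ tsupport f) :
    g.dual x (diff f x) (diff h x) + f x * g.laplacian h x = 0 := by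
  rw [diff_eq_zero_of_notMem_tsupport hx, image_eq_zero_of_notMem_tsupport hx,
    dual_zero_left, zero_mul, add_zero]

/-- In a chart the integrand times √det G is the coordinate divergence of a compactly supported
vector density; each partial derivative integrates to zero. -/
lemma green_of_tsupport_subset (g : Metric n M) (he : IsChart e) {f h : M → ℝ}
    (hf : ContMDiff (𝓡 n) 𝓘(ℝ) 1 f) (hc : HasCompactSupport f) (hfe : tsupport f ⊆ e.source)
    (hh : Smooth (n := n) h) :
    ∫ x, (g.dual x (diff f x) (diff h x) + f x * g.laplacian h x) ∂g.vol = 0 := by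
  have hsupp : Function.support (fun x => g.dual x (diff f x) (diff h x) + f x * g.laplacian h x) ⊆
      e.source := fun x hx => hfe (by_contra fun h0 => hx (divergence_eq_zero g h0))
  rw [Metric.vol, integral_eq_chart (isContForm_form g) he (measurable_divergence g hf hh) hsupp,
    ← setIntegral_congr_fun e.open_target.measurableSet fun u hu => sum_pd_chartFlux g he hf hh hu,
    setIntegral_eq_integral_of_forall_compl_eq_zero]
  · have hWd := contDiff_chartFlux g he hf hc hfe hh
    have hWc : ∀ i, HasCompactSupport (chartFlux g e f h i) := hasCompactSupport_chartFlux g hc hfe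
    rw [integral_finsetSum _ fun i _ => ?_, Finset.sum_eq_zero fun i _ =>
      integral_pd_eq_zero (hWd i) (hWc i) i]
    exact (((hWd i).continuous_fderiv (by simp)).clm_apply
      continuous_const).integrable_of_hasCompactSupport ((hWc i).fderiv_apply (𝕜 := ℝ) _)
  · intro u hu
    refine sum_pd_chartFlux_eq_zero g hc hfe ?_
    rintro ⟨x, hx, rfl⟩
    exact hu (e.map_source (hfe hx))

instance (g : Metric n M) : IsLocallyFiniteMeasure g.vol :=
  isLocallyFiniteMeasure_volumeMeasure (isContForm_form g)

/-- Green's identity: the divergence `⟨df, dh⟩ + f Δh` of a compactly supported field has integral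
zero. -/
theorem green (g : Metric n M) {f h : M → ℝ} (hf : ContMDiff (𝓡 n) 𝓘(ℝ) 1 f)
    (hc : HasCompactSupport f) (hh : Smooth (n := n) h) :
    ∫ x, (g.dual x (diff f x) (diff h x) + f x * g.laplacian h x) ∂g.vol = 0 := by
  have hint : ∀ f : M → ℝ, ContMDiff (𝓡 n) 𝓘(ℝ) 1 f → HasCompactSupport f →
      Integrable (fun x => g.dual x (diff f x) (diff h x) + f x * g.laplacian h x) g.vol := by
    intro f hf hc
    refine ((continuous_dual g hf hh).add (hf.continuous.mul
      (smooth_laplacian g hh).continuous)).integrable_of_hasCompactSupport ?_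
    refine HasCompactSupport.intro hc.isCompact fun x hx => ?_
    exact divergence_eq_zero g hx
  -- Class C¹ is essential: the identity is later applied to functions containing (s-t)₊²/2, which
  -- is not twice differentiable.
  refine compactSupport_induction (P := fun f =>
    ∫ x, (g.dual x (diff f x) (diff h x) + f x * g.laplacian h x) ∂g.vol = 0) (r := 1) (by simp)
    hf hc ?_ ?_ ?_
  · have h3 : ∀ x, g.dual x (diff (fun _ : M => (0 : ℝ)) x) (diff h x) + 0 * g.laplacian h x = 0 := by
      intro x
      rw [diff_const, dual_zero_left, zero_mul, add_zero]
    exact (integral_congr_ae (Eventually.of_forall h3)).trans (integral_zero _ _)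
  · intro f k hf hfc hk hkc _ _ h1 h2
    have h3 : ∀ x, g.dual x (diff (fun y => f y + k y) x) (diff h x) + (f x + k x) * g.laplacian h x =
        (g.dual x (diff f x) (diff h x) + f x * g.laplacian h x) +
        (g.dual x (diff k x) (diff h x) + k x * g.laplacian h x) := by
      intro x
      rw [diff_add ((hf x).mdifferentiableAt (by simp)) ((hk x).mdifferentiableAt (by simp)),
        dual_add_left]
      ring
    refine (integral_congr_ae (Eventually.of_forall h3)).trans ?_
    rw [integral_add (hint f hf hfc) (hint k hk hkc), h1, h2, add_zero]
  · intro x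
    exact ⟨_, (chartAt (E n) x).open_source.mem_nhds (mem_chart_source _ x), fun f hf hc hfs _ =>
      green_of_tsupport_subset g (isChart_chartAt x) hf hc hfs hh⟩

end Green

/-! ### Integrals over superlevel sets -/

section PosPart

/-- The function `x₊²/2`. -/
def halfSq (x : ℝ) : ℝ := max x 0 ^ 2 / 2

lemma hasDerivAt_halfSq (x : ℝ) : HasDerivAt halfSq (max x 0) x := by
  rcases lt_trichotomy x 0 with hx | rfl | hx
  · rw [max_eq_right hx.le]
    refine (hasDerivAt_const x (0 : ℝ)).congr_of_eventuallyEq ?_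
    filter_upwards [gt_mem_nhds hx] with y hy
    simp [halfSq, max_eq_right hy.le]
  · rw [max_self, hasDerivAt_iff_isLittleO_nhds_zero]
    have h1 : (fun h : ℝ => halfSq (0 + h) - halfSq 0 - h • (0 : ℝ)) =O[𝓝 0] fun h => h ^ 2 := by
      refine Asymptotics.IsBigO.of_bound 1 (Eventually.of_forall fun h => ?_)
      have h2 : halfSq (0 + h) - halfSq 0 - h • (0 : ℝ) = max h 0 ^ 2 / 2 := by simp [halfSq]
      rw [h2, Real.norm_eq_abs, Real.norm_eq_abs, abs_of_nonneg (a := h ^ 2) (by positivity),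
        abs_of_nonneg (by positivity)]
      rcases le_total h 0 with hh | hh
      · rw [max_eq_right hh]; nlinarith
      · rw [max_eq_left hh]; nlinarith
    refine h1.trans_isLittleO ?_
    simpa using Asymptotics.isLittleO_pow_pow (𝕜 := ℝ) (show 1 < 2 by norm_num)
  · rw [max_eq_left hx.le]
    have h1 : HasDerivAt (fun y : ℝ => y ^ 2 / 2) x x := by
      have := (hasDerivAt_pow 2 x).div_const 2
      simpa using this
    refine h1.congr_of_eventuallyEq ?_
    filter_upwards [lt_mem_nhds hx] with y hy
    simp [halfSq, max_eq_left hy.le]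

lemma deriv_halfSq (x : ℝ) : deriv halfSq x = max x 0 := (hasDerivAt_halfSq x).deriv

lemma contDiff_halfSq : ContDiff ℝ 1 halfSq := by
  refine contDiff_one_iff_deriv.2 ⟨fun x => (hasDerivAt_halfSq x).differentiableAt, ?_⟩
  rw [funext deriv_halfSq]
  fun_prop

/-- Approached from the left, t ↦ (a-t)₊ is still on its sloping branch at the kink t = a. The limit
is therefore the indicator of the closed condition t ≤ a, the one that occurs in `lev`. -/
lemma tendsto_slope_posPart (a t : ℝ) :
    Tendsto (slope (fun t => max (a - t) 0) t) (𝓝[<] t) (𝓝 (if t ≤ a then -1 else 0)) := by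
  refine tendsto_const_nhds.congr' ?_
  split_ifs with h
  · filter_upwards [self_mem_nhdsWithin] with u hu
    have hu' : u < t := hu
    rw [slope_def_field, max_eq_left (by linarith), max_eq_left (by linarith),
      eq_div_iff (by linarith)]
    ring
  · push Not at h
    filter_upwards [self_mem_nhdsWithin, nhdsWithin_le_nhds (lt_mem_nhds h)] with u hu hau
    rw [slope_def_field, max_eq_right (by linarith), max_eq_right (by linarith)]
    simp

end PosPart

/-! ### Integrals over superlevel sets and their first two primitives in t. -/

section Level

variable {X : Type*} [TopologicalSpace X] [T2Space X] [MeasurableSpace X] [BorelSpace X]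
  (μ : Measure X) [IsFiniteMeasureOnCompacts μ] (s k : X → ℝ) {k' : X → ℝ}

/-- The integral `∫_{s ≥ t} k`. -/
def lev (t : ℝ) : ℝ := ∫ x, {x | t ≤ s x}.indicator k x ∂μ

/-- The integral `∫ (s - t)₊ k`. -/
def lev₁ (t : ℝ) : ℝ := ∫ x, max (s x - t) 0 * k x ∂μ

/-- The integral `∫ (s - t)₊² / 2 k`. -/
def lev₂ (t : ℝ) : ℝ := ∫ x, halfSq (s x - t) * k x ∂μ

variable {s k} (hs : Continuous s) (hk : Continuous k) (hc : HasCompactSupport k)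
include hs hk hc

lemma integrable_lev (t : ℝ) : Integrable ({x | t ≤ s x}.indicator k) μ :=
  (hk.integrable_of_hasCompactSupport hc).indicator (isClosed_le continuous_const hs).measurableSet

lemma integrable_comp_mul {ψ : ℝ → ℝ} (hψ : Continuous ψ) : Integrable (fun x => ψ (s x) * k x) μ :=
  ((hψ.comp hs).mul hk).integrable_of_hasCompactSupport hc.mul_left

/-- The integrand is C¹ in t, so dominated convergence applies with no assumption on the level sets
of s. -/
lemma hasDerivAt_lev₂ (t : ℝ) : HasDerivAt (lev₂ μ s k) (-lev₁ μ s k t) t := by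
  have h1 : ∀ t, Continuous fun y : ℝ => halfSq (y - t) := fun t =>
    contDiff_halfSq.continuous.comp (by fun_prop)
  have h2 := hasDerivAt_integral_of_dominated_loc_of_deriv_le (μ := μ) (x₀ := t)
    (F := fun t x => halfSq (s x - t) * k x) (F' := fun t x => -max (s x - t) 0 * k x)
    (bound := fun x => ‖(|s x| + |t| + 1) * k x‖) (Metric.ball_mem_nhds t one_pos)
    (Eventually.of_forall fun t => (integrable_comp_mul μ hs hk hc (h1 t)).aestronglyMeasurable)
    (integrable_comp_mul μ hs hk hc (h1 t))
    (integrable_comp_mul μ hs hk hc (ψ := fun y => -max (y - t) 0) (by fun_prop)).aestronglyMeasurable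
    (Eventually.of_forall fun x u hu => ?_)
    (integrable_comp_mul μ hs hk hc (ψ := fun y => |y| + |t| + 1) (by fun_prop)).norm
    (Eventually.of_forall fun x u hu => ?_)
  · have h3 := h2.2
    have h4 : ∫ x, -max (s x - t) 0 * k x ∂μ = -lev₁ μ s k t := by
      simp only [lev₁, neg_mul, integral_neg]
    rw [h4] at h3
    exact h3
  · rw [norm_mul, norm_mul]
    refine mul_le_mul_of_nonneg_right ?_ (norm_nonneg _)
    rw [Real.norm_eq_abs, Real.norm_eq_abs, abs_neg, abs_of_nonneg (le_max_right _ _),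
      abs_of_nonneg (a := |s x| + |t| + 1) (by positivity)]
    rw [Metric.mem_ball, Real.dist_eq] at hu
    refine max_le ?_ (by positivity)
    have := le_abs_self (s x)
    have h5 := neg_abs_le t
    have h6 := (abs_lt.1 hu).1
    linarith
  · have h3 : HasDerivAt (fun t => halfSq (s x - t)) (max (s x - u) 0 * -1) u :=
      (hasDerivAt_halfSq (s x - u)).comp u (by simpa using (hasDerivAt_id u).const_sub (s x))
    have h4 := h3.mul_const (k x)
    rw [show -max (s x - u) 0 * k x = max (s x - u) 0 * -1 * k x by ring]
    exact h4

/-- The level set {s = t} is not known to be null, so differentiability of `lev₁` is a hypothesis.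
The left derivative always exists by dominated convergence, and it must coincide with the given one.
-/
lemma eq_neg_lev_of_hasDerivAt {c t : ℝ} (h : HasDerivAt (lev₁ μ s k) c t) : c = -lev μ s k t := by
  have h1 := (hasDerivAt_iff_tendsto_slope_left_right.1 h).1
  have hint : ∀ t, Integrable (fun x => max (s x - t) 0 * k x) μ := fun t =>
    integrable_comp_mul μ hs hk hc (ψ := fun y => max (y - t) 0) (by fun_prop)
  have h2 : ∀ u, slope (lev₁ μ s k) t u =
      ∫ x, slope (fun t => max (s x - t) 0) t u * k x ∂μ := by
    intro u
    rw [slope_def_field, lev₁, lev₁, ← integral_sub (hint u) (hint t), ← integral_div]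
    refine integral_congr_ae (Eventually.of_forall fun x => ?_)
    simp only [slope_def_field]
    ring
  have h3 : Tendsto (fun u => ∫ x, slope (fun t => max (s x - t) 0) t u * k x ∂μ) (𝓝[<] t)
      (𝓝 (∫ x, (if t ≤ s x then -1 else 0) * k x ∂μ)) := by
    refine tendsto_integral_filter_of_dominated_convergence (fun x => ‖k x‖)
      (Eventually.of_forall fun u => ?_) (Eventually.of_forall fun u => Eventually.of_forall fun x => ?_)
      (hk.integrable_of_hasCompactSupport hc).norm
      (Eventually.of_forall fun x => (tendsto_slope_posPart (s x) t).mul_const _)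
    · have : Continuous fun x => slope (fun t => max (s x - t) 0) t u * k x := by
        simp only [slope_def_field]
        fun_prop
      exact (this.integrable_of_hasCompactSupport hc.mul_left).aestronglyMeasurable
    · rw [norm_mul]
      refine mul_le_of_le_one_left (norm_nonneg _) ?_
      rw [slope_def_field, Real.norm_eq_abs, abs_div]
      refine div_le_one_of_le₀ ?_ (abs_nonneg _)
      refine (abs_max_sub_max_le_abs _ _ _).trans ?_
      rw [show s x - u - (s x - t) = -(u - t) by ring, abs_neg]
  rw [show slope (lev₁ μ s k) t = _ from funext h2] at h1
  rw [tendsto_nhds_unique h1 h3, lev, ← integral_neg]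
  refine integral_congr_ae (Eventually.of_forall fun x => ?_)
  by_cases hx : t ≤ s x
  · simp [hx]
  · simp [hx]

/-- On {s ≥ t} one has s = (s-t)₊ + t, and (s-t)₊ vanishes off this set. -/
lemma lev_mul_self (t : ℝ) : lev μ s (fun x => s x * k x) t = lev₁ μ s k t + t * lev μ s k t := by
  rw [lev, lev, lev₁, ← integral_const_mul, ← integral_add
    (integrable_comp_mul μ hs hk hc (ψ := fun y => max (y - t) 0) (by fun_prop))
    ((integrable_lev μ hs hk hc t).const_mul t)]
  refine integral_congr_ae (Eventually.of_forall fun x => ?_)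
  by_cases hx : t ≤ s x
  · simp only [indicator_of_mem (show x ∈ {x | t ≤ s x} from hx), max_eq_left (sub_nonneg.2 hx)]
    ring
  · simp only [indicator_of_notMem (show x ∉ {x | t ≤ s x} from hx),
      max_eq_right (sub_nonpos.2 (not_le.1 hx).le)]
    ring

lemma lev_add (hk' : Continuous k') (hc' : HasCompactSupport k') (t : ℝ) :
    lev μ s (fun x => k x + k' x) t = lev μ s k t + lev μ s k' t := by
  rw [lev, lev, lev, ← integral_add (integrable_lev μ hs hk hc t) (integrable_lev μ hs hk' hc' t)]
  exact integral_congr_ae (Eventually.of_forall fun x => congrFun (indicator_add _ _ _) x)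

omit hs hk hc [T2Space X] [BorelSpace X] [IsFiniteMeasureOnCompacts μ] in
lemma lev_const_mul (c t : ℝ) : lev μ s (fun x => c * k x) t = c * lev μ s k t := by
  rw [lev, lev, ← integral_const_mul]
  exact integral_congr_ae (Eventually.of_forall fun x => by simp only [indicator_apply]; split_ifs <;> simp)

end Level

/-! ### Differentiation of superlevel integrals in t by means of Green's identity. -/

section Flow

variable {n : ℕ} {M : Type*} [TopologicalSpace M] [ChartedSpace (E n) M] [IsManifold (𝓡 n) ∞ M]
  [T2Space M] [SigmaCompactSpace M] (g : Metric n M) (s : M → ℝ) {k k' h f : M → ℝ}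

/-- The divergence of `k ∇h`. -/
def Metric.gdiv (k h : M → ℝ) (x : M) : ℝ :=
  g.dual x (diff k x) (diff h x) + k x * g.laplacian h x

/-- The inner product `⟨df, dh⟩`. -/
def Metric.pair (f h : M → ℝ) (x : M) : ℝ := g.dual x (diff f x) (diff h x)

/-- The divergence of `k ∇s / |∇s|²`. -/
def Metric.transport (k : M → ℝ) : M → ℝ := g.gdiv (fun x => k x / g.pair s s x) s

/-- Smooth functions with compact support in the complement of the critical points of `s`. -/
structure Adm (s k : M → ℝ) : Prop where
  smooth : Smooth (n := n) k
  compact : HasCompactSupport k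
  regular : ∀ x ∈ tsupport k, diff (n := n) s x ≠ 0

variable {g s}

lemma smooth_pair (hf : Smooth (n := n) f) (hh : Smooth (n := n) h) : Smooth (n := n) (g.pair f h) :=
  smooth_dual g hf hh

lemma smooth_gdiv (hk : Smooth (n := n) k) (hh : Smooth (n := n) h) : Smooth (n := n) (g.gdiv k h) :=
  (smooth_dual g hk hh).add (hk.mul (smooth_laplacian g hh))

lemma tsupport_gdiv_subset : tsupport (g.gdiv k h) ⊆ tsupport k := by
  refine closure_minimal (fun x hx => ?_) (isClosed_tsupport k)
  by_contra h0
  refine hx ?_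
  rw [Metric.gdiv, diff_eq_zero_of_notMem_tsupport h0, image_eq_zero_of_notMem_tsupport h0,
    dual_zero_left, zero_mul, add_zero]

lemma gdiv_mul (hf : Smooth (n := n) f) (hk : Smooth (n := n) k) (x : M) :
    g.gdiv (fun y => f y * k y) h x = f x * g.gdiv k h x + k x * g.pair f h x := by
  simp only [Metric.gdiv, Metric.pair]
  rw [diff_mul (hf.mdiff x) (hk.mdiff x), dual_add_left, dual_smul_left, dual_smul_left]
  ring

lemma Adm.mul_left (hk : Adm (n := n) s k) (hf : Smooth (n := n) f) : Adm (n := n) s fun x => f x * k x :=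
  ⟨hf.mul hk.smooth, hk.compact.mul_left, fun x hx => hk.regular x (tsupport_mul_subset_right hx)⟩

lemma Adm.mul_right (hk : Adm (n := n) s k) (hf : Smooth (n := n) f) : Adm (n := n) s fun x => k x * f x :=
  ⟨hk.smooth.mul hf, hk.compact.mul_right, fun x hx => hk.regular x (tsupport_mul_subset_left hx)⟩

lemma Adm.gdiv (hk : Adm (n := n) s k) (hh : Smooth (n := n) h) : Adm (n := n) s (g.gdiv k h) :=
  ⟨smooth_gdiv hk.smooth hh, hk.compact.of_isClosed_subset (isClosed_tsupport _) tsupport_gdiv_subset,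
    fun x hx => hk.regular x (tsupport_gdiv_subset hx)⟩

lemma pair_self_pos {x : M} (hx : diff (n := n) s x ≠ 0) : 0 < g.pair s s x := dual_self_pos g _ hx

/-- The quotient is smooth even where ds vanishes: such points lie outside the closed support of
`k`, and the numerator is zero around them. -/
lemma Adm.div (hk : Adm (n := n) s k) (hs : Smooth (n := n) s) :
    Adm (n := n) s fun x => k x / g.pair s s x := by
  have hts : tsupport (fun x => k x / g.pair s s x) ⊆ tsupport k := by
    refine closure_minimal (fun x hx => ?_) (isClosed_tsupport k)
    by_contra h0
    refine hx ?_
    simp only [image_eq_zero_of_notMem_tsupport h0, zero_div]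
  refine ⟨fun x => ?_, hk.compact.of_isClosed_subset (isClosed_tsupport _) hts,
    fun x hx => hk.regular x (hts hx)⟩
  by_cases hx : x ∈ tsupport k
  · have h1 : ContMDiffAt (𝓡 n) 𝓘(ℝ) ∞ (fun x => (g.pair s s x)⁻¹) x :=
      ContMDiffAt.comp (g := fun t : ℝ => t⁻¹) x
        (contDiffAt_inv ℝ (pair_self_pos (hk.regular x hx)).ne').contMDiffAt (smooth_pair hs hs x)
    exact (hk.smooth x).mul h1
  · refine (contMDiffAt_const (c := (0 : ℝ))).congr_of_eventuallyEq ?_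
    filter_upwards [notMem_tsupport_iff_eventuallyEq.1 hx] with y hy
    rw [hy]; simp

lemma Adm.div_mul (hk : Adm (n := n) s k) (x : M) : k x / g.pair s s x * g.pair s s x = k x := by
  by_cases hx : x ∈ tsupport k
  · exact div_mul_cancel₀ _ (pair_self_pos (hk.regular x hx)).ne'
  · rw [image_eq_zero_of_notMem_tsupport hx]; simp

lemma Adm.transport (hk : Adm (n := n) s k) (hs : Smooth (n := n) s) :
    Adm (n := n) s (g.transport s k) := (hk.div hs).gdiv hs

variable [MeasurableSpace M] [BorelSpace M]

/-- Green's identity for (s-t)₊²/2 · k and h, since the derivative of the first factor is (s-t)₊ ds.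
-/
lemma lev₁_mul_pair (hs : Smooth (n := n) s) (hk : Smooth (n := n) k) (hc : HasCompactSupport k)
    (hh : Smooth (n := n) h) (t : ℝ) :
    lev₁ g.vol s (fun x => k x * g.pair s h x) t = -lev₂ g.vol s (g.gdiv k h) t := by
  have hst : ContMDiff (𝓡 n) 𝓘(ℝ) 1 fun x => halfSq (s x - t) :=
    (contDiff_halfSq.contMDiff (n := 1)).comp ((hs.sub contMDiff_const).of_le (by simp))
  have hk1 : ContMDiff (𝓡 n) 𝓘(ℝ) 1 k := hk.of_le (by simp)
  have h1 := green g (f := fun x => halfSq (s x - t) * k x) (hst.mul hk1) hc.mul_left hh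
  have hd : ∀ x, diff (n := n) (fun x => halfSq (s x - t)) x = max (s x - t) 0 • diff s x := by
    intro x
    have h2 := diff_comp (n := n) (f := s) (ψ := fun y => halfSq (y - t)) (x := x)
      (((hasDerivAt_halfSq (s x - t)).comp_sub_const (s x) t).differentiableAt) (hs.mdiff x)
    rw [((hasDerivAt_halfSq (s x - t)).comp_sub_const (s x) t).deriv] at h2
    exact h2
  have h3 : ∀ x, g.dual x (diff (fun x => halfSq (s x - t) * k x) x) (diff h x) +
      halfSq (s x - t) * k x * g.laplacian h x =
      max (s x - t) 0 * (k x * g.pair s h x) + halfSq (s x - t) * g.gdiv k h x := by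
    intro x
    rw [diff_mul ((hst x).mdifferentiableAt (by simp)) (hk.mdiff x), hd, dual_add_left,
      dual_smul_left, dual_smul_left, dual_smul_left, Metric.gdiv, Metric.pair]
    ring
  have h4 : ∫ x, (max (s x - t) 0 * (k x * g.pair s h x) + halfSq (s x - t) * g.gdiv k h x) ∂g.vol = 0 :=
    (integral_congr_ae (Eventually.of_forall fun x => (h3 x).symm)).trans h1
  have hc2 : HasCompactSupport (g.gdiv k h) :=
    hc.of_isClosed_subset (isClosed_tsupport _) tsupport_gdiv_subset
  have h5 : Integrable (fun x => max (s x - t) 0 * (k x * g.pair s h x)) g.vol :=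
    integrable_comp_mul g.vol hs.continuous (hk.continuous.mul (smooth_pair hs hh).continuous)
      hc.mul_right (ψ := fun y => max (y - t) 0) (by fun_prop)
  rw [integral_add h5
    (integrable_comp_mul g.vol hs.continuous (smooth_gdiv hk hh).continuous hc2
      (ψ := fun y => halfSq (y - t)) (contDiff_halfSq.continuous.comp (by fun_prop)))] at h4
  exact eq_neg_of_add_eq_zero_left h4

/-- The regularity gain: the right-hand side of `lev₁_mul_pair` contains `lev₂`, which is
differentiable without conditions, so `lev₁` of such products is differentiable too. -/
lemma hasDerivAt_lev₁_mul_pair (hs : Smooth (n := n) s) (hk : Smooth (n := n) k)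
    (hc : HasCompactSupport k) (hh : Smooth (n := n) h) (t : ℝ) :
    HasDerivAt (lev₁ g.vol s fun x => k x * g.pair s h x) (lev₁ g.vol s (g.gdiv k h) t) t := by
  have h1 := (hasDerivAt_lev₂ g.vol hs.continuous (smooth_gdiv hk hh).continuous
    (hc.of_isClosed_subset (isClosed_tsupport _) (tsupport_gdiv_subset (g := g) (h := h))) t).neg
  rw [neg_neg] at h1
  rw [show (lev₁ g.vol s fun x => k x * g.pair s h x) = -lev₂ g.vol s (g.gdiv k h) from
    funext fun t => lev₁_mul_pair hs hk hc hh t]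
  exact h1

lemma lev_mul_pair (hs : Smooth (n := n) s) (hk : Smooth (n := n) k)
    (hc : HasCompactSupport k) (hh : Smooth (n := n) h) (t : ℝ) :
    lev g.vol s (fun x => k x * g.pair s h x) t = -lev₁ g.vol s (g.gdiv k h) t := by
  rw [eq_neg_lev_of_hasDerivAt g.vol hs.continuous (hk.continuous.mul (smooth_pair hs hh).continuous)
    hc.mul_right (hasDerivAt_lev₁_mul_pair hs hk hc hh t), neg_neg]
  rfl

/-- Writing k = (k/|∇s|²)⟨ds,ds⟩, possible because the support of `k` avoids the critical points,
puts every admissible function in the form required by `hasDerivAt_lev₁_mul_pair`. -/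
lemma Adm.hasDerivAt_lev₁ (hk : Adm (n := n) s k) (hs : Smooth (n := n) s) (t : ℝ) :
    HasDerivAt (lev₁ g.vol s k) (-lev g.vol s k t) t := by
  have h1 := hasDerivAt_lev₁_mul_pair (g := g) hs (hk.div (g := g) hs).smooth
    (hk.div (g := g) hs).compact hs t
  simp only [hk.div_mul] at h1
  rwa [← eq_neg_lev_of_hasDerivAt g.vol hs.continuous hk.smooth.continuous hk.compact h1]

/-- The flow rule: the derivative of `∫_{s ≥ t} k⟨ds, dh⟩` is `∫_{s ≥ t} div(k∇h)`. -/
lemma Adm.hasDerivAt_lev_mul_pair (hk : Adm (n := n) s k) (hs : Smooth (n := n) s)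
    (hh : Smooth (n := n) h) (t : ℝ) :
    HasDerivAt (lev g.vol s fun x => k x * g.pair s h x) (lev g.vol s (g.gdiv k h) t) t := by
  have h1 := ((hk.gdiv (g := g) hh).hasDerivAt_lev₁ (g := g) hs t).neg
  rw [neg_neg] at h1
  rw [show (lev g.vol s fun x => k x * g.pair s h x) = -lev₁ g.vol s (g.gdiv k h) from
    funext fun t => lev_mul_pair hs hk.smooth hk.compact hh t]
  exact h1

lemma Adm.hasDerivAt_lev (hk : Adm (n := n) s k) (hs : Smooth (n := n) s) (t : ℝ) :
    HasDerivAt (lev g.vol s k) (lev g.vol s (g.transport s k) t) t := by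
  have h1 := (hk.div (g := g) hs).hasDerivAt_lev_mul_pair (g := g) hs hs t
  simp only [hk.div_mul] at h1
  exact h1

lemma Adm.deriv_lev (hk : Adm (n := n) s k) (hs : Smooth (n := n) s) :
    deriv (lev g.vol s k) = lev g.vol s (g.transport s k) :=
  funext fun t => (hk.hasDerivAt_lev hs t).deriv

/-- The derivative is again the superlevel integral of an admissible function, so the argument can
be repeated indefinitely. -/
lemma Adm.contDiff_lev (hk : Adm (n := n) s k) (hs : Smooth (n := n) s) :
    ContDiff ℝ ∞ (lev g.vol s k) := by
  refine contDiff_infty.2 fun m => ?_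
  induction m generalizing k with
  | zero =>
    exact contDiff_zero.2 (continuous_iff_continuousAt.2 fun t => (hk.hasDerivAt_lev hs t).continuousAt)
  | succ m ih =>
    rw [Nat.cast_add, Nat.cast_one, contDiff_succ_iff_deriv]
    refine ⟨fun t => (hk.hasDerivAt_lev hs t).differentiableAt, by simp, ?_⟩
    rw [hk.deriv_lev hs]
    exact ih (hk.transport hs)

/-- The derivative in t only sees the level set s = t, where the factor s equals t. Formally, in
`lev_mul_self` the derivative -lev of `lev₁` cancels the term lev from the product rule. -/
lemma Adm.deriv_lev_mul_self (hk : Adm (n := n) s k) (hs : Smooth (n := n) s) (t : ℝ) :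
    deriv (lev g.vol s fun x => s x * k x) t = t * deriv (lev g.vol s k) t := by
  have h1 : (lev g.vol s fun x => s x * k x) = fun t => lev₁ g.vol s k t + t * lev g.vol s k t :=
    funext fun t => lev_mul_self g.vol hs.continuous hk.smooth.continuous hk.compact t
  have h2 := (hk.hasDerivAt_lev₁ (g := g) hs t).add ((hasDerivAt_id t).mul (hk.hasDerivAt_lev (g := g) hs t))
  rw [h1, hk.deriv_lev hs]
  refine h2.deriv.trans ?_
  simp

lemma Adm.lev_add (hk : Adm (n := n) s k) (hk' : Adm (n := n) s k') (hs : Smooth (n := n) s) :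
    lev g.vol s (fun x => k x + k' x) = fun t => lev g.vol s k t + lev g.vol s k' t :=
  funext fun t => RenVol.lev_add g.vol hs.continuous hk.smooth.continuous hk.compact
    hk'.smooth.continuous hk'.compact t

/-- If `k` vanishes near the zero locus of `s`, then `∫_{s ≥ t} k` is constant for small `t`. -/
lemma lev_eventually_const (μ : Measure M) (hs : Continuous s) (hc : HasCompactSupport k)
    (h0 : ∀ x ∈ tsupport k, s x ≠ 0) : ∀ᶠ t in 𝓝 (0 : ℝ), lev μ s k t = lev μ s k 0 := by
  have h1 : ∃ δ > 0, ∀ x ∈ tsupport k, δ ≤ |s x| := by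
    rcases (tsupport k).eq_empty_or_nonempty with he | hne
    · exact ⟨1, one_pos, by simp [he]⟩
    · obtain ⟨x, hx, hmin⟩ := hc.isCompact.exists_isMinOn hne hs.abs.continuousOn
      exact ⟨|s x|, abs_pos.2 (h0 x hx), fun y hy => hmin hy⟩
  obtain ⟨δ, hδ, h2⟩ := h1
  filter_upwards [Metric.ball_mem_nhds (0 : ℝ) hδ] with t ht
  rw [Metric.mem_ball, Real.dist_eq, sub_zero] at ht
  refine integral_congr_ae (Eventually.of_forall fun x => ?_)
  by_cases hx : x ∈ tsupport k
  · have h3 := h2 x hx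
    have h4 : t ≤ s x ↔ 0 ≤ s x := by
      rcases abs_cases (s x) with h5 | h5 <;> rcases abs_lt.1 ht with ⟨h6, h7⟩
      · exact ⟨fun _ => h5.2, fun _ => by linarith⟩
      · exact ⟨fun _ => by linarith, fun _ => by linarith⟩
    simp only [indicator_apply, h4, mem_ofPred_eq]
  · simp only [indicator_apply, image_eq_zero_of_notMem_tsupport hx]
    simp

end Flow

/-! ### Derivatives at t = 0 of superlevel integrals: multiplication by s and integration by parts.
-/

section Jets

lemma iteratedDeriv_id_mul {v : ℝ → ℝ} (hv : ContDiff ℝ ∞ v) (m : ℕ) :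
    iteratedDeriv (m + 1) (fun t => t * v t) =
      fun t => t * iteratedDeriv (m + 1) v t + (m + 1) * iteratedDeriv m v t := by
  have hd : ∀ m t, HasDerivAt (iteratedDeriv m v) (iteratedDeriv (m + 1) v t) t := by
    intro m t
    rw [iteratedDeriv_succ]
    exact ((hv.differentiable_iteratedDeriv m (by exact_mod_cast ENat.natCast_lt_top m)) t).hasDerivAt
  induction m with
  | zero =>
    funext t
    rw [zero_add, iteratedDeriv_one]
    have h1 := (hasDerivAt_id t).mul (hd 0 t)
    rw [iteratedDeriv_zero] at h1
    refine h1.deriv.trans ?_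
    simp [add_comm]
  | succ m ih =>
    rw [iteratedDeriv_succ, ih]
    funext t
    have h1 := ((hasDerivAt_id t).mul (hd (m + 1) t)).add ((hd m t).const_mul ((m : ℝ) + 1))
    refine h1.deriv.trans ?_
    simp only [id, Nat.cast_add, Nat.cast_one]
    ring

variable {n : ℕ} {M : Type*} [TopologicalSpace M] [ChartedSpace (E n) M] [IsManifold (𝓡 n) ∞ M]
  [T2Space M] [SigmaCompactSpace M] [MeasurableSpace M] [BorelSpace M]
  (g : Metric n M) (s χ : M → ℝ) {h f k : M → ℝ}

/-- The derivative of order `m` at `t = 0` of `∫_{s ≥ t} χh`. -/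
def jet (m : ℕ) (h : M → ℝ) : ℝ := iteratedDeriv m (lev g.vol s fun x => χ x * h x) 0

/-- A cutoff function near the zero locus of `s`. -/
structure IsCutoff (s χ : M → ℝ) : Prop where
  adm : Adm (n := n) s χ
  eq_one : ∀ x, s x = 0 → χ =ᶠ[𝓝 x] fun _ => 1

variable {g s χ} (hs : Smooth (n := n) s) (hχ : IsCutoff (n := n) s χ)
include hs hχ

lemma jet_add (m : ℕ) (hf : Smooth (n := n) f) (hh : Smooth (n := n) h) :
    jet g s χ m (fun x => f x + h x) = jet g s χ m f + jet g s χ m h := by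
  have h1 : (fun x => χ x * (f x + h x)) = fun x => χ x * f x + χ x * h x := by
    funext x; ring
  rw [jet, h1, (hχ.adm.mul_right hf).lev_add (hχ.adm.mul_right hh) hs]
  exact iteratedDeriv_fun_add
    (((hχ.adm.mul_right hf).contDiff_lev hs).contDiffAt.of_le (by exact_mod_cast le_top))
    (((hχ.adm.mul_right hh).contDiff_lev hs).contDiffAt.of_le (by exact_mod_cast le_top))

omit hs hχ in
lemma jet_const_mul (m : ℕ) (c : ℝ) :
    jet g s χ m (fun x => c * f x) = c * jet g s χ m f := by
  have h1 : (fun x => χ x * (c * f x)) = fun x => c * (χ x * f x) := by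
    funext x; ring
  have h2 : (lev g.vol s fun x => c * (χ x * f x)) = fun t => c * lev g.vol s (fun x => χ x * f x) t :=
    funext fun t => lev_const_mul _ _ _
  rw [jet, h1, h2]
  exact iteratedDeriv_const_mul_field _ _

/-- The counterpart of the distributional identity xδ^{(m)}(x) = -mδ^{(m-1)}(x). -/
lemma jet_mul_self (m : ℕ) (hf : Smooth (n := n) f) :
    jet g s χ (m + 1) (fun x => s x * f x) = m * jet g s χ m f := by
  have hk := hχ.adm.mul_right hf
  have h1 : (fun x => χ x * (s x * f x)) = fun x => s x * (χ x * f x) := by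
    funext x; ring
  rw [jet, h1, iteratedDeriv_succ', funext (hk.deriv_lev_mul_self (g := g) hs)]
  cases m with
  | zero => simp
  | succ m =>
    rw [iteratedDeriv_id_mul]
    · simp only [zero_mul, zero_add, jet]
      rw [iteratedDeriv_succ' (f := lev g.vol s fun x => χ x * f x)]
      push_cast
      ring
    · rw [hk.deriv_lev hs]
      exact (hk.transport hs).contDiff_lev hs

/-- The flow rule applied to χf. The extra term f⟨dχ,dh⟩ is supported away from the zero locus,
since χ is locally constant there, and so does not contribute to derivatives at t = 0. -/
lemma jet_gdiv (m : ℕ) (hf : Smooth (n := n) f) (hh : Smooth (n := n) h) :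
    jet g s χ (m + 1) (g.gdiv f h) = jet g s χ (m + 2) (fun x => f x * g.pair s h x) := by
  have hk := hχ.adm.mul_right hf
  have h1 : (fun x => χ x * (f x * g.pair s h x)) = fun x => χ x * f x * g.pair s h x := by
    funext x; ring
  have h2 : g.gdiv (fun x => χ x * f x) h =
      fun x => χ x * g.gdiv f h x + f x * g.pair χ h x := funext fun x => gdiv_mul hχ.adm.smooth hf x
  have ht : tsupport (fun x => f x * g.pair χ h x) ⊆ tsupport χ := by
    refine closure_minimal (fun x hx => ?_) (isClosed_tsupport χ)
    by_contra h0
    refine hx ?_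
    simp only [Metric.pair, diff_eq_zero_of_notMem_tsupport h0, dual_zero_left, mul_zero]
  have ha2 : Adm (n := n) s fun x => f x * g.pair χ h x :=
    ⟨hf.mul (smooth_pair hχ.adm.smooth hh), hχ.adm.compact.of_isClosed_subset (isClosed_tsupport _) ht,
      fun x hx => hχ.adm.regular x (ht hx)⟩
  have hz : ∀ x ∈ tsupport (fun x => f x * g.pair χ h x), s x ≠ 0 := by
    intro x hx h0
    have h3 := hχ.eq_one x h0
    refine notMem_tsupport_iff_eventuallyEq.2 ?_ hx
    filter_upwards [h3.eventuallyEq_nhds] with y hy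
    simp only [Metric.pair, diff_congr hy, diff_const, dual_zero_left, mul_zero, Pi.zero_apply]
  have h4 := lev_eventually_const g.vol hs.continuous ha2.compact hz
  rw [jet, jet, h1, iteratedDeriv_succ' (n := m + 1),
    funext fun t => (hk.hasDerivAt_lev_mul_pair (g := g) hs hh t).deriv, h2,
    (hχ.adm.mul_right (smooth_gdiv hf hh)).lev_add ha2 hs]
  have h5 := iteratedDeriv_fun_add (n := m + 1) (x := (0 : ℝ))
    (((hχ.adm.mul_right (smooth_gdiv (g := g) hf hh)).contDiff_lev (g := g) hs).contDiffAt.of_le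
      (by exact_mod_cast le_top))
    ((ha2.contDiff_lev (g := g) hs).contDiffAt.of_le (by exact_mod_cast le_top))
  -- The superlevel integral of the extra term is constant near 0, though not zero; its derivatives
  -- vanish because the order m+1 is positive.
  have h6 : iteratedDeriv (m + 1) (lev g.vol s fun x => f x * g.pair χ h x) 0 = 0 := by
    rw [Filter.EventuallyEq.iteratedDeriv_eq (m + 1)
      (g := fun _ => lev g.vol s (fun x => f x * g.pair χ h x) 0) h4, iteratedDeriv_const]
    simp
  rw [h5, h6, add_zero]

end Jets

section SmoothOps

variable {n : ℕ} {M : Type*} [TopologicalSpace M] [ChartedSpace (E n) M] {f k : M → ℝ}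

lemma Smooth.fmul (hf : Smooth (n := n) f) (hk : Smooth (n := n) k) :
    Smooth (n := n) fun x => f x * k x := ContMDiff.mul hf hk

lemma Smooth.fadd (hf : Smooth (n := n) f) (hk : Smooth (n := n) k) :
    Smooth (n := n) fun x => f x + k x := ContMDiff.add hf hk

lemma Smooth.cmul (c : ℝ) (hf : Smooth (n := n) f) : Smooth (n := n) fun x => c * f x :=
  ContMDiff.mul contMDiff_const hf

end SmoothOps

/-! ### The recursion that lowers the order of the jet by the Laplace–Robin operator. -/

section Algebra

variable {n : ℕ} {M : Type*} [TopologicalSpace M] [ChartedSpace (E n) M] [IsManifold (𝓡 n) ∞ M]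
  [T2Space M] [SigmaCompactSpace M] [MeasurableSpace M] [BorelSpace M]
  {g : Metric n M} {s χ h f l : M → ℝ}

/-- The function `ρ = -(Δs + Js)/n`. -/
def Metric.rhoFn (g : Metric n M) (s : M → ℝ) (x : M) : ℝ := -(1 / (n : ℝ)) * g.yamabe s x

lemma smooth_rhoFn (hs : Smooth (n := n) s) : Smooth (n := n) (g.rhoFn s) :=
  contMDiff_const.mul (smooth_yamabe g hs)

lemma laplacian_eq_rhoFn (hn : 2 ≤ n) (x : M) :
    g.laplacian s x = -n * g.rhoFn s x - g.J x * s x := by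
  have hn' : (n : ℝ) ≠ 0 := by positivity
  rw [Metric.rhoFn, Metric.yamabe]
  field_simp
  ring

/-- This is how S enters the argument: for f = S⁻¹h the product f|∇s|² equals h up to a multiple of
s, which lowers the order of the jet. -/
lemma pair_self_eq (hn : 2 ≤ n) (x : M) :
    g.pair s s x = g.scurv s x - 2 * s x * g.rhoFn s x := by
  have hn' : (n : ℝ) ≠ 0 := by positivity
  rw [Metric.scurv, laplacian_eq_rhoFn hn, Metric.pair]
  field_simp
  ring

variable (hn : 2 ≤ n) (hs : Smooth (n := n) s) (hχ : IsCutoff (n := n) s χ)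
  (hS : ∀ x, g.scurv s x ≠ 0)
include hn hs hχ hS

/-- The flow rule for the vector field `S⁻¹h ∇s`. -/
lemma jet_pair_self (m : ℕ) (hh : Smooth (n := n) h) (hf : Smooth (n := n) f)
    (hfh : ∀ x, g.scurv s x * f x = h x) :
    jet g s χ (m + 1) (g.pair s f) - n * jet g s χ (m + 1) (fun x => g.rhoFn s x * f x) -
      jet g s χ (m + 1) (fun x => s x * (g.J x * f x)) =
    jet g s χ (m + 2) h - 2 * ((m : ℝ) + 1) * jet g s χ (m + 1) (fun x => g.rhoFn s x * f x) := by
  have hρ := (smooth_rhoFn (g := g) hs).fmul hf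
  have hJ := hs.fmul ((smooth_J g).fmul hf)
  have h1 := jet_gdiv (g := g) hs hχ m hf hs
  have h2 : g.gdiv f s = fun x => (g.pair s f x + -(n : ℝ) * (g.rhoFn s x * f x)) +
      -1 * (s x * (g.J x * f x)) := by
    funext x
    rw [Metric.gdiv, laplacian_eq_rhoFn hn, Metric.pair, dual_symm]
    ring
  have h3 : (fun x => f x * g.pair s s x) = fun x => h x + -2 * (s x * (g.rhoFn s x * f x)) := by
    funext x
    rw [pair_self_eq hn, ← hfh]
    ring
  rw [h2, h3, jet_add hs hχ _ ((smooth_pair hs hf).fadd (Smooth.cmul _ hρ))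
    (Smooth.cmul _ hJ), jet_add hs hχ _ (smooth_pair hs hf) (Smooth.cmul _ hρ),
    jet_const_mul _ _, jet_const_mul _ _, jet_add hs hχ _ hh
      (Smooth.cmul _ (hs.fmul hρ)), jet_const_mul _ _,
    jet_mul_self hs hχ _ hρ] at h1
  push_cast at h1
  linear_combination h1

/-- The recursion for the Laplace–Robin operator. -/
theorem jet_robin (m : ℕ) (hh : Smooth (n := n) h) :
    jet g s χ (m + 1) (fun x => -g.robin s ((m : ℝ) + 2 - n) (fun z => (g.scurv s z)⁻¹ * h z) x) =
      ((n : ℝ) - (m + 2)) * jet g s χ (m + 2) h := by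
  set f : M → ℝ := fun z => (g.scurv s z)⁻¹ * h z with hf'
  have hf : Smooth (n := n) f := ((smooth_scurv g hs).inv hS).mul hh
  have hρ := (smooth_rhoFn (g := g) hs).fmul hf
  have hJ := hs.fmul ((smooth_J g).fmul hf)
  have hL := hs.fmul (smooth_laplacian g hf)
  have hP : Smooth (n := n) (g.pair s f) := smooth_pair hs hf
  have h1 := jet_pair_self hn hs hχ hS m hh hf fun x => mul_inv_cancel_left₀ (hS x) _
  -- Integration by parts for s∇f: inside a jet of order m+1 the term sΔf may be replaced by
  -- m⟨ds,df⟩.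
  have h2 := jet_gdiv (g := g) hs hχ m hs hf
  have h3 : g.gdiv s f = fun x => g.pair s f x + s x * g.laplacian f x := rfl
  rw [h3, jet_add hs hχ _ hP hL, jet_mul_self hs hχ _ hP] at h2
  have h4 : (fun x => -g.robin s ((m : ℝ) + 2 - n) f x) = fun x =>
      ((-((n : ℝ) + 2 * ((m : ℝ) + 2 - n) - 2) * g.pair s f x +
      -(((n : ℝ) + 2 * ((m : ℝ) + 2 - n) - 2) * ((m : ℝ) + 2 - n)) * (g.rhoFn s x * f x)) +
      s x * g.laplacian f x) + ((m : ℝ) + 2 - n) * (s x * (g.J x * f x)) := by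
    funext x
    rw [Metric.robin, Metric.rhoFn, Metric.pair]
    ring
  rw [h4, jet_add hs hχ _ (((Smooth.cmul _ hP).fadd (Smooth.cmul _ hρ)).fadd hL)
    (Smooth.cmul _ hJ), jet_add hs hχ _ ((Smooth.cmul _ hP).fadd (Smooth.cmul _ hρ)) hL,
    jet_add hs hχ _ (Smooth.cmul _ hP) (Smooth.cmul _ hρ), jet_const_mul _ _,
    jet_const_mul _ _, jet_const_mul _ _]
  push_cast at h2
  -- After sΔf is replaced, ⟨ds,df⟩ has coefficient -(2m+2-n) + m = n-(m+2). The ρ and J terms of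
  -- the operator then match `h1` with this same factor.
  linear_combination h2 + ((n : ℝ) - (m + 2)) * h1

/-- The first step of the recursion, for the logarithm of a true scale. -/
theorem jet_inner₀ (hl : Smooth (n := n) l) :
    jet g s χ (n - 1) (g.inner₀ s l) = jet g s χ n fun _ => 1 := by
  obtain ⟨m, rfl⟩ : ∃ m, n = m + 2 := ⟨n - 2, by omega⟩
  set f : M → ℝ := fun z => (g.scurv s z)⁻¹ with hf'
  have hf : Smooth (n := m + 2) f := (smooth_scurv g hs).inv hS
  have hρ := (smooth_rhoFn (g := g) hs).fmul hf
  have hJ := hs.fmul ((smooth_J g).fmul hf)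
  have hP : Smooth (n := m + 2) (g.pair s f) := smooth_pair hs hf
  -- The flow rule for h = 1, that is, for the field S⁻¹∇s. It replaces `jet_robin`, whose factor
  -- would be zero at this order.
  have h1 := jet_pair_self hn hs hχ hS m (h := fun _ => 1) contMDiff_const hf
    fun x => mul_inv_cancel₀ (hS x)
  have hQ := hf.fmul (smooth_pair (g := g) hs hl)
  have hsf : Smooth (n := m + 2) fun x => s x * f x := hs.mul hf
  have hG : Smooth (n := m + 2) (g.gdiv (fun x => s x * f x) l) := smooth_gdiv hsf hl
  have h2 := jet_gdiv (g := g) hs hχ m hsf hl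
  have h3 : (fun x => s x * f x * g.pair s l x) = fun x => s x * (f x * g.pair s l x) := by
    funext x; ring
  rw [h3, jet_mul_self hs hχ _ hQ] at h2
  -- The terms in l are collected into a multiple of S⁻¹⟨ds,dl⟩ and the divergence of s S⁻¹∇l. By
  -- `h2` their jets cancel, which is what the correction with ∇S⁻¹ is for.
  have h4 : g.inner₀ s l = fun x => ((((m : ℝ) + 1) * (f x * g.pair s l x) +
      (m : ℝ) * (g.rhoFn s x * f x)) + -1 * (s x * (g.J x * f x))) + (-1 *
        g.gdiv (fun x => s x * f x) l x + g.pair s f x) := by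
    funext x
    rw [gdiv_mul hs hf, Metric.inner₀, Metric.robinLog, Metric.gdiv, Metric.rhoFn, Metric.pair,
      Metric.pair, dual_symm g (diff s x) (diff f x)]
    push_cast
    ring
  rw [h4, jet_add hs hχ _ (((Smooth.cmul _ hQ).fadd (Smooth.cmul _ hρ)).fadd
    (Smooth.cmul _ hJ)) ((Smooth.cmul _ hG).fadd hP),
    jet_add hs hχ _ ((Smooth.cmul _ hQ).fadd (Smooth.cmul _ hρ)) (Smooth.cmul _ hJ),
    jet_add hs hχ _ (Smooth.cmul _ hQ) (Smooth.cmul _ hρ),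
    jet_add hs hχ _ (Smooth.cmul _ hG) hP, jet_const_mul _ _,
    jet_const_mul _ _, jet_const_mul _ _, jet_const_mul _ _]
  push_cast at h1 h2 ⊢
  linear_combination h1 - h2

omit hS in
/-- The iterated recursion. -/
theorem jet_negDSinvPow {σ : Family n M M} (hσ : σ g = s) (hS : ∀ x, SCurv σ g x ≠ 0) (k : ℕ)
    (hk : k ≤ n - 2) : ∀ F : Family n M M, Smooth (n := n) (F g) →
    jet g s χ 1 (negDSinvPow σ k ((k : ℝ) + 1 - n) F g) =
      (n - 2).descFactorial k * jet g s χ (k + 1) (F g) := by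
  subst hσ
  induction k with
  | zero => intro F _; simp [negDSinvPow]
  | succ k ih =>
    intro F hF
    -- The factor acting on F is peeled off. It acts in weight k+2-n and contributes n-2-k, the next
    -- factor of the descending factorial.
    have h1 := ih (by omega) (fun g x =>
      -laplaceRobin σ ((k : ℝ) + 2 - n) (fun g' z => (SCurv σ g' z)⁻¹ * F g' z) g x)
      (smooth_robin g hs (((smooth_scurv g hs).inv hS).mul hF) _).neg
    have h2 := jet_robin hn hs hχ hS k hF
    rw [negDSinvPow, show ((k + 1 : ℕ) : ℝ) + 1 - n - 1 = (k : ℝ) + 1 - n by push_cast; ring,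
      show ((k + 1 : ℕ) : ℝ) + 1 - n = (k : ℝ) + 2 - n by push_cast; ring, h1]
    rw [show (fun x => -laplaceRobin σ ((k : ℝ) + 2 - n) (fun g' z => (SCurv σ g' z)⁻¹ * F g' z) g x) =
      fun x => -g.robin (σ g) ((k : ℝ) + 2 - n) (fun z => (g.scurv (σ g) z)⁻¹ * F g z) x from rfl, h2,
      Nat.descFactorial_succ, Nat.cast_mul, Nat.cast_sub (by omega : k ≤ n - 2),
      Nat.cast_sub (by omega : 2 ≤ n)]
    push_cast
    ring

omit hS in
theorem jet_negDSinvPow_innerTerm {σ τ : Family n M M} (hσ : σ g = s)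
    (hS : ∀ x, SCurv σ g x ≠ 0) (hl : Smooth (n := n) (logFam τ g)) :
    jet g s χ 1 (negDSinvPow σ (n - 2) (-1) (innerTerm σ τ) g) =
      (n - 2).factorial * jet g s χ n fun _ => 1 := by
  have h1 := jet_negDSinvPow hn hs hχ hσ hS (n - 2) le_rfl (innerTerm σ τ)
    (by rw [innerTerm_eq, hσ]; exact smooth_inner₀ g hs hl (by subst hσ; exact hS))
  rw [show ((n - 2 : ℕ) : ℝ) + 1 - n = -1 by push_cast [hn]; ring, Nat.descFactorial_self,
    show n - 2 + 1 = n - 1 by omega, innerTerm_eq, hσ,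
    jet_inner₀ hn hs hχ (by subst hσ; exact hS) hl] at h1
  exact h1

end Algebra

/-! ### The divergence theorem on a half-space -/

section HalfSpace

variable {m : ℕ}

/-- The divergence theorem on a large box with one face in the hyperplane x⁰ = 0; all other faces
miss the supports. -/
lemma integral_halfSpace_pi (F : Fin (m + 1) → (Fin (m + 1) → ℝ) → ℝ) (hF : ∀ i, ContDiff ℝ 1 (F i))
    (hc : ∀ i, HasCompactSupport (F i)) :
    ∫ x in {x : Fin (m + 1) → ℝ | 0 ≤ x 0}, ∑ i, fderiv ℝ (F i) x (Pi.single i 1) =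
      -∫ y : Fin m → ℝ, F 0 (Fin.cons 0 y) := by
  obtain ⟨R, hR, hball⟩ : ∃ R > 0, ∀ i, tsupport (F i) ⊆ Metric.ball 0 R := by
    have h1 : ∀ i, ∃ R, tsupport (F i) ⊆ Metric.ball 0 R := fun i =>
      (hc i).isCompact.isBounded.subset_ball 0
    choose R hR using h1
    refine ⟨∑ i, |R i| + 1, by positivity, fun i => (hR i).trans (Metric.ball_subset_ball ?_)⟩
    have := Finset.single_le_sum (f := fun i => |R i|) (fun i _ => abs_nonneg _) (Finset.mem_univ i)
    have h2 := le_abs_self (R i)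
    linarith
  have hzero : ∀ i x j, R ≤ |x j| → F i x = 0 := by
    intro i x j hj
    refine image_eq_zero_of_notMem_tsupport fun h => ?_
    have h1 := mem_ball_zero_iff.1 (hball i h)
    have h2 := norm_le_pi_norm x j
    rw [Real.norm_eq_abs] at h2
    linarith
  have hdzero : ∀ i x j, R ≤ |x j| → fderiv ℝ (F i) x = 0 := by
    intro i x j hj
    have h0 : x ∉ tsupport (F i) := fun h => by
      have h1 := mem_ball_zero_iff.1 (hball i h)
      have h2 := norm_le_pi_norm x j
      rw [Real.norm_eq_abs] at h2
      linarith
    rw [(notMem_tsupport_iff_eventuallyEq.1 h0).fderiv_eq]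
    simp
  set a : Fin (m + 1) → ℝ := Fin.cons 0 fun _ => -R with ha
  set b : Fin (m + 1) → ℝ := fun _ => R with hb
  have hcont : Continuous fun x => ∑ i, fderiv ℝ (F i) x (Pi.single i 1) :=
    continuous_finsetSum _ fun i _ => ((hF i).continuous_fderiv (by simp)).clm_apply continuous_const
  have key := integral_divergence_of_hasFDerivAt_off_countable' a b
    (fun i => by refine Fin.cases ?_ (fun i => ?_) i <;> simp [ha, hb] <;> linarith) F
    (fun i x => fderiv ℝ (F i) x) ∅ countable_empty (fun i => (hF i).continuous.continuousOn)
    (fun x _ i => ((hF i).differentiable (by simp) x).hasFDerivAt)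
    (hcont.continuousOn.integrableOn_compact isCompact_Icc)
  have hL : ∫ x in {x : Fin (m + 1) → ℝ | 0 ≤ x 0}, ∑ i, fderiv ℝ (F i) x (Pi.single i 1) =
      ∫ x in Icc a b, ∑ i, fderiv ℝ (F i) x (Pi.single i 1) := by
    refine (setIntegral_eq_of_subset_of_forall_sdiff_eq_zero
      ((isClosed_le continuous_const (continuous_apply 0)).measurableSet) ?_ ?_)
    · intro x hx
      exact hx.1 0
    · rintro x ⟨hx0, hx⟩
      have : ∃ j, R ≤ |x j| := by
        by_contra! hlt
        refine hx ⟨fun j => ?_, fun j => (abs_lt.1 (hlt j)).2.le⟩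
        refine Fin.cases ?_ (fun i => ?_) j
        · exact hx0
        · exact (abs_lt.1 (hlt i.succ)).1.le
      obtain ⟨j, hj⟩ := this
      exact Finset.sum_eq_zero fun i _ => by rw [hdzero i x j hj]; rfl
  rw [hL, key, Fin.sum_univ_succ, Finset.sum_eq_zero fun i _ => ?_, add_zero]
  · have h1 : ∀ y : Fin m → ℝ, F 0 (Fin.insertNth 0 (b 0) y) = 0 := fun y =>
      hzero 0 _ 0 (by simp [hb, abs_of_pos hR])
    have h2 : ∀ y : Fin m → ℝ, F 0 (Fin.insertNth 0 (a 0) y) = F 0 (Fin.cons 0 y) := fun y => by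
      rw [Fin.insertNth_zero']; rfl
    simp only [h1, h2, integral_zero, zero_sub, neg_inj]
    refine setIntegral_eq_integral_of_forall_compl_eq_zero fun y hy => ?_
    by_contra h0
    refine hy ⟨fun j => ?_, fun j => ?_⟩
    all_goals
      have h3 : |y j| < R := by
        by_contra! hj
        exact h0 (hzero 0 _ j.succ (by simpa using hj))
    · exact (abs_lt.1 h3).1.le
    · exact (abs_lt.1 h3).2.le
  · have h1 : ∀ y : Fin m → ℝ, F i.succ (Fin.insertNth i.succ (b i.succ) y) = 0 := fun y =>
      hzero _ _ i.succ (by simp [hb, abs_of_pos hR])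
    have h2 : ∀ y : Fin m → ℝ, F i.succ (Fin.insertNth i.succ (a i.succ) y) = 0 := fun y =>
      hzero _ _ i.succ (by simp [ha, abs_of_pos hR])
    simp only [h1, h2, integral_zero, sub_zero]

/-- The splitting `ℝᵐ⁺¹ = ℝᵐ × ℝ`, with the last factor as the coordinate of index `0`. -/
def consE (m : ℕ) : (E m × ℝ) ≃L[ℝ] E (m + 1) :=
  LinearEquiv.toContinuousLinearEquiv
    { toFun := fun p => WithLp.toLp 2 (Fin.cons p.2 p.1.ofLp : Fin (m + 1) → ℝ)
      map_add' := fun p q => by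
        ext i; refine Fin.cases ?_ (fun i => ?_) i <;> simp
      map_smul' := fun c p => by
        ext i; refine Fin.cases ?_ (fun i => ?_) i <;> simp
      invFun := fun u => (WithLp.toLp 2 (Fin.tail u.ofLp), u 0)
      left_inv := fun p => by ext <;> simp [Fin.tail]
      right_inv := fun u => by
        ext i; refine Fin.cases ?_ (fun i => ?_) i <;> simp [Fin.tail] }

@[simp] lemma consE_zero (p : E m × ℝ) : consE m p 0 = p.2 := rfl

@[simp] lemma consE_succ (p : E m × ℝ) (i : Fin m) : consE m p i.succ = p.1 i := rfl

/-- The inclusion of `ℝᵐ` in `ℝᵐ⁺¹` as the hyperplane `u⁰ = 0`. -/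
def incE (m : ℕ) : E m →L[ℝ] E (m + 1) :=
  (consE m : (E m × ℝ) →L[ℝ] E (m + 1)) ∘L ContinuousLinearMap.inl ℝ (E m) ℝ

lemma incE_apply (v : E m) : incE m v = consE m (v, 0) := rfl

@[simp] lemma incE_zero (v : E m) : incE m v 0 = 0 := rfl

@[simp] lemma incE_succ (v : E m) (i : Fin m) : incE m v i.succ = v i := rfl

lemma incE_stdVec (i : Fin m) : incE m (stdVec m i) = stdVec (m + 1) i.succ := by
  ext j
  refine Fin.cases ?_ (fun j => ?_) j
  · rw [incE_zero, stdVec_apply]; simp [(Fin.succ_ne_zero i).symm]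
  · rw [incE_succ, stdVec_apply, stdVec_apply]; simp [Fin.succ_inj]

/-- The divergence theorem on the half-space `u⁰ ≥ 0`. -/
theorem integral_halfSpace (W : Fin (m + 1) → E (m + 1) → ℝ) (hW : ∀ i, ContDiff ℝ 1 (W i))
    (hc : ∀ i, HasCompactSupport (W i)) :
    ∫ u in {u : E (m + 1) | 0 ≤ u 0}, ∑ i, pd i (W i) u = -∫ v : E m, W 0 (incE m v) := by
  set L : (Fin (m + 1) → ℝ) ≃L[ℝ] E (m + 1) := (EuclideanSpace.equiv (Fin (m + 1)) ℝ).symm with hL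
  have hLv : ∀ x, L x = WithLp.toLp 2 x := fun x => rfl
  have h1 := integral_halfSpace_pi (fun i => W i ∘ L) (fun i => (hW i).comp L.contDiff)
    (fun i => (hc i).comp_homeomorph L.toHomeomorph)
  have h2 : ∀ x : Fin (m + 1) → ℝ, ∑ i, fderiv ℝ (W i ∘ L) x (Pi.single i 1) =
      ∑ i, pd i (W i) (WithLp.toLp 2 x) := by
    intro x
    refine Finset.sum_congr rfl fun i _ => ?_
    rw [L.comp_right_fderiv, pd]
    rfl
  have hp := (PiLp.volume_preserving_toLp (Fin (m + 1)))
  have hp' := (PiLp.volume_preserving_toLp (Fin m))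
  have he := (MeasurableEquiv.toLp 2 (Fin (m + 1) → ℝ)).measurableEmbedding
  have he' := (MeasurableEquiv.toLp 2 (Fin m → ℝ)).measurableEmbedding
  rw [← hp.setIntegral_preimage_emb he, ← hp'.integral_comp he']
  simp only [h2] at h1
  exact h1

/-- Cramer's rule for the first entry of the inverse. -/
lemma det_mul_inv_zero_zero {G : Matrix (Fin (m + 1)) (Fin (m + 1)) ℝ} (hG : G.det ≠ 0) :
    G.det * G⁻¹ 0 0 = (G.submatrix Fin.succ Fin.succ).det := by
  rw [Matrix.inv_def, Matrix.smul_apply, Matrix.adjugate_fin_succ_eq_det_submatrix,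
    Ring.inverse_eq_inv', smul_eq_mul, mul_inv_cancel_left₀ hG]
  simp

end HalfSpace

/-! ### Charts adapted to a hypersurface -/

section Adapted

variable {m : ℕ} {M : Type*} [TopologicalSpace M] [ChartedSpace (E (m + 1)) M]
  [IsManifold (𝓡 (m + 1)) ∞ M] {N : Type*} [TopologicalSpace N] [ChartedSpace (E m) N]
  [IsManifold (𝓡 m) ∞ N] {ι : N → M} {e : OpenPartialHomeomorph M (E (m + 1))}
  {eN : OpenPartialHomeomorph N (E m)}

/-- The composition of a chart with a linear isomorphism. -/
def linChart {n : ℕ} {M : Type*} [TopologicalSpace M] (e : OpenPartialHomeomorph M (E n))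
    (L : E n ≃L[ℝ] E n) : OpenPartialHomeomorph M (E n) :=
  e.trans L.toHomeomorph.toOpenPartialHomeomorph

lemma IsChart.linChart {n : ℕ} {M : Type*} [TopologicalSpace M] [ChartedSpace (E n) M]
    [IsManifold (𝓡 n) ∞ M] {e : OpenPartialHomeomorph M (E n)} (he : IsChart e)
    (L : E n ≃L[ℝ] E n) : IsChart (RenVol.linChart e L) := by
  refine OpenPartialHomeomorph.mem_maximalAtlas_of_contMDiffOn (I := 𝓡 n) (n := ∞) _ ?_ ?_
  · intro x hx
    have hx' : x ∈ e.source := by simpa [RenVol.linChart] using hx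
    have h1 : ContMDiffAt 𝓘(ℝ, E n) 𝓘(ℝ, E n) ∞ L (e x) := L.contDiff.contMDiff _
    exact (h1.comp x (he.contMDiffAt hx')).contMDiffWithinAt
  · intro u hu
    have hu' : L.symm u ∈ e.target := by simpa [RenVol.linChart] using hu
    have h1 : ContMDiffAt 𝓘(ℝ, E n) 𝓘(ℝ, E n) ∞ L.symm u := L.symm.contDiff.contMDiff u
    exact ((he.contMDiffAt_symm hu').comp u h1).contMDiffWithinAt

lemma linChart_source {n : ℕ} {M : Type*} [TopologicalSpace M] (e : OpenPartialHomeomorph M (E n))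
    (L : E n ≃L[ℝ] E n) : (linChart e L).source = e.source := by simp [linChart]

variable (ι e eN) in
/-- Charts in which the map `ι` is the inclusion of the hyperplane `u⁰ = 0`. -/
structure IsAdapted : Prop where
  isChart_dom : IsChart eN
  isChart : IsChart e
  mapsTo : ∀ y ∈ eN.source, ι y ∈ e.source
  eq_inc : ∀ y ∈ eN.source, e (ι y) = incE m (eN y)

lemma IsAdapted.linChart (h : IsAdapted ι e eN) (L : E (m + 1) ≃L[ℝ] E (m + 1))
    (hL : ∀ v, L (incE m v) = incE m v) : IsAdapted ι (linChart e L) eN where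
  isChart_dom := h.isChart_dom
  isChart := h.isChart.linChart L
  mapsTo y hy := by rw [linChart_source]; exact h.mapsTo y hy
  eq_inc y hy := by
    change L (e (ι y)) = _
    rw [h.eq_inc y hy, hL]

/-- The local normal form of an immersion is v ↦ (v, 0) in E m × F. Counting dimensions forces F to
be a line, which is identified with ℝ and placed as coordinate 0. -/
lemma exists_isAdapted (hι : Manifold.IsImmersion (𝓡 m) (𝓡 (m + 1)) ∞ ι) (y₀ : N) :
    ∃ (e : OpenPartialHomeomorph M (E (m + 1))) (eN : OpenPartialHomeomorph N (E m)),
      IsAdapted ι e eN ∧ y₀ ∈ eN.source := by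
  obtain ⟨F, _, _, hF⟩ := hι
  have h := hF y₀
  have hfin : FiniteDimensional ℝ F := by
    refine FiniteDimensional.of_injective
      ((h.equiv : (E m × F) →L[ℝ] E (m + 1)).toLinearMap ∘ₗ LinearMap.inr ℝ (E m) F) ?_
    intro a b hab
    have := h.equiv.injective hab
    simpa using this
  have hrank : Module.finrank ℝ F = Module.finrank ℝ ℝ := by
    have h1 := h.equiv.toLinearEquiv.finrank_eq
    rw [Module.finrank_prod, finrank_euclideanSpace_fin, finrank_euclideanSpace_fin] at h1
    rw [Module.finrank_self]
    omega
  set φ : F ≃L[ℝ] ℝ := ContinuousLinearEquiv.ofFinrankEq hrank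
  set L : E (m + 1) ≃L[ℝ] E (m + 1) :=
    (h.equiv.symm.trans ((ContinuousLinearEquiv.refl ℝ (E m)).prodCongr φ)).trans (consE m)
  refine ⟨RenVol.linChart h.codChart L, h.domChart, ⟨h.domChart_mem_maximalAtlas,
    IsChart.linChart h.codChart_mem_maximalAtlas L, fun y hy => ?_, fun y hy => ?_⟩,
    h.mem_domChart_source⟩
  · rw [linChart_source]; exact h.source_subset_preimage_source hy
  · have h0 : h.domChart y ∈ (h.domChart.extend (𝓡 m)).target := by
      simpa using h.domChart.map_source hy
    have h1 := h.writtenInCharts h0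
    simp only [Function.comp, OpenPartialHomeomorph.extend_coe, OpenPartialHomeomorph.extend_coe_symm,
      modelWithCornersSelf_coe, modelWithCornersSelf_coe_symm, id, h.domChart.left_inv hy] at h1
    change L (h.codChart (ι y)) = _
    rw [h1]
    simp only [L, ContinuousLinearEquiv.trans_apply, ContinuousLinearEquiv.symm_apply_apply,
      ContinuousLinearEquiv.prodCongr_apply, map_zero, ContinuousLinearEquiv.refl_apply]
    rfl

lemma IsAdapted.mem_target (h : IsAdapted ι e eN) {v : E m} (hv : v ∈ eN.target) :
    incE m v ∈ e.target ∧ e.symm (incE m v) = ι (eN.symm v) := by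
  have h1 := h.eq_inc _ (eN.map_target hv)
  have h2 := h.mapsTo _ (eN.map_target hv)
  rw [eN.right_inv hv] at h1
  rw [← h1]
  exact ⟨e.map_source h2, e.left_inv h2⟩

/-- The Gram matrix of the induced metric in adapted charts. -/
lemma IsAdapted.gramE_pullback (h : IsAdapted ι e eN) (hι : ContMDiff (𝓡 m) (𝓡 (m + 1)) ∞ ι)
    (g : Metric (m + 1) M) {v : E m} (hv : v ∈ eN.target) :
    gramE (g.pullback ι : FormField m N) eN v =
      (gramE g.form e (incE m v)).submatrix Fin.succ Fin.succ := by
  have h1 : MDifferentiableAt 𝓘(ℝ, E m) 𝓘(ℝ, E (m + 1)) (incE m) v :=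
    (incE m).differentiableAt.mdifferentiableAt
  have h2 : MDifferentiableAt 𝓘(ℝ, E (m + 1)) (𝓡 (m + 1)) e.symm (incE m v) :=
    (h.isChart.contMDiffAt_symm (h.mem_target hv).1).mdifferentiableAt (by simp)
  have h3 : MDifferentiableAt 𝓘(ℝ, E m) (𝓡 m) eN.symm v :=
    (h.isChart_dom.contMDiffAt_symm hv).mdifferentiableAt (by simp)
  have h4 : MDifferentiableAt (𝓡 m) (𝓡 (m + 1)) ι (eN.symm v) :=
    (hι _).mdifferentiableAt (by simp)
  have h5 := mfderiv_comp v h2 h1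
  have h6 := mfderiv_comp v h4 h3
  have h7 : e.symm ∘ incE m =ᶠ[𝓝 v] ι ∘ eN.symm := by
    filter_upwards [eN.open_target.mem_nhds hv] with w hw using (h.mem_target hw).2
  have h8 := h7.mfderiv_eq (I := 𝓘(ℝ, E m)) (I' := 𝓡 (m + 1))
  rw [mfderiv_eq_fderiv, ContinuousLinearMap.fderiv] at h5
  have h9 : ∀ i, mfderiv (𝓡 m) (𝓡 (m + 1)) ι (eN.symm v) (coordE eN v (stdVec m i)) =
      mfderiv 𝓘(ℝ, E (m + 1)) (𝓡 (m + 1)) e.symm (incE m v) (stdVec (m + 1) i.succ) := by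
    intro i
    have h10 : mfderiv (𝓡 m) (𝓡 (m + 1)) ι (eN.symm v) (coordE eN v (stdVec m i)) =
      mfderiv 𝓘(ℝ, E m) (𝓡 (m + 1)) (ι ∘ eN.symm) v (stdVec m i) := by rw [h6]; rfl
    have h11 : mfderiv 𝓘(ℝ, E (m + 1)) (𝓡 (m + 1)) e.symm (incE m v) (stdVec (m + 1) i.succ) =
      mfderiv 𝓘(ℝ, E m) (𝓡 (m + 1)) (e.symm ∘ incE m) v (stdVec m i) := by
      rw [h5, ← incE_stdVec]; rfl
    exact h10.trans (Eq.trans (by rw [← h8]; rfl) h11.symm)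
  ext i j
  exact apply_heq (T := E (m + 1)) g.form (h.mem_target hv).2.symm (h9 i) (h9 j)

variable {s : M → ℝ} (hs : Smooth (n := m + 1) s) (h0 : ∀ y, s (ι y) = 0)
include hs h0

lemma IsAdapted.pd_succ_eq_zero (h : IsAdapted ι e eN) {v : E m} (hv : v ∈ eN.target) (i : Fin m) :
    pd i.succ (s ∘ e.symm) (incE m v) = 0 := by
  have h1 : DifferentiableAt ℝ (s ∘ e.symm) (incE m v) :=
    (h.isChart.contDiffAt_comp_symm le_rfl (h.mem_target hv).1 (hs _)).differentiableAt (by simp)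
  have h2 : (s ∘ e.symm) ∘ incE m =ᶠ[𝓝 v] fun _ => 0 := by
    filter_upwards [eN.open_target.mem_nhds hv] with w hw
    simp only [Function.comp, (h.mem_target hw).2, h0]
  have h3 := h2.fderiv_eq (𝕜 := ℝ)
  rw [fderiv_comp v h1 (incE m).differentiableAt, ContinuousLinearMap.fderiv] at h3
  have h4 := DFunLike.congr_fun h3 (stdVec m i)
  rw [pd, ← incE_stdVec]
  simpa using h4

lemma IsAdapted.pair_self_eq (h : IsAdapted ι e eN) (g : Metric (m + 1) M) {v : E m}
    (hv : v ∈ eN.target) : g.pair s s (ι (eN.symm v)) =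
      (gramE g.form e (incE m v))⁻¹ 0 0 * pd 0 (s ∘ e.symm) (incE m v) ^ 2 := by
  obtain ⟨h1, h2⟩ := h.mem_target hv
  have h3 := dual_diff_eq g h.isChart h1 (hs.mdiff _) (hs.mdiff _)
  rw [h2] at h3
  rw [Metric.pair, h3]
  simp only [Fin.sum_univ_succ, h.pd_succ_eq_zero hs h0 hv, mul_zero, zero_mul,
    Finset.sum_const_zero, add_zero]
  ring

/-- The normal derivative of s is nonzero because ds ≠ 0. If it is negative, the chart is composed
with the reflection u⁰ ↦ -u⁰, which fixes the hyperplane. -/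
lemma exists_isAdapted_pos [T2Space M] [SigmaCompactSpace M] (g : Metric (m + 1) M)
    (hι : Manifold.IsImmersion (𝓡 m) (𝓡 (m + 1)) ∞ ι) (y₀ : N)
    (hd : diff (n := m + 1) s (ι y₀) ≠ 0) :
    ∃ (e : OpenPartialHomeomorph M (E (m + 1))) (eN : OpenPartialHomeomorph N (E m)),
      IsAdapted ι e eN ∧ y₀ ∈ eN.source ∧ 0 < pd 0 (s ∘ e.symm) (incE m (eN y₀)) := by
  obtain ⟨e, eN, h, hy₀⟩ := exists_isAdapted hι y₀
  have hv := eN.map_source hy₀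
  have hne : pd 0 (s ∘ e.symm) (incE m (eN y₀)) ≠ 0 := by
    intro h1
    have h2 := h.pair_self_eq hs h0 g hv
    rw [eN.left_inv hy₀, h1] at h2
    have h3 := pair_self_pos (g := g) hd
    simp [h2] at h3
  rcases lt_or_gt_of_ne hne with h1 | h1
  · set R : E (m + 1) ≃L[ℝ] E (m + 1) := ((consE m).symm.trans
      ((ContinuousLinearEquiv.refl ℝ (E m)).prodCongr (ContinuousLinearEquiv.neg ℝ))).trans (consE m)
    have hR : ∀ v, R (incE m v) = incE m v := by
      intro v
      ext j
      refine Fin.cases ?_ (fun j => ?_) j <;> simp [R, incE_apply]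
    have hR' : R.symm (stdVec (m + 1) 0) = -stdVec (m + 1) 0 := by
      rw [ContinuousLinearEquiv.symm_apply_eq]
      have h2 : stdVec (m + 1) 0 = consE m (0, 1) := by
        ext j
        refine Fin.cases ?_ (fun j => ?_) j
        · rw [consE_zero, stdVec_apply]; simp
        · rw [consE_succ, stdVec_apply]; simp [Fin.succ_ne_zero]
      rw [map_neg, h2]
      simp only [R, ContinuousLinearEquiv.trans_apply, ContinuousLinearEquiv.symm_apply_apply,
        ContinuousLinearEquiv.prodCongr_apply, ContinuousLinearEquiv.refl_apply,
        ContinuousLinearEquiv.neg_apply, ← map_neg]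
      congr 1
      ext <;> simp
    refine ⟨_, eN, h.linChart R hR, hy₀, ?_⟩
    have h2 : s ∘ (RenVol.linChart e R).symm = (s ∘ e.symm) ∘ R.symm := rfl
    rw [h2, pd, R.symm.comp_right_fderiv]
    have h3 : R.symm (incE m (eN y₀)) = incE m (eN y₀) := by
      rw [ContinuousLinearEquiv.symm_apply_eq, hR]
    rw [h3]
    change 0 < fderiv ℝ (s ∘ e.symm) (incE m (eN y₀)) (R.symm (stdVec (m + 1) 0))
    rw [hR', map_neg]
    exact neg_pos.2 h1
  · exact ⟨e, eN, h, hy₀, h1⟩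

end Adapted

/-! ### The divergence theorem for superlevel sets -/

section Boundary

variable {m : ℕ}

/-- Along each line in direction u⁰ the function S is strictly increasing and vanishes at u⁰ = 0. -/
lemma eventually_nonneg_iff {S : E (m + 1) → ℝ} {v₀ : E m} (hS : ContDiffAt ℝ ∞ S (incE m v₀))
    (h0 : ∀ᶠ v in 𝓝 v₀, S (incE m v) = 0) (hp : 0 < pd 0 S (incE m v₀)) :
    ∀ᶠ u in 𝓝 (incE m v₀), (0 ≤ S u ↔ 0 ≤ u 0) := by
  have h1 : ∀ᶠ u in 𝓝 (incE m v₀), DifferentiableAt ℝ S u ∧ 0 < pd 0 S u :=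
    (((hS.of_le (m := 1) (by simp)).eventually (by simp)).mono fun u hu => hu.differentiableAt (by simp)).and
      ((contDiffAt_pd hS 0).continuousAt.eventually_const_lt hp)
  have h2 : ∀ᶠ p : E m × ℝ in 𝓝 (v₀, 0), (DifferentiableAt ℝ S (consE m p) ∧
      0 < pd 0 S (consE m p)) ∧ S (incE m p.1) = 0 :=
    (((consE m).continuous.tendsto (v₀, 0)).eventually h1).and
      ((continuous_fst.tendsto (v₀, (0 : ℝ))).eventually h0)
  obtain ⟨r, hr, hball⟩ := Metric.eventually_nhds_iff_ball.1 h2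
  have h3 : ∀ p ∈ Metric.ball ((v₀, 0) : E m × ℝ) r, (0 ≤ S (consE m p) ↔ 0 ≤ p.2) := by
    rintro ⟨v, t⟩ hvt
    rw [← ball_prod_same, mem_prod] at hvt
    obtain ⟨hv, ht⟩ := hvt
    have hmem : ∀ t' ∈ Metric.ball (0 : ℝ) r, (v, t') ∈ Metric.ball ((v₀, 0) : E m × ℝ) r := by
      intro t' ht'
      rw [← ball_prod_same]
      exact ⟨hv, ht'⟩
    have hder : ∀ t' ∈ Metric.ball (0 : ℝ) r,
        HasDerivAt (fun t' => S (consE m (v, t'))) (pd 0 S (consE m (v, t'))) t' := by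
      intro t' ht'
      have h4 : HasDerivAt (fun t' : ℝ => consE m (v, t')) (consE m (0, 1)) t' :=
        (consE m).hasFDerivAt.comp_hasDerivAt t' ((hasDerivAt_const t' v).prodMk (hasDerivAt_id t'))
      have h5 : consE m (0, 1) = stdVec (m + 1) 0 := by
        ext j
        refine Fin.cases ?_ (fun j => ?_) j
        · rw [consE_zero, stdVec_apply]; simp
        · rw [consE_succ, stdVec_apply]; simp [Fin.succ_ne_zero]
      have h6 := (hball _ (hmem t' ht')).1.1.hasFDerivAt.comp_hasDerivAt t' h4
      rw [h5] at h6
      exact h6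
    have hmono : StrictMonoOn (fun t' => S (consE m (v, t'))) (Metric.ball 0 r) := by
      refine strictMonoOn_of_deriv_pos (convex_ball 0 r)
        (fun t' ht' => (hder t' ht').continuousAt.continuousWithinAt) fun t' ht' => ?_
      rw [Metric.isOpen_ball.interior_eq] at ht'
      rw [(hder t' ht').deriv]
      exact (hball _ (hmem t' ht')).1.2
    have h7 : S (consE m (v, 0)) = 0 :=
      (hball (v, 0) (hmem 0 (Metric.mem_ball_self hr))).2
    have h8 := hmono.le_iff_le (Metric.mem_ball_self hr) ht
    simp only [h7] at h8
    exact h8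
  have h4 : ∀ᶠ p : E m × ℝ in 𝓝 ((consE m).symm (incE m v₀)), (0 ≤ S (consE m p) ↔ 0 ≤ p.2) := by
    rw [incE_apply, ContinuousLinearEquiv.symm_apply_apply]
    exact Metric.eventually_nhds_iff_ball.2 ⟨r, hr, h3⟩
  refine (((consE m).symm.continuous.tendsto _).eventually h4).mono fun u hu => ?_
  rw [ContinuousLinearEquiv.apply_symm_apply] at hu
  exact hu

variable {M : Type*} [TopologicalSpace M] [ChartedSpace (E (m + 1)) M]
  [IsManifold (𝓡 (m + 1)) ∞ M] [T2Space M] [SigmaCompactSpace M] [MeasurableSpace M] [BorelSpace M]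
  {N : Type*} [TopologicalSpace N] [ChartedSpace (E m) N]
  [IsManifold (𝓡 m) ∞ N] [T2Space N] [SigmaCompactSpace N] [MeasurableSpace N] [BorelSpace N]
  {ι : N → M} {s : M → ℝ} (hs : Smooth (n := m + 1) s) (h0 : ∀ y, s (ι y) = 0)
  (g : Metric (m + 1) M)
include hs h0

/-- By Cramer's rule the determinant of the induced metric is det G · G⁰⁰, and |∇s|² = G⁰⁰(∂₀s)² on
Σ. The product of the square roots is the normal component of the flux. -/
lemma IsAdapted.sqrt_det_mul_sqrt_pair {e : OpenPartialHomeomorph M (E (m + 1))}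
    {eN : OpenPartialHomeomorph N (E m)} (h : IsAdapted ι e eN)
    (hι : ContMDiff (𝓡 m) (𝓡 (m + 1)) ∞ ι) {v : E m} (hv : v ∈ eN.target)
    (hp : 0 < pd 0 (s ∘ e.symm) (incE m v)) :
    Real.sqrt (gramE (g.pullback ι : FormField m N) eN v).det *
        Real.sqrt (g.pair s s (ι (eN.symm v))) =
      flux (gramE g.form e) (s ∘ e.symm) 0 (incE m v) := by
  have hG := (metricGerm_gramE (g := g) h.isChart (h.mem_target hv).1).self_of_nhds.2
  have hG0 : 0 < (gramE g.form e (incE m v))⁻¹ 0 0 := hG.inv.diag_pos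
  rw [h.gramE_pullback hι g hv, ← det_mul_inv_zero_zero hG.det_pos.ne',
    h.pair_self_eq hs h0 g hv, flux, Real.sqrt_mul hG.det_pos.le, Real.sqrt_mul hG0.le,
    Real.sqrt_sq hp.le, Fin.sum_univ_succ]
  simp only [h.pd_succ_eq_zero hs h0 hv, mul_zero, Finset.sum_const_zero, add_zero]
  have := Real.mul_self_sqrt hG0.le
  linear_combination (Real.sqrt (gramE g.form e (incE m v)).det * pd 0 (s ∘ e.symm) (incE m v)) * this

/-- In an adapted chart {s ≥ 0} is a half-space, and the coordinate divergence theorem leaves the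
boundary flux computed in `IsAdapted.sqrt_det_mul_sqrt_pair`. -/
lemma lev_gdiv_eq_local (hι : Manifold.IsSmoothEmbedding (𝓡 m) (𝓡 (m + 1)) ∞ ι) (y₀ : N)
    (hd : diff (n := m + 1) s (ι y₀) ≠ 0) :
    ∃ O ∈ 𝓝 (ι y₀), ∀ k : M → ℝ, Smooth (n := m + 1) k → HasCompactSupport k → tsupport k ⊆ O →
      lev g.vol s (g.gdiv k s) 0 = -∫ y, k (ι y) * Real.sqrt (g.pair s s (ι y))
        ∂volumeMeasure (g.pullback ι : FormField m N) := by
  have hιs : ContMDiff (𝓡 m) (𝓡 (m + 1)) ∞ ι := hι.contMDiff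
  obtain ⟨e, eN, h, hy₀, hpos⟩ := exists_isAdapted_pos hs h0 g hι.isImmersion y₀ hd
  set v₀ := eN y₀
  have hv₀ : v₀ ∈ eN.target := eN.map_source hy₀
  obtain ⟨ht, hιv⟩ := h.mem_target hv₀
  rw [eN.left_inv hy₀] at hιv
  have hS : ContDiffAt ℝ ∞ (s ∘ e.symm) (incE m v₀) := h.isChart.contDiffAt_comp_symm le_rfl ht (hs _)
  have hB : ∀ᶠ u in 𝓝 (incE m v₀), (0 ≤ (s ∘ e.symm) u ↔ 0 ≤ u 0) ∧ 0 < pd 0 (s ∘ e.symm) u ∧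
      ((consE m).symm u).1 ∈ eN.target := by
    refine (eventually_nonneg_iff hS ?_ hpos).and
      (((contDiffAt_pd hS 0).continuousAt.eventually_const_lt hpos).and ?_)
    · filter_upwards [eN.open_target.mem_nhds hv₀] with w hw
      simp only [Function.comp, (h.mem_target hw).2, h0]
    · refine ((continuous_fst.comp (consE m).symm.continuous).tendsto _).eventually ?_
      rw [Function.comp, incE_apply, ContinuousLinearEquiv.symm_apply_apply]
      exact eN.open_target.mem_nhds hv₀
  -- Embeddedness enters here: `O'` keeps out other portions of Σ that might come near ι y₀, so that
  -- only points of the chart `eN` contribute to the boundary integral.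
  obtain ⟨O', hO', hO'N⟩ := hι.isEmbedding.isInducing.isOpen_iff.1 eN.open_source
  have hy₀e : ι y₀ ∈ e.source := h.mapsTo _ hy₀
  have hOe : ∀ᶠ x in 𝓝 (ι y₀), (0 ≤ (s ∘ e.symm) (e x) ↔ 0 ≤ e x 0) ∧
      0 < pd 0 (s ∘ e.symm) (e x) ∧ ((consE m).symm (e x)).1 ∈ eN.target := by
    have h1 := e.continuousAt hy₀e
    rw [ContinuousAt, h.eq_inc _ hy₀] at h1
    exact h1.eventually hB
  refine ⟨_, inter_mem (inter_mem (e.open_source.mem_nhds hy₀e) hOe)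
    (hO'.mem_nhds (show ι y₀ ∈ O' by rw [← mem_preimage, hO'N]; exact hy₀)), fun k hk hc hkO => ?_⟩
  have hke : tsupport k ⊆ e.source := fun x hx => (hkO hx).1.1
  have hk1 : ContMDiff (𝓡 (m + 1)) 𝓘(ℝ) 1 k := hk.of_le (by simp)
  have hkN : ∀ y, ι y ∈ tsupport k → y ∈ eN.source := fun y hy => by
    rw [← hO'N]; exact (hkO hy).2
  have hincN : ∀ v, incE m v ∈ e '' tsupport k → v ∈ eN.target := by
    rintro v ⟨x, hx, hxv⟩
    have h1 := (hkO hx).1.2.2.2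
    rwa [hxv, incE_apply, ContinuousLinearEquiv.symm_apply_apply] at h1
  have hmeas : Measurable ({x | 0 ≤ s x}.indicator (g.gdiv k s)) :=
    (smooth_gdiv hk hs).continuous.measurable.indicator
      (isClosed_le continuous_const hs.continuous).measurableSet
  have hsupp : Function.support ({x | 0 ≤ s x}.indicator (g.gdiv k s)) ⊆ e.source := by
    intro x hx
    refine hke (tsupport_gdiv_subset (g := g) (h := s) (subset_tsupport _ ?_))
    exact fun h1 => hx (by simp [indicator_apply, h1])
  have hlhs : lev g.vol s (g.gdiv k s) 0 = ∫ u in {u : E (m + 1) | 0 ≤ u 0},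
      ∑ i, pd i (chartFlux g e k s i) u := by
    rw [lev, Metric.vol, integral_eq_chart (isContForm_form g) h.isChart hmeas hsupp,
      ← integral_indicator (isClosed_le continuous_const (by fun_prop)).measurableSet]
    refine Eq.trans ?_ (setIntegral_eq_integral_of_forall_compl_eq_zero (s := e.target) ?_)
    · refine setIntegral_congr_fun e.open_target.measurableSet fun u hu => ?_
      by_cases hx : e.symm u ∈ tsupport k
      · have h1 := (hkO hx).1.2.1
        rw [e.right_inv hu] at h1
        simp only [indicator_apply, mem_ofPred_eq, ← h1, Function.comp]
        split_ifs
        · exact (sum_pd_chartFlux g h.isChart hk1 hs hu).symm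
        · rw [mul_zero]
      · have h1 : u ∉ e '' tsupport k := by
          rintro ⟨x, hx', rfl⟩
          exact hx (by rwa [e.left_inv (hke hx')])
        simp only [indicator_apply, sum_pd_chartFlux_eq_zero g hc hke h1, Metric.gdiv,
          divergence_eq_zero g hx, ite_self, mul_zero]
    · intro u hu
      have h1 : u ∉ e '' tsupport k := by
        rintro ⟨x, hx', rfl⟩
        exact hu (e.map_source (hke hx'))
      simp only [indicator_apply, sum_pd_chartFlux_eq_zero g hc hke h1, ite_self]
  have hcN : Continuous fun y => k (ι y) * Real.sqrt (g.pair s s (ι y)) :=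
    (hk.continuous.comp hιs.continuous).mul
      (Real.continuous_sqrt.comp ((smooth_pair hs hs).continuous.comp hιs.continuous))
  rw [hlhs, integral_halfSpace _ (contDiff_chartFlux g h.isChart hk1 hc hke hs)
    (hasCompactSupport_chartFlux g hc hke),
    integral_eq_chart (isContForm_pullback g hιs) h.isChart_dom hcN.measurable,
    ← setIntegral_eq_integral_of_forall_compl_eq_zero (s := eN.target)]
  · congr 1
    refine setIntegral_congr_fun eN.open_target.measurableSet fun v hv => ?_
    obtain ⟨h1, h2⟩ := h.mem_target hv
    simp only [chartFlux, indicator_of_mem h1]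
    rw [h2]
    by_cases hx : ι (eN.symm v) ∈ tsupport k
    · have h3 := (hkO hx).1.2.2.1
      rw [h.eq_inc _ (eN.map_target hv), eN.right_inv hv] at h3
      rw [← h.sqrt_det_mul_sqrt_pair hs h0 g hιs hv h3]
      ring
    · rw [image_eq_zero_of_notMem_tsupport hx]; simp
  · intro v hv
    refine image_eq_zero_of_notMem_tsupport fun h1 => hv (hincN v ?_)
    exact tsupport_chartFlux g hc hke 0 h1
  · intro y hy
    refine hkN y (subset_tsupport _ fun h1 => hy (by simp [h1]))

end Boundary

/-! ### Global divergence theorem, and the first jet as an integral over the hypersurface. -/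

section Boundary

variable {m : ℕ} {M : Type*} [TopologicalSpace M] [ChartedSpace (E (m + 1)) M]
  [IsManifold (𝓡 (m + 1)) ∞ M] [T2Space M] [SigmaCompactSpace M] [MeasurableSpace M] [BorelSpace M]
  {N : Type*} [TopologicalSpace N] [ChartedSpace (E m) N]
  [IsManifold (𝓡 m) ∞ N] [T2Space N] [CompactSpace N] [MeasurableSpace N] [BorelSpace N]
  {ι : N → M} {s χ k h : M → ℝ} (g : Metric (m + 1) M)
  (hι : Manifold.IsSmoothEmbedding (𝓡 m) (𝓡 (m + 1)) ∞ ι)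
  (hs : Smooth (n := m + 1) s) (h0 : {x | s x = 0} = range ι)
  (hd : ∀ x ∈ range ι, diff (n := m + 1) s x ≠ 0)

omit [T2Space M] [SigmaCompactSpace M] [MeasurableSpace M] [BorelSpace M] in
lemma integrable_volumeMeasure_pullback {f : N → ℝ}
    (hι : ContMDiff (𝓡 m) (𝓡 (m + 1)) ∞ ι) (hf : Continuous f) :
    Integrable f (volumeMeasure (g.pullback ι : FormField m N)) := by
  have := isLocallyFiniteMeasure_volumeMeasure (isContForm_pullback g hι)
  exact hf.integrable_of_hasCompactSupport (HasCompactSupport.of_compactSpace f)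

include hι hs h0 hd

/-- The divergence theorem: the integral of `div(k∇s)` over `{s ≥ 0}` is the flux through the
boundary `{s = 0}`. -/
theorem lev_gdiv_eq (hk : Smooth (n := m + 1) k) (hc : HasCompactSupport k) :
    lev g.vol s (g.gdiv k s) 0 = -∫ y, k (ι y) * Real.sqrt (g.pair s s (ι y))
      ∂volumeMeasure (g.pullback ι : FormField m N) := by
  have hιs := hι.contMDiff
  have hι0 : ∀ y, s (ι y) = 0 := fun y => by
    have : ι y ∈ {x | s x = 0} := h0 ▸ mem_range_self y
    exact this
  have hcN : ∀ {k : M → ℝ}, Smooth (n := m + 1) k →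
      Continuous fun y => k (ι y) * Real.sqrt (g.pair s s (ι y)) := fun hk =>
    (hk.continuous.comp hιs.continuous).mul
      (Real.continuous_sqrt.comp ((smooth_pair hs hs).continuous.comp hιs.continuous))
  have hoff : ∀ f : M → ℝ, (∀ x ∈ tsupport f, s x ≠ 0) →
      -∫ y, f (ι y) * Real.sqrt (g.pair s s (ι y))
        ∂volumeMeasure (g.pullback ι : FormField m N) = 0 := by
    intro f hf
    rw [integral_congr_ae (Eventually.of_forall fun y => ?_), integral_zero, neg_zero]
    change f (ι y) * _ = 0
    rw [image_eq_zero_of_notMem_tsupport fun h1 => hf _ h1 (hι0 y), zero_mul]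
  refine compactSupport_induction (P := fun k => lev g.vol s (g.gdiv k s) 0 =
    -∫ y, k (ι y) * Real.sqrt (g.pair s s (ι y)) ∂volumeMeasure (g.pullback ι : FormField m N))
    le_rfl hk hc ?_ ?_ ?_
  · have h1 : g.gdiv (fun _ => 0) s = fun _ => 0 := by
      funext x
      rw [Metric.gdiv, diff_const, dual_zero_left, zero_mul, add_zero]
    simp [h1, lev]
  · intro f f' hf hfc hf' hfc' _ _ h1 h2
    have h3 : g.gdiv (fun x => f x + f' x) s = fun x => g.gdiv f s x + g.gdiv f' s x := by
      funext x
      rw [Metric.gdiv, diff_add (Smooth.mdiff hf x) (Smooth.mdiff hf' x), dual_add_left, Metric.gdiv, Metric.gdiv]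
      ring
    have hgc : ∀ {f : M → ℝ}, HasCompactSupport f → HasCompactSupport (g.gdiv f s) := fun hf =>
      hf.of_isClosed_subset (isClosed_tsupport _) tsupport_gdiv_subset
    rw [h3, lev_add g.vol hs.continuous (smooth_gdiv hf hs).continuous (hgc hfc)
      (smooth_gdiv hf' hs).continuous (hgc hfc'), h1, h2]
    simp only [add_mul]
    rw [integral_add (integrable_volumeMeasure_pullback g hιs (hcN hf))
      (integrable_volumeMeasure_pullback g hιs (hcN hf')), neg_add]
  · intro x
    -- Off Σ the flux term vanishes. For s < 0 the region {s ≥ 0} does not meet the support, and for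
    -- s > 0 it contains it, which is Green's identity.
    rcases lt_trichotomy (s x) 0 with hx | hx | hx
    · refine ⟨{x | s x < 0}, (isOpen_lt hs.continuous continuous_const).mem_nhds hx,
        fun f hf hfc hfO _ => ?_⟩
      rw [hoff f fun y hy => (show s y < 0 from hfO hy).ne, lev,
        integral_congr_ae (Eventually.of_forall fun y => ?_), integral_zero]
      refine indicator_apply_eq_zero.2 fun hy => ?_
      exact divergence_eq_zero g fun h1 => absurd (show s y < 0 from hfO h1) (not_lt.2 hy)
    · obtain ⟨y₀, rfl⟩ : x ∈ range ι := h0 ▸ hx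
      obtain ⟨O, hO, hP⟩ := lev_gdiv_eq_local hs hι0 g hι y₀ (hd _ (mem_range_self y₀))
      exact ⟨O, hO, fun f hf hfc hfO _ => hP f hf hfc hfO⟩
    · refine ⟨{x | 0 < s x}, (isOpen_lt continuous_const hs.continuous).mem_nhds hx,
        fun f hf hfc hfO _ => ?_⟩
      rw [hoff f fun y hy => (show 0 < s y from hfO hy).ne']
      refine Eq.trans (integral_congr_ae (Eventually.of_forall fun y => ?_))
        (green g (hf.of_le (by simp)) hfc hs)
      by_cases hy : y ∈ tsupport f
      · exact indicator_of_mem (s := {x | 0 ≤ s x}) (show 0 < s y from hfO hy).le _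
      · simp only [indicator_apply, Metric.gdiv, divergence_eq_zero g hy, ite_self]

/-- The derivative is the outward flux of k∇s/|∇s|² through Σ, that is, -k/|∇s|²·|∇s|: the coarea
formula at the level t = 0. -/
lemma Adm.deriv_lev_zero (hk : Adm (n := m + 1) s k) : deriv (lev g.vol s k) 0 =
    -∫ y, k (ι y) / Real.sqrt (g.pair s s (ι y))
      ∂volumeMeasure (g.pullback ι : FormField m N) := by
  rw [hk.deriv_lev hs, Metric.transport,
    lev_gdiv_eq g hι hs h0 hd (hk.div (g := g) hs).smooth (hk.div (g := g) hs).compact]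
  congr 1
  refine integral_congr_ae (Eventually.of_forall fun y => ?_)
  have h1 := pair_self_pos (g := g) (hd _ (mem_range_self y))
  have h2 := Real.sqrt_pos.2 h1
  change k (ι y) / g.pair s s (ι y) * _ = _
  rw [div_mul_eq_mul_div, div_eq_div_iff h1.ne' h2.ne', mul_assoc, Real.mul_self_sqrt h1.le]

lemma jet_one (hχ : IsCutoff (n := m + 1) s χ) (hh : Smooth (n := m + 1) h) :
    jet g s χ 1 h = -∫ y, h (ι y) / Real.sqrt (g.pair s s (ι y))
      ∂volumeMeasure (g.pullback ι : FormField m N) := by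
  rw [jet, iteratedDeriv_one, (hχ.adm.mul_right hh).deriv_lev_zero g hι hs h0 hd]
  congr 1
  refine integral_congr_ae (Eventually.of_forall fun y => ?_)
  have h1 : s (ι y) = 0 := by
    have : ι y ∈ {x | s x = 0} := h0 ▸ mem_range_self y
    exact this
  simp only [(hχ.eq_one _ h1).self_of_nhds, one_mul]

end Boundary

/-! ### Asymptotic expansions -/

section Expansions

/-- The weighted average of `f` over the segment from `0` to `x`. -/
def segAvg (k : ℕ) (f : ℝ → ℝ) (x : ℝ) : ℝ := ∫ t in (0 : ℝ)..1, t ^ k * f (t * x)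

/-- Each differentiation under the integral brings out one factor t. The weight t^k is included so
that the family is closed under derivatives. -/
lemma hasDerivAt_segAvg (k : ℕ) {f : ℝ → ℝ} (hf : ContDiff ℝ 1 f) (x : ℝ) :
    HasDerivAt (segAvg k f) (segAvg (k + 1) (deriv f) x) x := by
  have hf' : Continuous (deriv f) := hf.continuous_deriv (by simp)
  obtain ⟨C, hC⟩ := (isCompact_closedBall (0 : ℝ) (|x| + 1)).exists_bound_of_continuousOn hf'.continuousOn
  refine (intervalIntegral.hasDerivAt_integral_of_dominated_loc_of_deriv_le (𝕜 := ℝ)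
    (F := fun x t => t ^ k * f (t * x)) (F' := fun x t => t ^ (k + 1) * deriv f (t * x))
    (s := Metric.ball x 1) (bound := fun _ => C) (Metric.ball_mem_nhds x one_pos) ?_ ?_ ?_ ?_ ?_ ?_).2
  · refine Eventually.of_forall fun y => Continuous.aestronglyMeasurable ?_
    have := hf.continuous
    fun_prop
  · refine Continuous.intervalIntegrable ?_ _ _
    have := hf.continuous
    fun_prop
  · refine Continuous.aestronglyMeasurable ?_
    fun_prop
  · refine Eventually.of_forall fun t ht y hy => ?_
    rw [uIoc_of_le zero_le_one] at ht
    have h1 : t * y ∈ Metric.closedBall (0 : ℝ) (|x| + 1) := by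
      rw [mem_closedBall_zero_iff, Real.norm_eq_abs, abs_mul, abs_of_pos ht.1]
      rw [Metric.mem_ball, Real.dist_eq] at hy
      have h2 : |y| ≤ |x| + 1 := by
        have := abs_sub_abs_le_abs_sub y x
        linarith
      nlinarith [abs_nonneg y, ht.1, ht.2]
    rw [norm_mul, norm_pow, Real.norm_eq_abs, abs_of_pos ht.1]
    exact (mul_le_of_le_one_left (norm_nonneg _) (pow_le_one₀ ht.1.le ht.2)).trans (hC _ h1)
  · simp
  · refine Eventually.of_forall fun t _ y _ => ?_
    have h1 := (((hf.differentiable (by simp)) (t * y)).hasDerivAt.comp y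
      ((hasDerivAt_id y).const_mul t)).const_mul (t ^ k)
    refine h1.congr_deriv ?_
    ring

lemma contDiff_segAvg (k : ℕ) {f : ℝ → ℝ} (hf : ContDiff ℝ ∞ f) : ContDiff ℝ ∞ (segAvg k f) := by
  refine contDiff_infty.2 fun m => ?_
  induction m generalizing k f with
  | zero =>
    exact contDiff_zero.2 (continuous_iff_continuousAt.2 fun x =>
      (hasDerivAt_segAvg k (hf.of_le (by simp)) x).continuousAt)
  | succ m ih =>
    rw [Nat.cast_add, Nat.cast_one, contDiff_succ_iff_deriv]
    have h1 := hasDerivAt_segAvg k (hf.of_le (m := 1) (by simp))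
    refine ⟨fun x => (h1 x).differentiableAt, by simp, ?_⟩
    rw [show deriv (segAvg k f) = segAvg (k + 1) (deriv f) from funext fun x => (h1 x).deriv]
    exact ih (k + 1) (contDiff_infty_iff_deriv.1 hf).2

/-- Hadamard's lemma. -/
lemma exists_contDiff_eq_add_mul {f : ℝ → ℝ} (hf : ContDiff ℝ ∞ f) :
    ∃ h : ℝ → ℝ, ContDiff ℝ ∞ h ∧ ∀ x, f x = f 0 + x * h x := by
  refine ⟨segAvg 0 (deriv f), contDiff_segAvg 0 (contDiff_infty_iff_deriv.1 hf).2, fun x => ?_⟩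
  simp only [segAvg, pow_zero, one_mul]
  rw [intervalIntegral.mul_integral_comp_mul_right, zero_mul, one_mul,
    intervalIntegral.integral_deriv_eq_sub' f rfl
      (fun y _ => hf.differentiable (by simp) y) ((hf.continuous_deriv (by simp)).continuousOn)]
  ring

/-- Taylor's formula with a smooth remainder. -/
lemma exists_contDiff_taylor {f : ℝ → ℝ} (hf : ContDiff ℝ ∞ f) (d : ℕ) :
    ∃ h : ℝ → ℝ, ContDiff ℝ ∞ h ∧ ∀ x,
      f x = ∑ j ∈ Finset.range d, iteratedDeriv j f 0 / j.factorial * x ^ j + x ^ d * h x := by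
  induction d generalizing f with
  | zero => exact ⟨f, hf, fun x => by simp⟩
  | succ d ih =>
    obtain ⟨h, hh, hfh⟩ := exists_contDiff_eq_add_mul hf
    obtain ⟨r, hr, hhr⟩ := ih hh
    refine ⟨r, hr, fun x => ?_⟩
    have h1 : ∀ j, iteratedDeriv (j + 1) f 0 = (j + 1) * iteratedDeriv j h 0 := by
      intro j
      have h2 : f = fun x => f 0 + x * h x := funext hfh
      have h3 : deriv f = deriv fun x => x * h x := by
        rw [h2]
        funext y
        simp
      rw [iteratedDeriv_succ', h3, ← iteratedDeriv_succ', iteratedDeriv_id_mul hh]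
      simp
    rw [Finset.sum_range_succ', hfh x, hhr x]
    have h4 : ∀ j ∈ Finset.range d, iteratedDeriv (j + 1) f 0 / (j + 1).factorial * x ^ (j + 1) =
        x * (iteratedDeriv j h 0 / j.factorial * x ^ j) := by
      intro j _
      rw [h1, Nat.factorial_succ]
      push_cast
      have : (j.factorial : ℝ) ≠ 0 := by positivity
      have : (j : ℝ) + 1 ≠ 0 := by positivity
      field_simp
      ring
    rw [Finset.sum_congr rfl h4, ← Finset.mul_sum]
    simp
    ring

/-- The antiderivative of `f(ε)/ε^d` has an expansion with a logarithm, whose coefficient is the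
Taylor coefficient of `f` of order `d - 1`. -/
lemma hasAnomaly_of_hasDerivAt {d : ℕ} {f V : ℝ → ℝ} (hf : ContDiff ℝ ∞ f)
    (hV : ∀ᶠ ε in 𝓝[>] (0 : ℝ), HasDerivAt V (f ε / ε ^ (d + 1)) ε) :
    HasAnomaly (d + 1) V (iteratedDeriv d f 0 / d.factorial) := by
  obtain ⟨h, hh, hfh⟩ := exists_contDiff_taylor hf (d + 1)
  set a : ℕ → ℝ := fun j => iteratedDeriv j f 0 / j.factorial with ha
  -- The term a_j ε^{j-d-1} has antiderivative a_j ε^{j-d}/(j-d); with k = d-j this is the polar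
  -- part. The index j = d gives the logarithm, and ε·segAvg 0 h ε is the integral of the smooth
  -- remainder.
  set Φ : ℝ → ℝ := fun ε => ∑ k ∈ Finset.Icc 1 d, -(a (d - k) / k) / ε ^ k + a d * Real.log ε +
    ε * segAvg 0 h ε with hΦ
  have hR : ∀ x, x * segAvg 0 h x = ∫ t in (0 : ℝ)..x, h t := by
    intro x
    simp only [segAvg, pow_zero, one_mul]
    rw [intervalIntegral.mul_integral_comp_mul_right, zero_mul, one_mul]
  have hderiv : ∀ ε, 0 < ε → HasDerivAt Φ (f ε / ε ^ (d + 1)) ε := by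
    intro ε hε
    have h1 : ∀ k ∈ Finset.Icc 1 d, HasDerivAt (fun ε : ℝ => -(a (d - k) / k) / ε ^ k)
        (a (d - k) * ε ^ (d - k) / ε ^ (d + 1)) ε := by
      intro k hk
      obtain ⟨hk1, hk2⟩ := Finset.mem_Icc.1 hk
      have h2 := (hasDerivAt_const ε (-(a (d - k) / k))).fun_div (hasDerivAt_pow k ε) (pow_pos hε k).ne'
      refine h2.congr_deriv ?_
      obtain ⟨k, rfl⟩ : ∃ k', k = k' + 1 := ⟨k - 1, by omega⟩
      obtain ⟨j, rfl⟩ : ∃ j, d = k + 1 + j := ⟨d - (k + 1), by omega⟩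
      have h3 : ((k + 1 : ℕ) : ℝ) ≠ 0 := by positivity
      have h4 := hε.ne'
      rw [show k + 1 + j - (k + 1) = j by omega, Nat.add_sub_cancel]
      field_simp
      ring
    have h2 := ((HasDerivAt.fun_sum h1).add ((Real.hasDerivAt_log hε.ne').const_mul (a d))).add
      (intervalIntegral.integral_hasDerivAt_right (hh.continuous.intervalIntegrable 0 ε)
        (hh.continuous.stronglyMeasurableAtFilter _ _) hh.continuous.continuousAt)
    simp only [hΦ, hR]
    refine h2.congr_deriv ?_
    have hfa : f ε = ∑ j ∈ Finset.range (d + 1), a j * ε ^ j + ε ^ (d + 1) * h ε := hfh ε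
    clear_value a
    rw [hfa, Finset.sum_range_succ, ← Finset.sum_div]
    have h3 : ∑ k ∈ Finset.Icc 1 d, a (d - k) * ε ^ (d - k) = ∑ j ∈ Finset.range d, a j * ε ^ j := by
      refine Finset.sum_bij' (fun k _ => d - k) (fun j _ => d - j) ?_ ?_ ?_ ?_ ?_
      · intro k hk; simp only [Finset.mem_Icc, Finset.mem_range] at *; omega
      · intro k hk; simp only [Finset.mem_Icc, Finset.mem_range] at *; omega
      · intro k hk; simp only [Finset.mem_Icc] at *; omega
      · intro k hk; simp only [Finset.mem_range] at *; omega
      · intro k hk; rfl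
    rw [h3]
    have h4 := hε.ne'
    field_simp
    ring
  obtain ⟨δ, hδ, hVδ⟩ : ∃ δ > 0, ∀ ε ∈ Ioo 0 δ, HasDerivAt V (f ε / ε ^ (d + 1)) ε := by
    obtain ⟨δ, hδ, hsub⟩ := mem_nhdsGT_iff_exists_Ioo_subset.1 hV
    exact ⟨δ, hδ, fun ε hε => hsub hε⟩
  have hconst : ∀ ε ∈ Ioo 0 δ, V ε - Φ ε = V (δ / 2) - Φ (δ / 2) := by
    have hd : ∀ ε ∈ Ioo 0 δ, HasDerivAt (fun ε => V ε - Φ ε) 0 ε := fun ε hε => by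
      have := (hVδ ε hε).sub (hderiv ε hε.1)
      rwa [sub_self] at this
    intro ε hε
    refine (convex_Ioo (0 : ℝ) δ).is_const_of_fderivWithin_eq_zero (𝕜 := ℝ)
      (f := fun ε => V ε - Φ ε) (fun x hx => (hd x hx).differentiableAt.differentiableWithinAt) ?_ hε
      ⟨half_pos hδ, half_lt_self hδ⟩
    intro x hx
    rw [fderivWithin_of_isOpen isOpen_Ioo hx]
    ext
    simpa using (hd x hx).deriv
  refine ⟨fun k => -(a (d - k) / k), V (δ / 2) - Φ (δ / 2), segAvg 0 h, contDiff_segAvg 0 hh, ?_⟩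
  filter_upwards [Ioo_mem_nhdsGT hδ] with ε hε
  have h1 := hconst ε hε
  rw [Nat.add_sub_cancel]
  simp only [hΦ] at h1 ⊢
  linarith

/-- Differentiation lowers the power of ε by one, up to a smooth term and a nonzero factor. At power
zero the left side is unbounded unless B = 0. -/
lemma eq_zero_of_mul_pow_mul_log_eq {m : ℕ} {B : ℝ} {p : ℝ → ℝ} (hp : ContDiff ℝ ∞ p)
    (h : ∀ᶠ ε in 𝓝[>] (0 : ℝ), B * (ε ^ m * Real.log ε) = p ε) : B = 0 := by
  induction m generalizing B p with
  | zero =>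
    by_contra hB
    simp only [pow_zero, one_mul] at h
    have h1 : Tendsto (fun ε => B⁻¹ * p ε) (𝓝[>] 0) (𝓝 (B⁻¹ * p 0)) :=
      (((hp.continuous.tendsto 0).const_mul _).mono_left nhdsWithin_le_nhds)
    have h2 : Tendsto Real.log (𝓝[>] 0) (𝓝 (B⁻¹ * p 0)) := h1.congr' (by
      filter_upwards [h] with ε hε
      rw [← hε, inv_mul_cancel_left₀ hB])
    exact not_tendsto_nhds_of_tendsto_atBot Real.tendsto_log_nhdsGT_zero _ h2
  | succ m ih =>
    obtain ⟨δ, hδ, hsub⟩ := mem_nhdsGT_iff_exists_Ioo_subset.1 h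
    have h1 : B * (m + 1) = 0 := by
      refine ih (p := fun ε => deriv p ε - B * ε ^ m)
        ((contDiff_infty_iff_deriv.1 hp).2.sub (by fun_prop)) ?_
      filter_upwards [Ioo_mem_nhdsGT hδ] with ε hε
      have h2 : (fun ε => B * (ε ^ (m + 1) * Real.log ε)) =ᶠ[𝓝 ε] p := by
        filter_upwards [isOpen_Ioo.mem_nhds hε] with x hx using hsub hx
      have h3 := ((hasDerivAt_pow (m + 1) ε).mul (Real.hasDerivAt_log hε.1.ne')).const_mul B
      have h4 := h2.deriv_eq
      rw [← h4]
      refine Eq.trans ?_ (congrArg (· - B * ε ^ m) h3.deriv.symm)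
      have h5 : ε ^ (m + 1) * ε⁻¹ = ε ^ m := by
        rw [pow_succ, mul_inv_cancel_right₀ hε.1.ne']
      rw [Nat.add_sub_cancel, h5]
      push_cast
      ring
    exact (mul_eq_zero.1 h1).resolve_right (by positivity)

/-- The coefficient of the logarithm is unique. -/
lemma HasAnomaly.unique {d : ℕ} {V : ℝ → ℝ} {A A' : ℝ} (h : HasAnomaly d V A)
    (h' : HasAnomaly d V A') : A = A' := by
  obtain ⟨v, c, R, hR, hV⟩ := h
  obtain ⟨v', c', R', hR', hV'⟩ := h'
  -- Multiplication of the difference of the two expansions by ε^{d-1} clears all poles and leaves a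
  -- smooth function.
  refine sub_eq_zero.1 (eq_zero_of_mul_pow_mul_log_eq (m := d - 1) (p := fun ε =>
    ∑ k ∈ Finset.Icc 1 (d - 1), (v' k - v k) * ε ^ (d - 1 - k) + ε ^ (d - 1) * (c' - c) +
      ε ^ (d - 1) * (ε * (R' ε - R ε))) (by fun_prop) ?_)
  filter_upwards [hV, hV', self_mem_nhdsWithin] with ε h1 h2 hε
  have hε0 : ε ≠ 0 := ne_of_gt hε
  have h3 : ∑ k ∈ Finset.Icc 1 (d - 1), (v' k - v k) * ε ^ (d - 1 - k) =
      ε ^ (d - 1) * (∑ k ∈ Finset.Icc 1 (d - 1), v' k / ε ^ k - ∑ k ∈ Finset.Icc 1 (d - 1), v k / ε ^ k) := by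
    rw [← Finset.sum_sub_distrib, Finset.mul_sum]
    refine Finset.sum_congr rfl fun k hk => ?_
    rw [← sub_div, mul_div_assoc', eq_div_iff (pow_ne_zero k hε0), mul_assoc, ← pow_add,
      Nat.sub_add_cancel (Finset.mem_Icc.1 hk).2]
    ring
  rw [h3]
  linear_combination ε ^ (d - 1) * (h2 - h1)

lemma HasAnomaly.congr_add_const {d : ℕ} {V V' : ℝ → ℝ} {A C : ℝ} (h : HasAnomaly d V A)
    (h' : ∀ᶠ ε in 𝓝[>] (0 : ℝ), V' ε = C + V ε) : HasAnomaly d V' A := by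
  obtain ⟨v, c, R, hR, hV⟩ := h
  refine ⟨v, C + c, R, hR, ?_⟩
  filter_upwards [hV, h'] with ε h1 h2
  rw [h2, h1]
  ring

/-- There is a smooth function on the line which equals `t^{-d}` for `t ≥ a`. -/
lemma exists_contDiff_eq_inv_pow (d : ℕ) {a : ℝ} (ha : 0 < a) :
    ∃ ψ : ℝ → ℝ, ContDiff ℝ ∞ ψ ∧ ∀ t, a ≤ t → ψ t = (t ^ d)⁻¹ := by
  -- The function b rises from 0 for t ≤ a/2 to 1 for t ≥ a, so t·b + (1-b) interpolates between 1
  -- and t through positive values, and its inverse power is smooth on the whole line.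
  set b : ℝ → ℝ := fun t => Real.smoothTransition ((t - a / 2) / (a / 2)) with hb
  have hbs : ContDiff ℝ ∞ b := Real.smoothTransition.contDiff.comp (by fun_prop)
  have hpos : ∀ t, 0 < t * b t + (1 - b t) := by
    intro t
    have h0 : 0 ≤ b t := Real.smoothTransition.nonneg _
    have h1 : b t ≤ 1 := Real.smoothTransition.le_one _
    rcases le_or_gt t (a / 2) with ht | ht
    · have h2 : b t = 0 := Real.smoothTransition.zero_of_nonpos
        (div_nonpos_of_nonpos_of_nonneg (by linarith) (by linarith))
      rw [h2]; norm_num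
    · have h3 : 0 < t := by linarith
      rcases h1.lt_or_eq with h4 | h4
      · have := mul_nonneg h3.le h0
        linarith
      · rw [h4]; linarith
  refine ⟨fun t => ((t * b t + (1 - b t)) ^ d)⁻¹, ?_, fun t ht => ?_⟩
  · exact (((contDiff_id.mul hbs).add (contDiff_const.sub hbs)).pow d).inv
      fun t => (pow_pos (hpos t) d).ne'
  · have h2 : b t = 1 := Real.smoothTransition.one_of_one_le (by
      rw [le_div_iff₀ (by linarith)]; linarith)
    simp only [h2]
    norm_num

end Expansions

/-! ### The singular integrand s^{-d} and the logarithmic coefficient. -/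

section Regularization

variable {n : ℕ} {M : Type*} [TopologicalSpace M] [ChartedSpace (E n) M] [IsManifold (𝓡 n) ∞ M]
  [T2Space M] [SigmaCompactSpace M] [MeasurableSpace M] [BorelSpace M]
  {g : Metric n M} {s k : M → ℝ} (hs : Smooth (n := n) s)
include hs

lemma Adm.deriv_lev_pow_mul (hk : Adm (n := n) s k) (d : ℕ) (t : ℝ) :
    deriv (lev g.vol s fun x => s x ^ d * k x) t = t ^ d * deriv (lev g.vol s k) t := by
  induction d with
  | zero => simp
  | succ d ih =>
    have h1 : (fun x => s x ^ (d + 1) * k x) = fun x => s x * (s x ^ d * k x) := by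
      funext x; ring
    rw [h1, (hk.mul_left (f := fun x => s x ^ d) (hs.pow d)).deriv_lev_mul_self hs, ih]
    ring

/-- Near ε only points with s ≥ ε/2 matter, so s^{-d} can be replaced by a function ψ(s) that is
smooth across the zero locus. Multiplying back by s^d gives the factor ε^d in the derivative. -/
lemma Adm.hasDerivAt_lev_div_pow (hk : Adm (n := n) s k) (d : ℕ) {ε : ℝ} (hε : 0 < ε) :
    HasDerivAt (lev g.vol s fun x => k x / s x ^ d) (deriv (lev g.vol s k) ε / ε ^ d) ε := by
  obtain ⟨ψ, hψ, hψd⟩ := exists_contDiff_eq_inv_pow d (half_pos hε)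
  have hψs : Smooth (n := n) fun x => ψ (s x) := hψ.contMDiff.comp hs
  have hk' : Adm (n := n) s fun x => ψ (s x) * k x := hk.mul_left hψs
  have h1 : lev g.vol s (fun x => ψ (s x) * k x) =ᶠ[𝓝 ε] lev g.vol s fun x => k x / s x ^ d := by
    filter_upwards [lt_mem_nhds (half_lt_self hε)] with t ht
    refine integral_congr_ae (Eventually.of_forall fun x => ?_)
    simp only [indicator_apply, mem_ofPred_eq]
    split_ifs with hx
    · rw [hψd _ (ht.le.trans hx)]; ring
    · rfl
  have h2 : lev g.vol s (fun x => s x ^ d * (ψ (s x) * k x)) =ᶠ[𝓝 ε] lev g.vol s k := by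
    filter_upwards [lt_mem_nhds (half_lt_self hε)] with t ht
    refine integral_congr_ae (Eventually.of_forall fun x => ?_)
    simp only [indicator_apply, mem_ofPred_eq]
    split_ifs with hx
    · have h3 : s x ^ d ≠ 0 := pow_ne_zero d (by linarith [show t ≤ s x from hx])
      rw [hψd _ (ht.le.trans hx), mul_inv_cancel_left₀ h3]
    · rfl
  have h3 := (hk'.hasDerivAt_lev (g := g) hs ε).congr_of_eventuallyEq h1.symm
  refine h3.congr_deriv ?_
  rw [← hk'.deriv_lev hs, ← h2.deriv_eq, hk'.deriv_lev_pow_mul hs,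
    mul_div_cancel_left₀ _ (pow_ne_zero d hε.ne')]

/-- The anomaly of the integral of `χ s^{-d}` over `{s ≥ ε}` is a Taylor coefficient of the
integral of `χ`. -/
lemma IsCutoff.hasAnomaly {χ : M → ℝ} (hχ : IsCutoff (n := n) s χ) (d : ℕ) :
    HasAnomaly (d + 1) (lev g.vol s fun x => χ x / s x ^ (d + 1))
      (jet g s χ (d + 1) (fun _ => 1) / d.factorial) := by
  -- The dimension is d+1 here: the volume has derivative L'(ε)/ε^{d+1}, and the logarithm takes the
  -- Taylor coefficient of L' of order d.
  have h1 : jet g s χ (d + 1) (fun _ => 1) = iteratedDeriv d (deriv (lev g.vol s χ)) 0 := by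
    simp only [jet, mul_one, iteratedDeriv_succ']
  rw [h1]
  refine hasAnomaly_of_hasDerivAt (contDiff_infty_iff_deriv.1 (hχ.adm.contDiff_lev hs)).2 ?_
  filter_upwards [self_mem_nhdsWithin] with ε hε
  exact hχ.adm.hasDerivAt_lev_div_pow hs (d + 1) hε

end Regularization

/-! ### Change of scale -/

section Rescaling

variable {n : ℕ} {M : Type*} [TopologicalSpace M] [ChartedSpace (E n) M] [IsManifold (𝓡 n) ∞ M]

/-- The metric `a²g`. -/
def Metric.rescale (g : Metric n M) (a : M → ℝ) (ha : Smooth (n := n) a) (ha0 : ∀ x, 0 < a x) :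
    Metric n M where
  inner x := a x ^ 2 • g.inner x
  symm x v w := by
    change a x ^ 2 * g.inner x v w = a x ^ 2 * g.inner x w v
    rw [g.symm]
  pos x v hv := mul_pos (pow_pos (ha0 x) 2) (g.pos x v hv)
  -- The unit ball of a²g is the image of the unit ball of g under multiplication by a⁻¹.
  isVonNBounded x := by
    have h1 := (g.isVonNBounded x).image
      ((a x)⁻¹ • ContinuousLinearMap.id ℝ (TangentSpace (𝓡 n) x))
    refine Bornology.IsVonNBounded.subset (fun v hv => ?_) h1
    refine (mem_image _ _ _).2 ⟨a x • v, ?_, ?_⟩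
    · have h2 : a x ^ 2 * g.inner x v v < 1 := hv
      change g.inner x (a x • v) (a x • v) < 1
      rw [map_smul, map_smul, smul_apply, smul_eq_mul, smul_eq_mul]
      linarith
    · change (a x)⁻¹ • a x • v = v
      rw [inv_smul_smul₀ (ha0 x).ne']
  contMDiff := (ha.pow 2).smul_section g.contMDiff

lemma isRescaling_rescale (g : Metric n M) {a : M → ℝ} (ha : Smooth (n := n) a)
    (ha0 : ∀ x, 0 < a x) : IsRescaling g (g.rescale a ha ha0) a := ⟨ha, ha0, fun _ _ _ => rfl⟩

lemma rescale_mem_conformalClass {g₀ g : Metric n M} (hg : g ∈ conformalClass g₀) {a : M → ℝ}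
    (ha : Smooth (n := n) a) (ha0 : ∀ x, 0 < a x) : g.rescale a ha ha0 ∈ conformalClass g₀ := by
  obtain ⟨b, hb, hb0, h⟩ := hg
  refine ⟨fun x => a x * b x, ha.mul hb, fun x => mul_pos (ha0 x) (hb0 x), fun x v w => ?_⟩
  rw [mul_pow, mul_assoc, ← h]
  rfl

variable [T2Space M] [SigmaCompactSpace M] [MeasurableSpace M] [BorelSpace M]
  {c : Set (Metric n M)} {σ τ : Family n M M} {g g' : Metric n M} {Ω : M → ℝ}

lemma integral_withDensity_pow {X : Type*} [MeasurableSpace X] (μ : Measure X) {a f f' : X → ℝ}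
    (k : ℕ) (ha : Measurable a) (ha0 : ∀ x, 0 < a x) (hf : ∀ x, a x ^ k * f' x = f x) :
    ∫ x, f' x ∂μ.withDensity (fun x => ENNReal.ofReal (a x ^ k)) = ∫ x, f x ∂μ := by
  have h1 : (fun x => ENNReal.ofReal (a x ^ k)) = fun x => ((Real.toNNReal (a x ^ k) : NNReal) : ENNReal) :=
    rfl
  rw [h1, integral_withDensity_eq_integral_smul (ha.pow_const k).real_toNNReal]
  refine integral_congr_ae (Eventually.of_forall fun x => ?_)
  simp only [NNReal.smul_def, Real.coe_toNNReal _ (pow_pos (ha0 x) k).le, smul_eq_mul, hf]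

/-- The regulated volume does not depend on the choice of a metric in the conformal class. -/
lemma regVolume_eq_of_isRescaling (hσ : IsDensity c 1 σ) (hτ : IsDensity c 1 τ) (hg : g ∈ c)
    (hg' : g' ∈ c) (h : IsRescaling g g' Ω) {D : Set M} (hD : MeasurableSet D) :
    regVolume σ τ D g' = regVolume σ τ D g := by
  funext ε
  have h1 : g'.vol = g.vol.withDensity fun x => ENNReal.ofReal (Ω x ^ n) :=
    volumeMeasure_rescale h.1.continuous h.2.1 (isContForm_form g) h.2.2
  rw [regVolume, regVolume, h1, restrict_withDensity hD]
  refine integral_withDensity_pow _ n h.1.continuous.measurable h.2.1 fun x => ?_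
  have h0 := (h.2.1 x).ne'
  have h0' := pow_ne_zero n h0
  simp only [regIntegrand, hσ.rescale_one hg hg' h, hτ.rescale_one hg hg' h,
    mul_div_mul_left _ _ h0, mul_pow]
  rw [← mul_div_assoc, mul_div_mul_left _ _ h0']

/-- The weight -m cancels the factor Ω^m by which the m-dimensional area measure scales. -/
lemma integral_eq_of_isRescaling {m : ℕ} {N : Type*} [TopologicalSpace N] [ChartedSpace (E m) N]
    [IsManifold (𝓡 m) ∞ N] [T2Space N] [SigmaCompactSpace N] [MeasurableSpace N] [BorelSpace N]
    {ι : N → M} (hι : ContMDiff (𝓡 m) (𝓡 n) ∞ ι) {q : Family n M N}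
    (hq : IsDensityAlong (m := m) ι c (-(m : ℝ)) q) (hg : g ∈ c) (hg' : g' ∈ c)
    (h : IsRescaling g g' Ω) :
    ∫ y, q g' y ∂volumeMeasure (g'.pullback ι : FormField m N) =
      ∫ y, q g y ∂volumeMeasure (g.pullback ι : FormField m N) := by
  have hc : Continuous fun y => Ω (ι y) := h.1.continuous.comp hι.continuous
  rw [volumeMeasure_rescale hc (fun y => h.2.1 _) (isContForm_pullback g hι)
    (h' := g'.pullback ι) fun y v w => h.2.2 _ _ _]
  refine integral_withDensity_pow _ m hc.measurable (fun y => h.2.1 _) fun y => ?_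
  rw [hq.2 g hg g' hg' Ω h, Real.rpow_neg (h.2.1 _).le, Real.rpow_natCast,
    mul_inv_cancel_left₀ (pow_ne_zero m (h.2.1 _).ne')]

end Rescaling

/-! ### The regulated volume -/

section Volume

variable {n : ℕ} {M : Type*} [TopologicalSpace M] [ChartedSpace (E n) M] [IsManifold (𝓡 n) ∞ M]
  [T2Space M] [SigmaCompactSpace M] [MeasurableSpace M] [BorelSpace M]
  {g : Metric n M} {s f χ : M → ℝ} {Z D U : Set M}

/-- The compact set Z lies in the open set where ds ≠ 0; the cutoff equals 1 near Z and is supported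
in a compact set between them. -/
lemma exists_isCutoff (hs : Smooth (n := n) s) (hZ : IsCompact Z) (hZ0 : {x | s x = 0} = Z)
    (hd : ∀ x ∈ Z, diff (n := n) s x ≠ 0) (g : Metric n M) (hU : IsOpen U) (hZU : Z ⊆ U) :
    ∃ χ, IsCutoff (n := n) s χ ∧ tsupport χ ⊆ U := by
  have : LocallyCompactSpace M := Manifold.locallyCompact_of_finiteDimensional (𝓡 n)
  have hopen : IsOpen (U ∩ {x | g.pair s s x ≠ 0}) :=
    hU.inter (isOpen_ne_fun (smooth_pair hs hs).continuous continuous_const)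
  obtain ⟨K, hK, hZK, hKU⟩ := exists_compact_between hZ hopen fun x hx =>
    ⟨hZU hx, (pair_self_pos (hd x hx)).ne'⟩
  obtain ⟨χ, hχ1, hχ0, -⟩ := exists_contMDiffMap_one_nhds_of_subset_interior (n := ⊤) (𝓡 n)
    hZ.isClosed hZK
  have hts : tsupport χ ⊆ K := closure_minimal
    (fun x hx => by_contra fun h => hx (hχ0 x h)) hK.isClosed
  refine ⟨χ, ⟨⟨χ.contMDiff, hK.of_isClosed_subset (isClosed_tsupport _) hts, fun x hx h0 => ?_⟩,
    fun x hx => ?_⟩, fun x hx => (hKU (hts hx)).1⟩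
  · refine (hKU (hts hx)).2 ?_
    rw [Metric.pair, h0, dual_zero_left]
  · exact (eventually_nhdsSet_iff_forall.1 hχ1) x (hZ0 ▸ hx)

lemma integrableOn_indicator_div {A : Set M} (hA : IsClosed A) (hf : ContinuousOn f A)
    (hD : IsCompact (closure D)) : IntegrableOn (A.indicator f) D g.vol := by
  have h1 : IntegrableOn f (closure D ∩ A) g.vol :=
    (hf.mono inter_subset_right).integrableOn_compact (hD.inter_right hA)
  have h2 : IntegrableOn f (A ∩ D) g.vol := h1.mono_set fun x hx => ⟨subset_closure hx.2, hx.1⟩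
  rwa [IntegrableOn, integrable_indicator_iff hA.measurableSet, IntegrableOn,
    Measure.restrict_restrict hA.measurableSet]

/-- The regulated volume in the scale of the regulator differs by a constant from the integral of
`χ s^{-d}` over `{s ≥ ε}`, if `χ` is a cutoff function. -/
lemma exists_integral_indicator_eq (hs : Smooth (n := n) s) (hχ : IsCutoff (n := n) s χ)
    (hDm : MeasurableSet D) (hD : IsCompact (closure D)) (hχD : tsupport χ ∩ {x | 0 < s x} ⊆ D)
    (d : ℕ) : ∃ C : ℝ, ∀ᶠ ε in 𝓝[>] (0 : ℝ),
      ∫ x in D, {x | ε ≤ s x}.indicator (fun x => 1 / s x ^ d) x ∂g.vol =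
        C + lev g.vol s (fun x => χ x / s x ^ d) ε := by
  have hA : ∀ ε, IsClosed {x | ε ≤ s x} := fun ε => isClosed_le continuous_const hs.continuous
  have hcont : ∀ {f : M → ℝ} {ε : ℝ}, 0 < ε → Continuous f →
      ContinuousOn (fun x => f x / s x ^ d) {x | ε ≤ s x} := fun hε hf =>
    hf.continuousOn.div (hs.continuous.pow d).continuousOn fun x hx =>
      pow_ne_zero d (hε.trans_le hx).ne'
  -- |s| has a positive minimum on the compact part of the closure of D where χ is not locally 1.
  -- Hence (1-χ)s^{-d} only lives where s ≥ δ on the positive side, and its integral is the same for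
  -- all small ε.
  obtain ⟨δ, hδ, hδs⟩ : ∃ δ > 0, ∀ x ∈ closure D, |s x| < δ → χ x = 1 := by
    have h1 : ∀ x, s x = 0 → x ∈ interior {x | χ x = 1} := fun x hx =>
      mem_interior_iff_mem_nhds.2 (hχ.eq_one x hx)
    have hK : IsCompact (closure D \ interior {x | χ x = 1}) := hD.diff isOpen_interior
    rcases (closure D \ interior {x | χ x = 1}).eq_empty_or_nonempty with he | hne
    · refine ⟨1, one_pos, fun x hx _ => ?_⟩
      by_contra h2
      exact he.subset ⟨hx, fun h3 => h2 (interior_subset (s := {x | χ x = 1}) h3)⟩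
    · obtain ⟨x, hx, hmin⟩ := hK.exists_isMinOn hne hs.continuous.abs.continuousOn
      refine ⟨|s x|, abs_pos.2 fun h2 => hx.2 (h1 x h2), fun y hy hlt => ?_⟩
      by_contra h2
      exact absurd (hmin (a := y) ⟨hy, fun h3 => h2 (interior_subset (s := {x | χ x = 1}) h3)⟩) (not_le.2 hlt)
  refine ⟨∫ x in D, {x | δ / 2 ≤ s x}.indicator (fun x => (1 - χ x) / s x ^ d) x ∂g.vol, ?_⟩
  filter_upwards [Ioo_mem_nhdsGT (half_pos hδ)] with ε hε
  have h1 : ∀ x, {x | ε ≤ s x}.indicator (fun x => 1 / s x ^ d) x =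
      {x | ε ≤ s x}.indicator (fun x => (1 - χ x) / s x ^ d) x +
        {x | ε ≤ s x}.indicator (fun x => χ x / s x ^ d) x := by
    intro x
    rw [← Pi.add_apply, ← indicator_add']
    refine congrFun (congrArg _ (funext fun y => ?_)) x
    rw [Pi.add_apply]
    ring
  have hχc := hχ.adm.smooth.continuous
  simp only [h1]
  rw [integral_add (integrableOn_indicator_div (hA ε)
    (hcont (f := fun x => 1 - χ x) hε.1 (continuous_const.sub hχc)) hD)
    (integrableOn_indicator_div (hA ε) (hcont hε.1 hχc) hD)]
  congr 1
  · refine setIntegral_congr_fun hDm fun x hx => ?_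
    simp only [indicator_apply, mem_ofPred_eq]
    by_cases h2 : δ / 2 ≤ s x
    · rw [if_pos h2, if_pos (hε.2.le.trans h2)]
    · rw [if_neg h2]
      split_ifs with h3
      · rw [hδs x (subset_closure hx) (by rw [abs_of_pos (hε.1.trans_le h3)]; linarith), sub_self,
          zero_div]
      · rfl
  · refine setIntegral_eq_integral_of_forall_compl_eq_zero fun x hx => ?_
    simp only [indicator_apply, mem_ofPred_eq]
    split_ifs with h3
    · rw [image_eq_zero_of_notMem_tsupport fun h4 => hx (hχD ⟨h4, hε.1.trans_le h3⟩), zero_div]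
    · rfl

lemma regIntegrand_eq (σ τ : Family n M M) (ε : ℝ) (g : Metric n M) :
    regIntegrand σ τ ε g = {x | ε ≤ σ g x / τ g x}.indicator fun x => 1 / σ g x ^ n := by
  funext x
  simp only [regIntegrand, heaviside, sub_nonneg, indicator_apply, mem_ofPred_eq]
  split_ifs <;> simp

lemma integrableOn_regIntegrand {σ τ : Family n M M} (hσ : Continuous (σ g)) (hτ : Continuous (τ g))
    (hτ0 : ∀ x, 0 < τ g x) (hD : IsCompact (closure D)) {ε : ℝ}
    (hε : 0 < ε) : IntegrableOn (regIntegrand σ τ ε g) D g.vol := by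
  rw [regIntegrand_eq]
  refine integrableOn_indicator_div
    (isClosed_le continuous_const (hσ.div hτ fun x => (hτ0 x).ne')) ?_ hD
  refine continuousOn_const.div (hσ.pow n).continuousOn fun x hx => pow_ne_zero n ?_
  have h1 : ε ≤ σ g x / τ g x := hx
  intro h2
  rw [h2, zero_div] at h1
  linarith

end Volume

/-! ### Assembly of the anomaly formula. -/

section Anomaly

variable {m : ℕ} {M : Type*} [TopologicalSpace M] [ChartedSpace (E (m + 1)) M]
  [IsManifold (𝓡 (m + 1)) ∞ M] [T2Space M] [SigmaCompactSpace M] [MeasurableSpace M] [BorelSpace M]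
  {N : Type*} [TopologicalSpace N] [ChartedSpace (E m) N]
  [IsManifold (𝓡 m) ∞ N] [T2Space N] [CompactSpace N] [MeasurableSpace N] [BorelSpace N]
  {ι : N → M} {g₀ : Metric (m + 1) M} {σ τ τreg : Family (m + 1) M M} {D : Set M}

/-- The anomaly in the scale of the regulator. -/
lemma hasAnomaly_of_eq_one (hm : 2 ≤ m + 1) (hι : Manifold.IsSmoothEmbedding (𝓡 m) (𝓡 (m + 1)) ∞ ι)
    {c : Set (Metric (m + 1) M)} (hσ : IsDefiningDensity c (range ι) σ) (hτ : IsTrueScale c τ)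
    (hS : ∀ g ∈ c, ∀ x, SCurv σ g x ≠ 0) (hD : MeasurableSet D) (hDc : IsCompact (closure D))
    (hcollar : ∃ U : Set M, IsOpen U ∧ range ι ⊆ U ∧ ∀ g ∈ c, U ∩ {x | 0 < σ g x} ⊆ D)
    {g : Metric (m + 1) M} (hg : g ∈ c) (h1 : ∀ x, τreg g x = 1) :
    HasAnomaly (m + 1) (regVolume σ τreg D g)
      (1 / (m.factorial * (m + 1 - 2).factorial) *
        ∫ y, QCurv σ τ ι g y ∂volumeMeasure (g.pullback ι : FormField m N)) := by
  obtain ⟨U, hU, hιU, hUD⟩ := hcollar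
  have hs : Smooth (n := m + 1) (σ g) := hσ.1.smooth hg
  have h0 := hσ.2.1 g hg
  have hd := hσ.2.2 g hg
  obtain ⟨χ, hχ, hχU⟩ := exists_isCutoff hs (isCompact_range hι.contMDiff.continuous) h0 hd g hU hιU
  obtain ⟨C, hC⟩ := exists_integral_indicator_eq (g := g) hs hχ hD hDc
    (fun x hx => hUD g hg ⟨hχU hx.1, hx.2⟩) (m + 1)
  have h2 : HasAnomaly (m + 1) (regVolume σ τreg D g)
      (jet g (σ g) χ (m + 1) (fun _ => 1) / m.factorial) := by
    refine (hχ.hasAnomaly hs m).congr_add_const (C := C) ?_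
    filter_upwards [hC] with ε hε
    rw [← hε, regVolume, regIntegrand_eq]
    simp only [h1, div_one]
  have hl : Smooth (n := m + 1) (logFam τ g) := hτ.smooth_log hg
  have h3 := jet_negDSinvPow_innerTerm hm hs hχ (σ := σ) (τ := τ) rfl (hS g hg) hl
  have h4 := (isDensity_negDSinvPow hm hσ.1 hS (m + 1 - 2) (isDensity_innerTerm hm hσ.1 hτ hS)).smooth hg
  rw [jet_one g hι hs h0 hd hχ h4] at h3
  -- On Σ, S = |∇s|², so S^{-1/2} supplies the density 1/|∇s| of `jet_one`; the sign in front of the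
  -- Q-curvature absorbs the sign there.
  have h5 : ∫ y, QCurv σ τ ι g y ∂volumeMeasure (g.pullback ι : FormField m N) =
      (m + 1 - 2).factorial * jet g (σ g) χ (m + 1) fun _ => 1 := by
    rw [← h3, ← integral_neg]
    refine integral_congr_ae (Eventually.of_forall fun y => ?_)
    have h6 : σ g (ι y) = 0 := by
      have : ι y ∈ {x | σ g x = 0} := h0 ▸ mem_range_self y
      exact this
    have h7 : SCurv σ g (ι y) = g.pair (σ g) (σ g) (ι y) := by
      rw [SCurv, h6, Metric.pair]; simp
    simp only [QCurv, QCurvBulk, h7]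
    ring
  rw [h5]
  convert h2 using 1
  have h6 : (m.factorial : ℝ) ≠ 0 := by positivity
  have h7 : ((m + 1 - 2).factorial : ℝ) ≠ 0 := by positivity
  field_simp

/-- In the metric τreg⁻²g the regulator is 1. The regulated volume and the integral of the weight -m
density Q do not depend on the representative, so the result returns to g. -/
lemma anomaly_eq (hm : 2 ≤ m + 1) (hι : Manifold.IsSmoothEmbedding (𝓡 m) (𝓡 (m + 1)) ∞ ι)
    (hσ : IsDefiningDensity (conformalClass g₀) (range ι) σ)
    (hτ : IsTrueScale (conformalClass g₀) τ) (hτreg : IsTrueScale (conformalClass g₀) τreg)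
    (hS : ∀ g ∈ conformalClass g₀, ∀ x, SCurv σ g x ≠ 0)
    (hD : MeasurableSet D) (hDc : IsCompact (closure D))
    (hcollar : ∃ U : Set M, IsOpen U ∧ range ι ⊆ U ∧
      ∀ g ∈ conformalClass g₀, U ∩ {x | 0 < σ g x} ⊆ D)
    {g : Metric (m + 1) M} (hg : g ∈ conformalClass g₀) :
    HasAnomaly (m + 1) (regVolume σ τreg D g)
      (1 / (m.factorial * (m + 1 - 2).factorial) *
        ∫ y, QCurv σ τ ι g y ∂volumeMeasure (g.pullback ι : FormField m N)) := by
  have hpos := hτreg.2 g hg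
  have ha : Smooth (n := m + 1) fun x => (τreg g x)⁻¹ :=
    (hτreg.1.smooth hg).inv fun x => (hpos x).ne'
  have ha0 : ∀ x, 0 < (τreg g x)⁻¹ := fun x => inv_pos.2 (hpos x)
  have h := isRescaling_rescale g ha ha0
  have hg' := rescale_mem_conformalClass hg ha ha0
  have h1 := hasAnomaly_of_eq_one hm hι hσ hτ hS hD hDc hcollar hg' (τreg := τreg) fun x => by
    rw [hτreg.1.rescale_one hg hg' h]
    exact inv_mul_cancel₀ (hpos x).ne'
  have hq : IsDensityAlong (m := m) ι (conformalClass g₀) (-(m : ℝ)) (QCurv σ τ ι) := by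
    have h2 := isDensityAlong_QCurv hm hι.contMDiff hσ hτ hS
    rwa [show 1 - ((m + 1 : ℕ) : ℝ) = -m by push_cast; ring] at h2
  rwa [regVolume_eq_of_isRescaling hσ.1 hτreg.1 hg hg' h hD,
    integral_eq_of_isRescaling hι.contMDiff hq hg hg' h] at h1

end Anomaly

/-- The dimension of the hypersurface is a separate variable m with d = m+1, so that substitution
gives the form ℝ^{m+1} needed by the adapted charts without truncated subtraction in the types. -/
theorem anomaly_eq_integral_QCurv {d m : ℕ} (hd : 2 ≤ d) (hdm : d = m + 1)
    {M : Type*} [TopologicalSpace M] [ChartedSpace (E d) M] [IsManifold (𝓡 d) ∞ M]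
    [T2Space M] [SigmaCompactSpace M] [MeasurableSpace M] [BorelSpace M]
    {N : Type*} [TopologicalSpace N] [ChartedSpace (E m) N]
    [IsManifold (𝓡 m) ∞ N] [T2Space N] [CompactSpace N] [MeasurableSpace N] [BorelSpace N]
    {ι : N → M} (hι : Manifold.IsSmoothEmbedding (𝓡 m) (𝓡 d) ∞ ι)
    {g₀ : Metric d M} {σ τ τreg : Family d M M}
    (hσ : IsDefiningDensity (conformalClass g₀) (range ι) σ)
    (hτ : IsTrueScale (conformalClass g₀) τ) (hτreg : IsTrueScale (conformalClass g₀) τreg)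
    (hS : ∀ g ∈ conformalClass g₀, ∀ x, SCurv σ g x ≠ 0)
    {D : Set M} (hD : MeasurableSet D) (hDc : IsCompact (closure D))
    (hcollar : ∃ U : Set M, IsOpen U ∧ range ι ⊆ U ∧
      ∀ g ∈ conformalClass g₀, U ∩ {x | 0 < σ g x} ⊆ D) :
    IsDensityAlong (m := m) ι (conformalClass g₀) (1 - (d : ℝ)) (QCurv σ τ ι) ∧
      ∀ g ∈ conformalClass g₀,
        (∀ ε : ℝ, 0 < ε → IntegrableOn (regIntegrand σ τreg ε g) D g.vol) ∧
        Integrable (QCurv σ τ ι g) (volumeMeasure (n := m) (Metric.pullback g ι)) ∧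
        ∀ A : ℝ, HasAnomaly d (regVolume σ τreg D g) A ↔
          A = 1 / ((m.factorial : ℝ) * ((d - 2).factorial : ℝ)) *
            ∫ y, QCurv σ τ ι g y ∂(volumeMeasure (n := m) (Metric.pullback g ι)) := by
  subst hdm
  have hq := isDensityAlong_QCurv hd hι.contMDiff hσ hτ hS
  refine ⟨hq, fun g hg => ⟨fun ε hε => ?_, ?_, fun A => ?_⟩⟩
  · exact integrableOn_regIntegrand (hσ.1.smooth hg).continuous (hτreg.1.smooth hg).continuous
      (hτreg.2 g hg) hDc hε
  · exact integrable_volumeMeasure_pullback g hι.contMDiff (hq.1 g hg).continuous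
  · have h1 := anomaly_eq hd hι hσ hτ hτreg hS hD hDc hcollar hg
    exact ⟨fun h => h.unique h1, fun h => h ▸ h1⟩

end RenVol

end

theorem theorem3p6 {d : ℕ} (hd : 2 ≤ d)
    -- the bulk `d`-manifold
    {M : Type*} [TopologicalSpace M] [ChartedSpace (RenVol.E d) M] [IsManifold (𝓡 d) ∞ M]
    [T2Space M] [SigmaCompactSpace M] [MeasurableSpace M] [BorelSpace M]
    -- the closed (compact, without boundary) hypersurface, embedded by `ι`
    {N : Type*} [TopologicalSpace N] [ChartedSpace (RenVol.E (d - 1)) N]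
    [IsManifold (𝓡 (d - 1)) ∞ N] [T2Space N] [CompactSpace N] [MeasurableSpace N] [BorelSpace N]
    (ι : N → M) (hι : Manifold.IsSmoothEmbedding (𝓡 (d - 1)) (𝓡 d) ∞ ι)
    -- the conformal class `[g₀]`, the defining density, and two true scales
    (g₀ : RenVol.Metric d M) (σ τ τreg : RenVol.Family d M M)
    (hσ : RenVol.IsDefiningDensity (RenVol.conformalClass g₀) (range ι) σ)
    (hτ : RenVol.IsTrueScale (RenVol.conformalClass g₀) τ)
    (hτreg : RenVol.IsTrueScale (RenVol.conformalClass g₀) τreg)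
    -- the `S`-curvature vanishes nowhere
    (hS : ∀ g ∈ RenVol.conformalClass g₀, ∀ x, RenVol.SCurv σ g x ≠ 0)
    -- the bounded region, containing a one-sided collar of the hypersurface
    (D : Set M) (hD : MeasurableSet D) (hDc : IsCompact (closure D))
    (hcollar : ∃ U : Set M, IsOpen U ∧ range ι ⊆ U ∧
      ∀ g ∈ RenVol.conformalClass g₀, U ∩ {x | 0 < σ g x} ⊆ D) :
    -- `Q^σ` is a density of weight `1 - d` along the hypersurface
    RenVol.IsDensityAlong (m := d - 1) ι (RenVol.conformalClass g₀) (1 - (d : ℝ))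
        (RenVol.QCurv σ τ ι) ∧
      -- in every scale `g`, the integrals below converge and the anomaly is the integral of `Q^σ`
      ∀ g ∈ RenVol.conformalClass g₀,
        (∀ ε : ℝ, 0 < ε → IntegrableOn (RenVol.regIntegrand σ τreg ε g) D g.vol) ∧
        Integrable (RenVol.QCurv σ τ ι g)
          (RenVol.volumeMeasure (n := d - 1) (RenVol.Metric.pullback g ι)) ∧
        ∀ A : ℝ, RenVol.HasAnomaly d (RenVol.regVolume σ τreg D g) A ↔
          A = 1 / ((Nat.factorial (d - 1) : ℝ) * (Nat.factorial (d - 2) : ℝ)) *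
            ∫ y, RenVol.QCurv σ τ ι g y
              ∂(RenVol.volumeMeasure (n := d - 1) (RenVol.Metric.pullback g ι)) := by
  exact RenVol.anomaly_eq_integral_QCurv hd (by omega) hι hσ hτ hτreg hS hD hDc hcollar
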